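/- **Chess state tracking is $\mathsf{NC}^1$-complete.** *The problem.* The input of the chess state-tracking problem is a pair consisting of a chessboard state and a finite sequence of chess moves. A chessboard state is an arbitrary placement of chess pieces on the $8\times 8$ board together with the player to move, the castling rights, and the file of the pawn that has just made a double step (if any). Moves are written in UCI notation, that is, as a pair (source square, target square), followed by the kind of the new piece exactly when a pawn is promoted; castling is written as the move of the king. The output is the chessboard state reached by playing the moves one after another under the rules of chess, where draws are ignored; if some move is illegal in the state reached before it, the output is a null state. Inputs and outputs are written as bit strings: 265 bits for a state, 15 bits for each move, 266 bits for the output. *The classes.* A Boolean circuit family $(C_n)_{n\ge 0}$, with AND, OR and NOT gates and possibly several outputs, is an $\mathsf{NC}^1$ family if for some constant $c$ and all $n$, $C_n$ has size at most $n^c+c$, depth at most $c(\lfloor\log_2 n\rfloor+1)$ (with $\lfloor\log_2 0\rfloor:=0$) and fan-in at most $2$; it is an $\mathsf{AC}^0$ family if for some constant $c$ and all $n$, $C_n$ has size at most $n^c+c$ and depth at most $c$, with unbounded fan-in. The family is $\mathsf{L}$-uniform if some deterministic Turing machine that uses $O(\log n)$ work space prints a description of $C_n$ on the input $1^n$. A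 problem is in ($\mathsf{L}$-uniform) $\mathsf{NC}^1$ if its output is computed from the bit string of the instance by an ($\mathsf{L}$-uniform) $\mathsf{NC}^1$ family. A language $A\subseteq\{0,1\}^*$ reduces to a problem $B$ by an ($\mathsf{L}$-uniform) $\mathsf{AC}^0$ reduction if there are ($\mathsf{L}$-uniform) $\mathsf{AC}^0$ families $R$ and $S$ such that for every $x\in\{0,1\}^*$, $R(x)$ is the bit string of an instance $y$ of $B$, and $S$, applied to the output of $B$ on $y$, yields the bit $[x\in A]$. A problem is ($\mathsf{L}$-uniformly) $\mathsf{NC}^1$-complete under $\mathsf{AC}^0$ reductions if it is in ($\mathsf{L}$-uniform) $\mathsf{NC}^1$ and every language in ($\mathsf{L}$-uniform) $\mathsf{NC}^1$ reduces to it by an ($\mathsf{L}$-uniform) $\mathsf{AC}^0$ reduction. *Claim.* The chess state-tracking problem in UCI notation is $\mathsf{NC}^1$-complete under $\mathsf{AC}^0$ reductions, both with $\mathsf{L}$-uniform circuits and reductions throughout and with non-uniform circuits and reductions throughout. -/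

import Mathlib

/-! ### Boolean circuits -/

namespace CircuitComplexity

/-- A gate of a Boolean circuit. The arguments of `neg`, `conj`, `disj` are indices of earlier gates
of the circuit; `conj []` and `disj []` are the constants true and false. -/
inductive Gate where
  | input (i : ℕ)
  | neg (j : ℕ)
  | conj (js : List ℕ)
  | disj (js : List ℕ)

/-- A circuit: the gates in topological order, and the list of the gates that are its outputs. -/
structure Circuit where
  gates : List Gate
  outputs : List ℕ

/-- The value of a gate on the input `x`, given the values `v` of the earlier gates.
A dangling reference is read as the constant false. -/
def Gate.value (x v : List Bool) : Gate → Bool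
  | .input i => x.getD i false
  | .neg j => !(v.getD j false)
  | .conj js => js.all fun j => v.getD j false
  | .disj js => js.any fun j => v.getD j false

/-- The depth of a gate, given the depths `d` of the earlier gates. Inputs have depth `0`. -/
def Gate.depth (d : List ℕ) : Gate → ℕ
  | .input _ => 0
  | .neg j => d.getD j 0 + 1
  | .conj js => (js.map fun j => d.getD j 0).foldr max 0 + 1
  | .disj js => (js.map fun j => d.getD j 0).foldr max 0 + 1

def Gate.fanIn : Gate → ℕ
  | .input _ => 0
  | .neg _ => 1
  | .conj js => js.length
  | .disj js => js.length

/-- The values of all gates on the input `x`, in order. -/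
def Circuit.values (C : Circuit) (x : List Bool) : List Bool :=
  C.gates.foldl (fun v g => v ++ [g.value x v]) []

/-- The output string of the circuit on the input `x`. -/
def Circuit.eval (C : Circuit) (x : List Bool) : List Bool :=
  C.outputs.map fun j => (C.values x).getD j false

/-- The depth: the largest number of logical gates on a path. -/
def Circuit.depth (C : Circuit) : ℕ :=
  (C.gates.foldl (fun d g => d ++ [g.depth d]) []).foldr max 0

/-- The size: the number of gates, wires and outputs. -/
def Circuit.size (C : Circuit) : ℕ :=
  (C.gates.map fun g => g.fanIn + 1).sum + C.outputs.length

/-- A circuit family; the member with index `n` handles the inputs of length `n`. -/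
abbrev Family := ℕ → Circuit

/-- The function on bit strings that a circuit family computes. -/
def Family.eval (C : Family) (x : List Bool) : List Bool := (C x.length).eval x

/-- Polynomial size, logarithmic depth, fan-in at most two. -/
def Family.IsNC1 (C : Family) : Prop :=
  ∃ c : ℕ, ∀ n : ℕ, (C n).size ≤ n ^ c + c ∧ (C n).depth ≤ c * (Nat.log 2 n + 1) ∧
    ∀ g ∈ (C n).gates, g.fanIn ≤ 2

/-- Polynomial size, constant depth, unbounded fan-in. -/
def Family.IsAC0 (C : Family) : Prop :=
  ∃ c : ℕ, ∀ n : ℕ, (C n).size ≤ n ^ c + c ∧ (C n).depth ≤ c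

/-! ### Descriptions of circuits -/

/-- The alphabet in which circuits are described. -/
inductive Sym where
  | tick | done | input | neg | conj | disj | output
  deriving DecidableEq

/-- A number in unary, with an end mark. -/
def unary (j : ℕ) : List Sym := List.replicate j Sym.tick ++ [Sym.done]

def Gate.describe : Gate → List Sym
  | .input i => Sym.input :: unary i
  | .neg j => Sym.neg :: unary j
  | .conj js => Sym.conj :: js.flatMap unary
  | .disj js => Sym.disj :: js.flatMap unary

/-- The description of a circuit: its gates one after another, then its outputs. -/
def Circuit.describe (C : Circuit) : List Sym :=
  C.gates.flatMap Gate.describe ++ Sym.output :: C.outputs.flatMap unary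

/-! ### Turing machines that construct circuits in logarithmic space -/

/-- Head movements. -/
inductive Dir where
  | left | stay | right
  deriving DecidableEq

/-- Tapes are infinite to the right; a head on the leftmost cell stays there when told to go left. -/
def Dir.move : Dir → ℕ → ℕ
  | .left, p => p - 1
  | .stay, p => p
  | .right, p => p + 1

/-- The symbols on the input tape: cell `0` holds a left end mark, the cells `1, …, n` hold the
input `1 ^ n`, and cell `n + 1` holds a right end mark. -/
inductive InSym where
  | leftEnd | one | rightEnd
  deriving DecidableEq

def inputTape (n p : ℕ) : InSym :=
  if p = 0 then .leftEnd else if p ≤ n then .one else .rightEnd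

/-- What a machine does in one step: next state, symbols written on the work tapes, moves of the
work heads, move of the input head, and possibly a symbol printed on the write-only output tape. -/
structure Action (Q Γ O : Type) (k : ℕ) where
  next : Q
  write : Fin k → Γ
  move : Fin k → Dir
  moveInput : Dir
  print : Option O

/-- A deterministic Turing machine with a two-way read-only input tape, `k` work tapes and a one-way
write-only output tape with alphabet `O`. It halts where `δ` is `none`. -/
structure TuringTransducer (O : Type) where
  Q : Type
  Γ : Type
  finite_Q : Finite Q
  finite_Γ : Finite Γ
  k : ℕ
  start : Q
  blank : Γ
  δ : Q → InSym → (Fin k → Γ) → Option (Action Q Γ O k)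

namespace TuringTransducer

variable {O : Type}

/-- A configuration: state, position of the input head, contents of the work tapes, positions of the
work heads, and the string printed so far. -/
structure Cfg (M : TuringTransducer O) where
  state : M.Q
  inputHead : ℕ
  tape : Fin M.k → ℕ → M.Γ
  head : Fin M.k → ℕ
  out : List O

def init (M : TuringTransducer O) : M.Cfg where
  state := M.start
  inputHead := 0
  tape := fun _ _ => M.blank
  head := fun _ => 0
  out := []

/-- One step on the input `1 ^ n`; `none` if the machine has halted. -/
def step (M : TuringTransducer O) (n : ℕ) (c : M.Cfg) : Option M.Cfg :=
  (M.δ c.state (inputTape n c.inputHead) fun i => c.tape i (c.head i)).map fun a =>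
    { state := a.next
      inputHead := min (a.moveInput.move c.inputHead) (n + 1)
      tape := fun i => Function.update (c.tape i) (c.head i) (a.write i)
      head := fun i => (a.move i).move (c.head i)
      out := c.out ++ a.print.toList }

/-- On the input `1 ^ n` the machine halts with output `w`. -/
def Outputs (M : TuringTransducer O) (n : ℕ) (w : List O) : Prop :=
  ∃ c ∈ StateTransition.eval (M.step n) M.init, c.out = w

/-- On every input `1 ^ n` the work heads visit only the first `O(log n)` cells of their tapes. -/
def IsLogSpace (M : TuringTransducer O) : Prop :=
  ∃ b : ℕ, ∀ n : ℕ, ∀ c : M.Cfg, StateTransition.Reaches (M.step n) M.init c →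
    ∀ i, c.head i ≤ b * (Nat.log 2 n + 1)

end TuringTransducer

/-- A circuit family is `L`-uniform if some Turing machine that runs in logarithmic space prints the
description of the `n`-th circuit on the input `1 ^ n`. -/
def LUniform (C : Family) : Prop :=
  ∃ M : TuringTransducer Sym, M.IsLogSpace ∧ ∀ n : ℕ, M.Outputs n (C n).describe

/-- No uniformity condition. -/
def NonUniform (_ : Family) : Prop := True

/-! ### Problems, reductions, completeness -/

/-- A computational problem: instances, written as bit strings, and for each instance a required
output, again a bit string. -/
structure Problem where
  Instance : Type
  code : Instance → List Bool
  code_injective : Function.Injective code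
  answer : Instance → List Bool

open Classical in
/-- The decision problem of a language, with a one-bit answer. -/
noncomputable def decisionProblem (L : Language Bool) : Problem where
  Instance := List Bool
  code := id
  code_injective := Function.injective_id
  answer x := [decide (x ∈ L)]

/-- The problem is solved by circuits of the class `NC¹` under the uniformity condition `U`. -/
def InNC1 (U : Family → Prop) (A : Problem) : Prop :=
  ∃ C : Family, C.IsNC1 ∧ U C ∧ ∀ x : A.Instance, C.eval (A.code x) = A.answer x

/-- `A` reduces to `B` by an `AC⁰` reduction under the uniformity condition `U`: `AC⁰` circuits `R`
turn an instance of `A` into an instance of `B`, and `AC⁰` circuits `S` read off the answer for `A`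
from the answer for `B`. -/
def AC0Reduces (U : Family → Prop) (A B : Problem) : Prop :=
  ∃ R S : Family, R.IsAC0 ∧ U R ∧ S.IsAC0 ∧ U S ∧ ∀ x : A.Instance,
    ∃ y : B.Instance, R.eval (A.code x) = B.code y ∧ S.eval (B.answer y) = A.answer x

/-- Every language in `NC¹` reduces to the problem by an `AC⁰` reduction. -/
def NC1Hard (U : Family → Prop) (B : Problem) : Prop :=
  ∀ L : Language Bool, InNC1 U (decisionProblem L) → AC0Reduces U (decisionProblem L) B

/-- The problem is complete for `NC¹` under `AC⁰` reductions; circuits and reductions both obey the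
uniformity condition `U`. -/
def NC1Complete (U : Family → Prop) (B : Problem) : Prop :=
  InNC1 U B ∧ NC1Hard U B

end CircuitComplexity

/-! ### The rules of chess -/

namespace Chess

inductive Colour where
  | white | black
  deriving DecidableEq

instance : Fintype Colour := ⟨{.white, .black}, by intro x; cases x <;> decide⟩

def Colour.other : Colour → Colour
  | .white => .black
  | .black => .white

inductive Kind where
  | pawn | knight | bishop | rook | queen | king
  deriving DecidableEq

instance : Fintype Kind := ⟨{.pawn, .knight, .bishop, .rook, .queen, .king}, by intro x; cases x <;> decide⟩

structure Piece where
  colour : Colour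
  kind : Kind
  deriving DecidableEq, Fintype

/-- Files `a, …, h` and ranks `1, …, 8` are both numbered `0, …, 7`. -/
structure Square where
  file : Fin 8
  rank : Fin 8
  deriving DecidableEq, Fintype

abbrev Board := Square → Option Piece

/-- The wings of the board, for castling. -/
inductive Wing where
  | kingside | queenside
  deriving DecidableEq

instance : Fintype Wing := ⟨{.kingside, .queenside}, by intro x; cases x <;> decide⟩

/-- A chessboard state: the pieces, the player to move, the castling rights, and the file of the pawn
that has just made a double step, if there is one. -/
structure Position where
  board : Board
  turn : Colour
  castling : Colour → Wing → Bool
  enPassant : Option (Fin 8)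
  deriving DecidableEq

/-- A move in UCI notation: source square, target square, and, for promotions only, the kind of the
new piece. Castling is written as the move of the king. -/
structure Move where
  source : Square
  target : Square
  promotion : Option Kind
  deriving DecidableEq, Fintype

/-- Signed number of files from `s` to `t`. -/
def dx (s t : Square) : ℤ := (t.file : ℤ) - s.file

/-- Signed number of ranks from `s` to `t`. -/
def dy (s t : Square) : ℤ := (t.rank : ℤ) - s.rank

/-- `u` lies on the straight segment from `s` to `t`, strictly between them. -/
def Between (s t u : Square) : Prop :=
  u ≠ s ∧ u ≠ t ∧ dx s u * dy s t = dy s u * dx s t ∧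
    min s.file t.file ≤ u.file ∧ u.file ≤ max s.file t.file ∧
    min s.rank t.rank ≤ u.rank ∧ u.rank ≤ max s.rank t.rank

instance (s t u : Square) : Decidable (Between s t u) := by unfold Between; infer_instance

/-- All squares strictly between `s` and `t` are empty. -/
def Clear (b : Board) (s t : Square) : Prop := ∀ u, Between s t u → b u = none

instance (b : Board) (s t : Square) : Decidable (Clear b s t) := by unfold Clear; infer_instance

/-- The direction in which pawns move. -/
def forward : Colour → ℤ
  | .white => 1
  | .black => -1

def homeRank : Colour → Fin 8
  | .white => 0
  | .black => 7

def pawnRank : Colour → Fin 8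
  | .white => 1
  | .black => 6

def SameLine (s t : Square) : Prop := dx s t = 0 ∨ dy s t = 0

instance (s t : Square) : Decidable (SameLine s t) := by unfold SameLine; infer_instance

def SameDiagonal (s t : Square) : Prop := |dx s t| = |dy s t|

instance (s t : Square) : Decidable (SameDiagonal s t) := by unfold SameDiagonal; infer_instance

/-- The piece `p`, standing on `s`, attacks the square `t`. -/
def PieceAttacks (b : Board) (p : Piece) (s t : Square) : Prop :=
  s ≠ t ∧ match p.kind with
    | .pawn => |dx s t| = 1 ∧ dy s t = forward p.colour
    | .knight => |dx s t| * |dy s t| = 2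
    | .bishop => SameDiagonal s t ∧ Clear b s t
    | .rook => SameLine s t ∧ Clear b s t
    | .queen => (SameLine s t ∨ SameDiagonal s t) ∧ Clear b s t
    | .king => |dx s t| ≤ 1 ∧ |dy s t| ≤ 1

instance (b : Board) (p : Piece) (s t : Square) : Decidable (PieceAttacks b p s t) := by
  obtain ⟨c, k⟩ := p
  unfold PieceAttacks
  cases k <;> infer_instance

/-- The square `t` is attacked by some piece of colour `c`. -/
def Attacked (b : Board) (c : Colour) (t : Square) : Prop :=
  ∃ s, ∃ p ∈ b s, p.colour = c ∧ PieceAttacks b p s t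

instance (b : Board) (c : Colour) (t : Square) : Decidable (Attacked b c t) := by
  unfold Attacked; infer_instance

/-- A king of colour `c` is attacked. -/
def InCheck (b : Board) (c : Colour) : Prop :=
  ∃ t, b t = some ⟨c, .king⟩ ∧ Attacked b c.other t

instance (b : Board) (c : Colour) : Decidable (InCheck b c) := by
  unfold InCheck; infer_instance

/-- The square holds a piece of colour `c` that may be captured; kings are never captured. -/
def Capturable (b : Board) (c : Colour) (t : Square) : Prop :=
  ∃ p ∈ b t, p.colour = c ∧ p.kind ≠ .king

instance (b : Board) (c : Colour) (t : Square) : Decidable (Capturable b c t) := by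
  unfold Capturable; infer_instance

/-- The initial square of the king of colour `c`. -/
def kingHome (c : Colour) : Square := ⟨4, homeRank c⟩

/-- The initial square of the rook of colour `c` on the wing `w`. -/
def rookHome (c : Colour) : Wing → Square
  | .kingside => ⟨7, homeRank c⟩
  | .queenside => ⟨0, homeRank c⟩

/-- Where the king goes when castling. -/
def kingCastled (c : Colour) : Wing → Square
  | .kingside => ⟨6, homeRank c⟩
  | .queenside => ⟨2, homeRank c⟩

/-- Where the rook goes when castling; this is also the square that the king crosses. -/
def rookCastled (c : Colour) : Wing → Square
  | .kingside => ⟨5, homeRank c⟩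
  | .queenside => ⟨3, homeRank c⟩

/-- The move is castling of the player to move on the wing `w`, as far as its squares are concerned. -/
def IsCastling (P : Position) (m : Move) (w : Wing) : Prop :=
  P.board m.source = some ⟨P.turn, .king⟩ ∧ m.source = kingHome P.turn ∧
    m.target = kingCastled P.turn w

instance (P : Position) (m : Move) (w : Wing) : Decidable (IsCastling P m w) := by
  unfold IsCastling; infer_instance

/-- Castling on the wing `w` is allowed, apart from the safety of the king on its target square. -/
def CanCastle (P : Position) (m : Move) (w : Wing) : Prop :=
  IsCastling P m w ∧ m.promotion = none ∧ P.castling P.turn w = true ∧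
    P.board (rookHome P.turn w) = some ⟨P.turn, .rook⟩ ∧
    Clear P.board (kingHome P.turn) (rookHome P.turn w) ∧
    ¬ Attacked P.board P.turn.other (kingHome P.turn) ∧
    ¬ Attacked P.board P.turn.other (rookCastled P.turn w)

instance (P : Position) (m : Move) (w : Wing) : Decidable (CanCastle P m w) := by
  unfold CanCastle; infer_instance

/-- The square of the pawn that is taken by a capture en passant from `s` to `t`. -/
def enPassantVictim (s t : Square) : Square := ⟨t.file, s.rank⟩

/-- The move is a capture en passant. -/
def IsEnPassant (P : Position) (m : Move) : Prop :=
  P.board m.source = some ⟨P.turn, .pawn⟩ ∧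
    PieceAttacks P.board ⟨P.turn, .pawn⟩ m.source m.target ∧
    P.enPassant = some m.target.file ∧
    (m.target.rank : ℤ) = pawnRank P.turn.other + forward P.turn.other ∧
    P.board m.target = none ∧
    P.board (enPassantVictim m.source m.target) = some ⟨P.turn.other, .pawn⟩

instance (P : Position) (m : Move) : Decidable (IsEnPassant P m) := by
  unfold IsEnPassant; infer_instance

/-- A move of a pawn of the player to move, apart from the promotion. -/
def PawnMove (P : Position) (m : Move) : Prop :=
  (dx m.source m.target = 0 ∧ dy m.source m.target = forward P.turn ∧ P.board m.target = none) ∨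
  (dx m.source m.target = 0 ∧ dy m.source m.target = 2 * forward P.turn ∧
    m.source.rank = pawnRank P.turn ∧ P.board m.target = none ∧
    Clear P.board m.source m.target) ∨
  (PieceAttacks P.board ⟨P.turn, .pawn⟩ m.source m.target ∧
    Capturable P.board P.turn.other m.target) ∨
  IsEnPassant P m

instance (P : Position) (m : Move) : Decidable (PawnMove P m) := by
  unfold PawnMove; infer_instance

/-- Exactly the pawns that reach the last rank are promoted, to a knight, bishop, rook or queen. -/
def PromotionOK (P : Position) (m : Move) : Prop :=
  if m.target.rank = homeRank P.turn.other then
    m.promotion ∈ [some Kind.knight, some Kind.bishop, some Kind.rook, some Kind.queen]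
  else m.promotion = none

instance (P : Position) (m : Move) : Decidable (PromotionOK P m) := by
  unfold PromotionOK; infer_instance

/-- The move follows the rules for the moving piece, apart from leaving the own king in check. -/
def PseudoLegal (P : Position) (m : Move) : Prop :=
  ∃ p ∈ P.board m.source, p.colour = P.turn ∧
    ((p.kind = .pawn ∧ PawnMove P m ∧ PromotionOK P m) ∨
     (p.kind ≠ .pawn ∧ m.promotion = none ∧ PieceAttacks P.board p m.source m.target ∧
        (P.board m.target = none ∨ Capturable P.board P.turn.other m.target)) ∨
     ∃ w, CanCastle P m w)

instance (P : Position) (m : Move) : Decidable (PseudoLegal P m) := by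
  unfold PseudoLegal; infer_instance

/-- The board after a move. -/
def boardAfter (P : Position) (m : Move) : Board :=
  let moved : Option Piece :=
    match m.promotion with
    | none => P.board m.source
    | some k => some ⟨P.turn, k⟩
  let b : Board := Function.update (Function.update P.board m.source none) m.target moved
  if IsEnPassant P m then
    Function.update b (enPassantVictim m.source m.target) none
  else if IsCastling P m .kingside then
    Function.update (Function.update b (rookHome P.turn .kingside) none)
      (rookCastled P.turn .kingside) (some ⟨P.turn, .rook⟩)
  else if IsCastling P m .queenside then
    Function.update (Function.update b (rookHome P.turn .queenside) none)
      (rookCastled P.turn .queenside) (some ⟨P.turn, .rook⟩)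
  else b

/-- The position after a move. A castling right is lost when a move starts from the initial square of
the king, or starts or ends on the initial square of the rook. -/
def positionAfter (P : Position) (m : Move) : Position where
  board := boardAfter P m
  turn := P.turn.other
  castling c w := P.castling c w && decide (m.source ≠ kingHome c ∧
    m.source ≠ rookHome c w ∧ m.target ≠ rookHome c w)
  enPassant :=
    if P.board m.source = some ⟨P.turn, .pawn⟩ ∧ |dy m.source m.target| = 2 then
      some m.source.file
    else none

/-- A legal move: it follows the rules for the moving piece and does not leave the own king attacked. -/
def Legal (P : Position) (m : Move) : Prop :=
  PseudoLegal P m ∧ ¬ InCheck (boardAfter P m) P.turn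

instance (P : Position) (m : Move) : Decidable (Legal P m) := by
  unfold Legal; infer_instance

/-- Play one move; the null state `none` if the move is illegal. -/
def play (P : Position) (m : Move) : Option Position :=
  if Legal P m then some (positionAfter P m) else none

/-- Play a sequence of moves; the null state `none` if one of them is illegal. Draws are ignored. -/
def track (P : Position) (ms : List Move) : Option Position := ms.foldlM play P

/-! ### Bit strings for positions and moves -/

/-- The `k` lowest binary digits of `n`, lowest first. -/
def bits (k n : ℕ) : List Bool := List.ofFn fun i : Fin k => n.testBit i

def Colour.number : Colour → ℕ
  | .white => 0
  | .black => 1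

def Kind.number : Kind → ℕ
  | .pawn => 1
  | .knight => 2
  | .bishop => 3
  | .rook => 4
  | .queen => 5
  | .king => 6

/-- Three bits for the kind of a piece, or none. -/
def kindBits : Option Kind → List Bool
  | none => bits 3 0
  | some k => bits 3 k.number

/-- Four bits for the contents of a square. -/
def pieceBits : Option Piece → List Bool
  | none => bits 1 0 ++ kindBits none
  | some p => bits 1 p.colour.number ++ kindBits (some p.kind)

/-- Six bits for a square. -/
def squareBits (s : Square) : List Bool := bits 3 s.file ++ bits 3 s.rank

/-- Fifteen bits for a move. -/
def Move.bits (m : Move) : List Bool :=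
  squareBits m.source ++ squareBits m.target ++ kindBits m.promotion

/-- Four bits for the en passant file, if any. -/
def enPassantBits : Option (Fin 8) → List Bool
  | none => false :: Chess.bits 3 0
  | some f => true :: Chess.bits 3 f

/-- The contents of the 64 squares, rank by rank. -/
def boardBits (b : Board) : List Bool :=
  (List.finRange 8).flatMap fun r => (List.finRange 8).flatMap fun f => pieceBits (b ⟨f, r⟩)

/-- The bit string of a position: 256 bits for the board, one for the player to move, four for the
castling rights and four for the en passant file. -/
def Position.bits (P : Position) : List Bool :=
  boardBits P.board ++ Chess.bits 1 P.turn.number ++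
    [P.castling .white .kingside, P.castling .white .queenside,
      P.castling .black .kingside, P.castling .black .queenside] ++ enPassantBits P.enPassant

/-- The bit string of a position or of the null state: one bit tells them apart, and the null state
is padded with zeros to the same length. -/
def stateBits : Option Position → List Bool
  | none => List.replicate 266 false
  | some P => true :: P.bits

/-- The bit string of a position followed by a sequence of moves. -/
def instanceBits (x : Position × List Move) : List Bool := x.1.bits ++ x.2.flatMap Move.bits

@[simp] theorem length_bits (k n : ℕ) : (bits k n).length = k := by simp [bits]

@[simp] theorem length_kindBits (k : Option Kind) : (kindBits k).length = 3 := by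
  cases k <;> simp [kindBits]

@[simp] theorem length_pieceBits (p : Option Piece) : (pieceBits p).length = 4 := by
  cases p <;> simp [pieceBits]

@[simp] theorem length_squareBits (s : Square) : (squareBits s).length = 6 := by
  simp [squareBits]

@[simp] theorem length_moveBits (m : Move) : m.bits.length = 15 := by simp [Move.bits]

@[simp] theorem length_enPassantBits (f : Option (Fin 8)) : (enPassantBits f).length = 4 := by
  cases f <;> simp [enPassantBits]

theorem length_boardBits (b : Board) : (boardBits b).length = 256 := by
  simp [boardBits, List.length_flatMap]

theorem length_positionBits (P : Position) : P.bits.length = 265 := by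
  simp [Position.bits, length_boardBits]

theorem finBits_injective : Function.Injective fun f : Fin 8 => bits 3 f := by decide

theorem kindBits_injective : Function.Injective kindBits := by decide

theorem pieceBits_injective : Function.Injective pieceBits := by decide +kernel

theorem colourBits_injective : Function.Injective fun c : Colour => bits 1 c.number := by decide

theorem enPassantBits_injective : Function.Injective enPassantBits := by decide

theorem squareBits_injective : Function.Injective squareBits := by
  rintro ⟨f, r⟩ ⟨f', r'⟩ h
  obtain ⟨h1, h2⟩ := List.append_inj h (by simp)
  have e1 : f = f' := finBits_injective h1
  have e2 : r = r' := finBits_injective h2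
  rw [e1, e2]

theorem moveBits_injective : Function.Injective Move.bits := by
  rintro ⟨s, t, p⟩ ⟨s', t', p'⟩ h
  obtain ⟨h1, h2⟩ := List.append_inj h (by simp)
  obtain ⟨h3, h4⟩ := List.append_inj h1 (by simp)
  have e1 : s = s' := squareBits_injective h3
  have e2 : t = t' := squareBits_injective h4
  have e3 : p = p' := kindBits_injective h2
  rw [e1, e2, e3]

theorem flatMap_eq_imp {α β : Type} (g h : α → List β) (hl : ∀ a, (g a).length = (h a).length)
    (l : List α) (e : l.flatMap g = l.flatMap h) : ∀ a ∈ l, g a = h a := by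
  induction l with
  | nil => simp
  | cons a l ih =>
    simp only [List.flatMap_cons] at e
    obtain ⟨e1, e2⟩ := List.append_inj e (hl a)
    simpa using ⟨e1, ih e2⟩

theorem boardBits_injective : Function.Injective boardBits := by
  intro b b' h
  funext ⟨f, r⟩
  have h1 := flatMap_eq_imp _ _ (by intro r; simp [List.length_flatMap]) _ h r (List.mem_finRange r)
  have h2 := flatMap_eq_imp _ _ (by intro f; simp) _ h1 f (List.mem_finRange f)
  exact pieceBits_injective h2

theorem positionBits_injective : Function.Injective Position.bits := by
  rintro ⟨b, t, c, e⟩ ⟨b', t', c', e'⟩ h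
  obtain ⟨h1, h2⟩ := List.append_inj' h (by simp)
  obtain ⟨h3, h4⟩ := List.append_inj' h1 (by simp)
  obtain ⟨h5, h6⟩ := List.append_inj' h3 (by simp)
  have hc : c = c' := by
    funext x w
    simp only [List.cons.injEq, and_true] at h4
    obtain ⟨a1, a2, a3, a4⟩ := h4
    cases x <;> cases w <;> assumption
  have hb : b = b' := boardBits_injective h5
  have ht : t = t' := colourBits_injective h6
  have he : e = e' := enPassantBits_injective h2
  rw [hb, ht, hc, he]

theorem stateBits_injective : Function.Injective stateBits := by
  rintro (_ | P) (_ | P') h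
  · rfl
  · exact absurd (congrArg List.head? h) (by simp [stateBits])
  · exact absurd (congrArg List.head? h) (by simp [stateBits])
  · simp only [stateBits, List.cons.injEq, true_and] at h
    rw [positionBits_injective h]

theorem movesBits_injective : Function.Injective fun ms : List Move => ms.flatMap Move.bits := by
  intro l
  induction l with
  | nil =>
    rintro (_ | ⟨m, l'⟩) h
    · rfl
    · have := congrArg List.length h
      simp [List.length_flatMap] at this
      omega
  | cons m l ih =>
    rintro (_ | ⟨m', l'⟩) h
    · have := congrArg List.length h
      simp [List.length_flatMap] at this
    · simp only [List.flatMap_cons] at h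
      obtain ⟨h1, h2⟩ := List.append_inj h (by simp)
      rw [moveBits_injective h1, ih h2]

theorem instanceBits_injective : Function.Injective instanceBits := by
  rintro ⟨P, l⟩ ⟨P', l'⟩ h
  obtain ⟨h1, h2⟩ := List.append_inj h (by simp [length_positionBits])
  have h3 : l = l' := movesBits_injective h2
  have h4 : P = P' := positionBits_injective h1
  rw [h3, h4]

/-- The chess state-tracking problem: given a chessboard state and a sequence of moves in UCI
notation, find the chessboard state after these moves, or the null state if one of them is
illegal. -/
def stateTracking : CircuitComplexity.Problem where
  Instance := Position × List Move
  code := instanceBits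
  code_injective := instanceBits_injective
  answer x := stateBits (track x.1 x.2)

end Chess

/-!
Chess state tracking is in `NC¹` because there are only finitely many positions: playing a list of
moves is running a finite automaton, hence composing a list of functions on a finite set. As
composition is associative, a balanced binary tree of blocks of bounded size computes it, each block
composing two functions that are given by their tables (`TreeData.exists_nc1_of_automaton`,
`Chess.exists_nc1_stateTracking`).

Hardness is shown by reversible programs in the manner of Ben-Or and Cleve, over three bits of
memory, whose instructions add one bit of the memory to another (`cnot`). A procedure call that
performs an instruction if a gate is true can be replaced by eight calls that refer to the arguments
of the gate: for `f ∧ g`, the commutator of the additions `a → k` if `f` and `k → b` if `g`, with `k`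
the third bit, is the addition `a → b` if `f ∧ g`. After as many rounds as the circuit is deep, each
call depends on a single input bit (`Call.foldl_leaf`), and since the depth is logarithmic, there are
polynomially many calls. On the chessboard, the memory is the file of a queen that stands among rooks
on the first rank, an instruction permutes these pieces by exchanging neighbours, and the move list
of an instruction that is not to be executed is replaced by an idle one of the same length
(`Chess.track_cnotMoves`). Every bit of the resulting instance is then a constant, an input bit or
the negation of one, and the output of the circuit is a single bit of the final position.

Most of the work is uniformity. To construct machines, programs over registers with polynomially
bounded contents are compiled to machines with logarithmic space (`Prog.exists_machine`); the
predicates `LS` and `Prints` describe what such programs can compute and print, and are closed under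
arithmetic, case distinctions and bounded loops. Conversely, a machine with logarithmic space is
simulated by such programs, with a work tape held in registers as two numbers
(`TuringTransducer.exists_lsFin`). So the description of a uniform circuit can be searched for the
kind and the arguments of any gate (`LUniform.lookup`), which makes the path from the root call to
the call at any place of the program computable, and hence the reduction uniform
(`reductionCircuit_lUniform`).
-/

namespace CircuitComplexity

/-! ### A register language for logarithmic space -/

/-- Programs over registers that hold natural numbers. `load r` adds the length of the input
to the register `r`. -/
inductive Prog where
  | inc (r : ℕ)
  | clear (r : ℕ)
  | print (s : Sym)
  | skip
  | seq (p q : Prog)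
  | ifEq (a b : ℕ) (p q : Prog)
  | whileNe (a b : ℕ) (p : Prog)
  | load (r : ℕ)

namespace Prog

/-- `Exec B p ρ w ρ'`: started with register contents `ρ`, the program `p` prints `w` and halts with
register contents `ρ'`, and no increment produces a value above `B`. There is no rule for `load`,
which is executed only once, at the very beginning. -/
inductive Exec (B : ℕ) : Prog → (ℕ → ℕ) → List Sym → (ℕ → ℕ) → Prop
  | inc {r : ℕ} {ρ : ℕ → ℕ} : ρ r < B → Exec B (inc r) ρ [] (Function.update ρ r (ρ r + 1))
  | clear {r : ℕ} {ρ : ℕ → ℕ} : Exec B (clear r) ρ [] (Function.update ρ r 0)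
  | print {s : Sym} {ρ : ℕ → ℕ} : Exec B (print s) ρ [s] ρ
  | skip {ρ : ℕ → ℕ} : Exec B skip ρ [] ρ
  | seq {p q : Prog} {ρ ρ' ρ'' : ℕ → ℕ} {v w : List Sym} :
      Exec B p ρ v ρ' → Exec B q ρ' w ρ'' → Exec B (seq p q) ρ (v ++ w) ρ''
  | ifEq_pos {a b : ℕ} {p q : Prog} {ρ ρ' : ℕ → ℕ} {w : List Sym} :
      ρ a = ρ b → Exec B p ρ w ρ' → Exec B (ifEq a b p q) ρ w ρ'
  | ifEq_neg {a b : ℕ} {p q : Prog} {ρ ρ' : ℕ → ℕ} {w : List Sym} :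
      ρ a ≠ ρ b → Exec B q ρ w ρ' → Exec B (ifEq a b p q) ρ w ρ'
  | while_exit {a b : ℕ} {p : Prog} {ρ : ℕ → ℕ} : ρ a = ρ b → Exec B (whileNe a b p) ρ [] ρ
  | while_step {a b : ℕ} {p : Prog} {ρ ρ' ρ'' : ℕ → ℕ} {v w : List Sym} :
      ρ a ≠ ρ b → Exec B p ρ v ρ' → Exec B (whileNe a b p) ρ' w ρ'' →
      Exec B (whileNe a b p) ρ (v ++ w) ρ''

/-- A bound on the registers that a program mentions. -/
def width : Prog → ℕ
  | inc r => r + 1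
  | clear r => r + 1
  | print _ => 0
  | skip => 0
  | seq p q => max p.width q.width
  | ifEq a b p q => max (max (a + 1) (b + 1)) (max p.width q.width)
  | whileNe a b p => max (max (a + 1) (b + 1)) p.width
  | load r => r + 1

/-- The continuations, other than `k`, that occur while `p` runs with continuation `k`.
They serve as the states of a Turing machine. -/
def conts : Prog → List Prog → Set (List Prog)
  | inc r, k => {inc r :: k}
  | clear r, k => {clear r :: k}
  | print s, k => {print s :: k}
  | skip, k => {skip :: k}
  | seq p q, k => {seq p q :: k} ∪ (conts p (q :: k) ∪ conts q k)
  | ifEq a b p q, k => {ifEq a b p q :: k} ∪ (conts p k ∪ conts q k)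
  | whileNe a b p, k => {whileNe a b p :: k} ∪ conts p (whileNe a b p :: k)
  | load r, k => {load r :: k, inc r :: load r :: k}

theorem cons_mem_conts (p : Prog) (k : List Prog) : p :: k ∈ p.conts k := by
  cases p <;> simp [conts]

theorem finite_conts (p : Prog) (k : List Prog) : (p.conts k).Finite := by
  induction p generalizing k with
  | seq p q hp hq => exact (Set.finite_singleton _).union ((hp _).union (hq _))
  | ifEq a b p q hp hq => exact (Set.finite_singleton _).union ((hp _).union (hq _))
  | whileNe a b p hp => exact (Set.finite_singleton _).union (hp _)
  | _ => simp [conts]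

/-- Contents of a cell of a work tape. -/
inductive Cell where
  | blank | mark | bit (b : Bool)
  deriving DecidableEq

instance : Finite Cell :=
  Finite.of_injective (β := Option (Option Bool))
    (fun | .blank => none | .mark => some none | .bit b => some (some b))
    (by rintro (_ | _ | _) (_ | _ | _) h <;> simp_all)

/-- The phases in the execution of a single instruction: `ready` at its beginning, `act` while heads
move right, `wipe` while digits are erased, `ret` while heads return to the left end. -/
inductive Phase where
  | init | ready | act | wipe | ret

instance : Finite Phase :=
  Finite.of_injective (β := Fin 5)
    (fun | .init => 0 | .ready => 1 | .act => 2 | .wipe => 3 | .ret => 4)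
    (by rintro (_ | _ | _ | _ | _) (_ | _ | _ | _ | _) h <;> simp_all)

section Machine

variable {K : ℕ}

/-- The cell under the head of tape `r`; blank if there is no such tape. -/
def readCell (s : Fin K → Cell) (r : ℕ) : Cell := if h : r < K then s ⟨r, h⟩ else .blank

/-- Write `c` on tape `r` and leave the other tapes alone. -/
def writeCell (s : Fin K → Cell) (r : ℕ) (c : Cell) : Fin K → Cell :=
  fun i => if i.1 = r then c else s i

/-- Move the head of tape `r` only. -/
def moveAt (r : ℕ) (d : Dir) : Fin K → Dir := fun i => if i.1 = r then d else .stay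

/-- Move the heads of tapes `a` and `b` to the right. -/
def moveBoth (a b : ℕ) : Fin K → Dir := fun i => if i.1 = a ∨ i.1 = b then .right else .stay

/-- The comparison of two registers, digit by digit: continue with `k` if they are equal and with
`k'` otherwise. -/
def compare (s : Fin K → Cell) (a b : ℕ) (cur k k' : List Prog) :
    Action (Phase × List Prog) Cell Sym K :=
  if readCell s a = readCell s b then
    if readCell s a = .blank then ⟨(.ret, k), s, fun _ => .stay, .stay, none⟩
    else ⟨(.act, cur), s, moveBoth a b, .stay, none⟩
  else ⟨(.ret, k'), s, fun _ => .stay, .stay, none⟩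

/-- The transition table of the machine that runs a program; its states are pairs of a phase and a
continuation. -/
def delta : Phase → List Prog → InSym → (Fin K → Cell) →
    Option (Action (Phase × List Prog) Cell Sym K)
  | .init, k, _, _ => some ⟨(.ready, k), fun _ => .mark, fun _ => .stay, .stay, none⟩
  | .ret, k, _, s =>
    if ∀ i, s i = .mark then some ⟨(.ready, k), s, fun _ => .stay, .stay, none⟩
    else some ⟨(.ret, k), s, fun _ => .left, .stay, none⟩
  | .ready, inc r :: k, _, s => some ⟨(.act, inc r :: k), s, moveAt r .right, .stay, none⟩
  | .ready, clear r :: k, _, s => some ⟨(.act, clear r :: k), s, moveAt r .right, .stay, none⟩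
  | .ready, print o :: k, _, s => some ⟨(.ready, k), s, fun _ => .stay, .stay, some o⟩
  | .ready, skip :: k, _, s => some ⟨(.ready, k), s, fun _ => .stay, .stay, none⟩
  | .ready, seq p q :: k, _, s => some ⟨(.ready, p :: q :: k), s, fun _ => .stay, .stay, none⟩
  | .ready, ifEq a b p q :: k, _, s =>
    some ⟨(.act, ifEq a b p q :: k), s, moveBoth a b, .stay, none⟩
  | .ready, whileNe a b p :: k, _, s =>
    some ⟨(.act, whileNe a b p :: k), s, moveBoth a b, .stay, none⟩
  | .ready, load r :: k, .leftEnd, s =>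
    some ⟨(.ready, load r :: k), s, fun _ => .stay, .right, none⟩
  | .ready, load r :: k, .one, s =>
    some ⟨(.ready, inc r :: load r :: k), s, fun _ => .stay, .right, none⟩
  | .ready, load _ :: k, .rightEnd, s => some ⟨(.ready, k), s, fun _ => .stay, .stay, none⟩
  | .act, inc r :: k, _, s =>
    if readCell s r = .bit true then
      some ⟨(.act, inc r :: k), writeCell s r (.bit false), moveAt r .right, .stay, none⟩
    else some ⟨(.ret, k), writeCell s r (.bit true), fun _ => .stay, .stay, none⟩
  | .act, clear r :: k, _, s =>
    if readCell s r = .blank then some ⟨(.wipe, clear r :: k), s, moveAt r .left, .stay, none⟩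
    else some ⟨(.act, clear r :: k), s, moveAt r .right, .stay, none⟩
  | .wipe, clear r :: k, _, s =>
    if readCell s r = .mark then some ⟨(.ready, k), s, fun _ => .stay, .stay, none⟩
    else some ⟨(.wipe, clear r :: k), writeCell s r .blank, moveAt r .left, .stay, none⟩
  | .act, ifEq a b p q :: k, _, s => some (compare s a b (ifEq a b p q :: k) (p :: k) (q :: k))
  | .act, whileNe a b p :: k, _, s =>
    some (compare s a b (whileNe a b p :: k) k (p :: whileNe a b p :: k))
  | _, _, _, _ => none

end Machine

open Classical in
/-- The Turing machine for the program `p`, with one work tape for each of the registers below `K`.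
The work tape of a register holds an end mark in cell `0`, and the binary digits of its contents,
lowest first, from cell `1` on. -/
noncomputable def machine (p : Prog) (K : ℕ) : TuringTransducer Sym where
  Q := Phase × ↥(p.conts [] ∪ {[]})
  Γ := Cell
  finite_Q :=
    have := (((finite_conts p []).union (Set.finite_singleton [])).to_subtype)
    inferInstance
  finite_Γ := inferInstance
  k := K
  start := (.init, ⟨[p], Or.inl (cons_mem_conts p [])⟩)
  blank := .blank
  δ q i s := (delta q.1 q.2.1 i s).map fun a =>
    { next := (a.next.1, if h : a.next.2 ∈ p.conts [] ∪ {[]} then ⟨a.next.2, h⟩ else q.2)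
      write := a.write
      move := a.move
      moveInput := a.moveInput
      print := a.print }

/-- The contents of a work tape with the digits `l`. -/
def tapeOf (l : List Bool) : ℕ → Cell
  | 0 => .mark
  | p + 1 => match l[p]? with
    | some b => .bit b
    | none => .blank

section Run

variable {P : Prog} {K : ℕ} {n s : ℕ}

/-- The configuration with the given phase, continuation, position of the input head, contents of the
work tapes, positions of the work heads, and output. -/
def conf (K : ℕ) (ph : Phase) (k : ↥(P.conts [] ∪ {[]})) (h : ℕ) (ls : ℕ → List Bool)
    (hd : ℕ → ℕ) (o : List Sym) : (P.machine K).Cfg where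
  state := (ph, k)
  inputHead := h
  tape := fun i => tapeOf (ls i.1)
  head := fun i => hd i.1
  out := o

end Run

end Prog

/-- The machine gets from one configuration to another, and the heads stay within the first `s`
cells before the last configuration. -/
def TuringTransducer.Runs {O : Type} (M : TuringTransducer O) (n s : ℕ) : M.Cfg → M.Cfg → Prop :=
  Relation.ReflTransGen fun a b => M.step n a = some b ∧ ∀ i, a.head i ≤ s

theorem TuringTransducer.Runs.reaches {O : Type} {M : TuringTransducer O} {n s : ℕ} {a b : M.Cfg}
    (h : M.Runs n s a b) : StateTransition.Reaches (M.step n) a b := by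
  induction h with
  | refl => exact Relation.ReflTransGen.refl
  | tail _ h ih => exact ih.tail h.1

theorem TuringTransducer.Runs.trans {O : Type} {M : TuringTransducer O} {n s : ℕ} {a b c : M.Cfg}
    (h : M.Runs n s a b) (h' : M.Runs n s b c) : M.Runs n s a c :=
  Relation.ReflTransGen.trans h h'

theorem TuringTransducer.Runs.head_le {O : Type} {M : TuringTransducer O} {n s : ℕ} {a b c : M.Cfg}
    (h : M.Runs n s a b) (hb : M.step n b = none) (hs : ∀ i, b.head i ≤ s)
    (hc : StateTransition.Reaches (M.step n) a c) : ∀ i, c.head i ≤ s := by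
  induction h using Relation.ReflTransGen.head_induction_on with
  | refl =>
    rcases Relation.ReflTransGen.cases_head hc with rfl | ⟨d, hd, -⟩
    · exact hs
    · simp [hb] at hd
  | head h1 _ ih =>
    rcases Relation.ReflTransGen.cases_head hc with rfl | ⟨d, hd, hdc⟩
    · exact h1.2
    · simp only [h1.1, Option.mem_def, Option.some.injEq] at hd
      exact ih (hd ▸ hdc)

namespace Prog

section Run

variable {P : Prog} {K : ℕ} {n s : ℕ}

theorem runs_step {ph : Phase} {k : ↥(P.conts [] ∪ {[]})} {h : ℕ} {ls : ℕ → List Bool} {hd : ℕ → ℕ}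
    {o : List Sym} {a : Action (Phase × List Prog) Cell Sym K} (k' : ↥(P.conts [] ∪ {[]}))
    (ls' : ℕ → List Bool) (hd' : ℕ → ℕ)
    (ha : delta ph k.1 (inputTape n h) (fun i : Fin K => tapeOf (ls i.1) (hd i.1)) = some a)
    (hk : a.next.2 = k'.1) (hs : ∀ i < K, hd i ≤ s)
    (hl : ∀ i : Fin K, Function.update (tapeOf (ls i)) (hd i) (a.write i) = tapeOf (ls' i))
    (hh : ∀ i : Fin K, (a.move i).move (hd i) = hd' i) :
    (P.machine K).Runs n s (conf K ph k h ls hd o)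
      (conf K a.next.1 k' (min (a.moveInput.move h) (n + 1)) ls' hd' (o ++ a.print.toList)) := by
  refine Relation.ReflTransGen.single ⟨?_, fun i => hs i.1 i.2⟩
  have h1 : (P.machine K).δ (ph, k) (inputTape n h) (fun i : Fin K => tapeOf (ls i.1) (hd i.1)) =
      some { next := (a.next.1, k'), write := a.write, move := a.move, moveInput := a.moveInput,
             print := a.print } := by
    have h2 : a.next.2 ∈ P.conts [] ∪ {[]} := hk ▸ k'.2
    simp only [machine, ha, Option.map_some, dif_pos h2]
    congr 3
    exact Subtype.ext hk
  unfold TuringTransducer.step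
  refine (congrArg _ h1).trans ?_
  simp only [Option.map_some, conf, Option.some.injEq]
  congr 1
  · funext i; exact hl i
  · funext i; exact hh i

theorem readCell_of_lt (t : Fin K → Cell) {r : ℕ} (hr : r < K) : readCell t r = t ⟨r, hr⟩ := by
  simp [readCell, hr]

theorem tapeOf_eq_mark {l : List Bool} {p : ℕ} : tapeOf l p = .mark ↔ p = 0 := by
  cases p with
  | zero => simp [tapeOf]
  | succ p => simp only [tapeOf]; split <;> simp

theorem tapeOf_append_cons (u v : List Bool) (b : Bool) :
    tapeOf (u ++ b :: v) (u.length + 1) = .bit b := by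
  simp [tapeOf]

theorem tapeOf_length (u : List Bool) : tapeOf u (u.length + 1) = .blank := by
  simp [tapeOf]

theorem update_tapeOf (u v : List Bool) (b c : Bool) :
    Function.update (tapeOf (u ++ b :: v)) (u.length + 1) (.bit c) = tapeOf (u ++ c :: v) := by
  funext p
  rcases p with _ | p
  · simp [tapeOf]
  · rw [Function.update_apply]
    split
    · rename_i h
      rw [h, tapeOf_append_cons]
    · rename_i h
      have h : p ≠ u.length := by omega
      have : (u ++ b :: v)[p]? = (u ++ c :: v)[p]? := by
        rw [List.getElem?_append, List.getElem?_append]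
        by_cases hp : p < u.length
        · simp [hp]
        · obtain ⟨q, hq⟩ : ∃ q, p - u.length = q + 1 := ⟨p - u.length - 1, by omega⟩
          simp [hq]
      simp only [tapeOf, this]

theorem update_tapeOf_end (u : List Bool) (c : Bool) :
    Function.update (tapeOf u) (u.length + 1) (.bit c) = tapeOf (u ++ [c]) := by
  funext p
  rcases p with _ | p
  · simp [tapeOf]
  · rw [Function.update_apply]
    split
    · rename_i h
      rw [h, tapeOf_append_cons]
    · rename_i h
      have h : p ≠ u.length := by omega
      have : u[p]? = (u ++ [c])[p]? := by
        rw [List.getElem?_append]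
        by_cases hp : p < u.length
        · simp [hp]
        · rw [List.getElem?_eq_none (by omega), if_neg hp, List.getElem?_eq_none (by simp; omega)]
      simp only [tapeOf, this]

theorem update_tapeOf_blank (u : List Bool) (c : Bool) :
    Function.update (tapeOf (u ++ [c])) (u.length + 1) .blank = tapeOf u := by
  rw [← update_tapeOf_end, Function.update_idem, ← tapeOf_length u, Function.update_eq_self]

/-- Returning the heads. -/
theorem runs_ret (k : ↥(P.conts [] ∪ {[]})) (h : ℕ) (ls : ℕ → List Bool) (o : List Sym)
    (hn : h ≤ n + 1) (m : ℕ) :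
    ∀ hd : ℕ → ℕ, m ≤ s → (∀ i < K, hd i ≤ m) →
    (P.machine K).Runs n s (conf K .ret k h ls hd o) (conf K .ready k h ls (fun _ => 0) o) := by
  induction m with
  | zero =>
    intro hd _ hm
    have h1 : ∀ i : Fin K, hd i = 0 := fun i => Nat.le_zero.1 (hm i.1 i.2)
    have := runs_step (n := n) (s := s) (ph := .ret) (k := k) (h := h) (ls := ls) (hd := hd) (o := o)
      (a := ⟨(.ready, k.1), fun i : Fin K => tapeOf (ls i) (hd i), fun _ => .stay, .stay, none⟩)
      k ls (fun _ => 0) (by simp [delta, h1, tapeOf]) rfl (by intro i hi; have := hm i hi; omega)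
      (by intro i; simp) (by intro i; simp [Dir.move, h1])
    simpa [Dir.move, Nat.min_eq_left hn] using this
  | succ m ih =>
    intro hd hs hm
    by_cases h1 : ∀ i : Fin K, hd i = 0
    · exact ih hd (by omega) (fun i hi => by have := h1 ⟨i, hi⟩; simp only at this; omega)
    have h2 : ¬ ∀ i : Fin K, tapeOf (ls i) (hd i) = .mark := by simpa [tapeOf_eq_mark] using h1
    have := runs_step (n := n) (s := s) (ph := .ret) (k := k) (h := h) (ls := ls) (hd := hd) (o := o)
      (a := ⟨(.ret, k.1), fun i : Fin K => tapeOf (ls i) (hd i), fun _ => .left, .stay, none⟩)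
      k ls (fun i => hd i - 1) (by simp only [delta, if_neg h2])
      rfl (by intro i hi; have := hm i hi; omega)
      (by intro i; simp) (by intro i; simp [Dir.move])
    refine TuringTransducer.Runs.trans ?_ (ih (fun i => hd i - 1) (by omega) ?_)
    · simpa [Dir.move, Nat.min_eq_left hn] using this
    · intro i hi; have := hm i hi; omega

/-- Adding one to a string of binary digits, lowest digit first. -/
def incDigits : List Bool → List Bool
  | [] => [true]
  | false :: l => true :: l
  | true :: l => false :: incDigits l

theorem incDigits_bits (v : ℕ) : incDigits v.bits = (v + 1).bits := by
  induction v using Nat.binaryRec' with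
  | zero => simp [incDigits]
  | bit b v hb ih =>
    rw [Nat.bits_append_bit _ _ hb]
    cases b
    · have : Nat.bit false v + 1 = 2 * v + 1 := by simp [Nat.bit_val]
      rw [this, Nat.bit1_bits, incDigits]
    · have : Nat.bit true v + 1 = 2 * (v + 1) := by simp [Nat.bit_val]; ring
      rw [this, Nat.bit0_bits _ (by omega), incDigits, ih]

/-- Positions of the heads while a single head is away from the left end. -/
def headAt (r p : ℕ) : ℕ → ℕ := fun i => if i = r then p else 0

theorem runs_inc_act (r : ℕ) (hr : r < K) (k : List Prog) (h1 : inc r :: k ∈ P.conts [] ∪ {[]})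
    (h2 : k ∈ P.conts [] ∪ {[]}) (h : ℕ) (o : List Sym) (hn : h ≤ n + 1) (v : List Bool) :
    ∀ (ls : ℕ → List Bool) (u : List Bool), ls r = u ++ v → u.length + v.length + 1 ≤ s →
    (P.machine K).Runs n s (conf K .act ⟨_, h1⟩ h ls (headAt r (u.length + 1)) o)
      (conf K .ready ⟨k, h2⟩ h (Function.update ls r (u ++ incDigits v)) (fun _ => 0) o) := by
  have key : ∀ (ls : ℕ → List Bool) (u : List Bool) (w : List Bool), u.length + 1 ≤ s →
      tapeOf (ls r) (u.length + 1) ≠ .bit true →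
      Function.update (tapeOf (ls r)) (u.length + 1) (.bit true) = tapeOf w →
      (P.machine K).Runs n s (conf K .act ⟨_, h1⟩ h ls (headAt r (u.length + 1)) o)
      (conf K .ready ⟨k, h2⟩ h (Function.update ls r w) (fun _ => 0) o) := by
    intro ls u w hs ht hu
    have := runs_step (n := n) (s := s) (P := P) (ph := .act) (k := ⟨_, h1⟩) (h := h) (ls := ls)
      (hd := headAt r (u.length + 1)) (o := o)
      (a := ⟨(.ret, k), writeCell (fun i : Fin K => tapeOf (ls i) (headAt r (u.length + 1) i)) r
        (.bit true), fun _ => .stay, .stay, none⟩)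
      ⟨k, h2⟩ (Function.update ls r w) (headAt r (u.length + 1))
      (by simp only [delta, readCell_of_lt _ hr, headAt, if_true, if_neg ht]) rfl
      (by intro i hi; simp only [headAt]; split <;> omega)
      (by
        intro i
        by_cases hi : i.1 = r
        · simp [hi, writeCell, headAt, hu]
        · simp [hi, writeCell])
      (by intro i; simp [Dir.move])
    refine TuringTransducer.Runs.trans ?_ (runs_ret ⟨k, h2⟩ h _ o hn s (headAt r (u.length + 1)) le_rfl
      (by intro i hi; simp only [headAt]; split <;> omega))
    simpa [Dir.move, Nat.min_eq_left hn] using this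
  induction v with
  | nil =>
    intro ls u hu hs
    refine key ls u _ (by simpa using hs) ?_ ?_
    · rw [hu, List.append_nil, tapeOf_length]; simp
    · rw [hu, List.append_nil, update_tapeOf_end]; rfl
  | cons b v ih =>
    intro ls u hu hs
    simp only [List.length_cons] at hs
    cases b with
    | false =>
      refine key ls u _ (by omega) ?_ ?_
      · rw [hu, tapeOf_append_cons]; simp
      · rw [hu, update_tapeOf]; rfl
    | true =>
      have := runs_step (n := n) (s := s) (P := P) (ph := .act) (k := ⟨_, h1⟩) (h := h) (ls := ls)
        (hd := headAt r (u.length + 1)) (o := o)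
        (a := ⟨(.act, inc r :: k), writeCell (fun i : Fin K => tapeOf (ls i)
          (headAt r (u.length + 1) i)) r (.bit false), moveAt r .right, .stay, none⟩)
        ⟨_, h1⟩ (Function.update ls r (u ++ false :: v)) (headAt r (u.length + 1 + 1))
        (by simp only [delta, readCell_of_lt _ hr, headAt, if_true, hu, tapeOf_append_cons]) rfl
        (by intro i hi; simp only [headAt]; split <;> omega)
        (by
          intro i
          by_cases hi : i.1 = r
          · simp [hi, writeCell, headAt, hu, update_tapeOf]
          · simp [hi, writeCell])
        (by intro i; simp only [moveAt, headAt]; split <;> simp [Dir.move])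
      have h3 := ih (Function.update ls r (u ++ false :: v)) (u ++ [false]) (by simp)
        (by simp; omega)
      refine TuringTransducer.Runs.trans (b := conf K .act ⟨_, h1⟩ h
        (Function.update ls r (u ++ false :: v)) (headAt r (u.length + 1 + 1)) o) ?_ ?_
      · simpa [Dir.move, Nat.min_eq_left hn] using this
      · simpa [incDigits] using h3

/-- The digits of the registers. -/
def digits (ρ : ℕ → ℕ) : ℕ → List Bool := fun r => (ρ r).bits

theorem digits_update (ρ : ℕ → ℕ) (r v : ℕ) :
    digits (Function.update ρ r v) = Function.update (digits ρ) r v.bits := by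
  funext i
  by_cases h : i = r
  · subst h; simp [digits]
  · simp [digits, h]

theorem runs_inc (r : ℕ) (hr : r < K) (k : List Prog) (h1 : inc r :: k ∈ P.conts [] ∪ {[]})
    (h2 : k ∈ P.conts [] ∪ {[]}) (h : ℕ) (o : List Sym) (hn : h ≤ n + 1) (ρ : ℕ → ℕ)
    (hs : (ρ r).bits.length + 1 ≤ s) :
    (P.machine K).Runs n s (conf K .ready ⟨_, h1⟩ h (digits ρ) (fun _ => 0) o)
      (conf K .ready ⟨k, h2⟩ h (digits (Function.update ρ r (ρ r + 1))) (fun _ => 0) o) := by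
  have := runs_step (n := n) (s := s) (P := P) (ph := .ready) (k := ⟨_, h1⟩) (h := h)
    (ls := digits ρ) (hd := fun _ => 0) (o := o)
    (a := ⟨(.act, inc r :: k), fun i : Fin K => tapeOf (digits ρ i) 0, moveAt r .right, .stay, none⟩)
    ⟨_, h1⟩ (digits ρ) (headAt r 1) (by simp only [delta]) rfl (by simp) (by simp)
    (by intro i; simp only [moveAt, headAt]; split <;> simp [Dir.move])
  have h3 := runs_inc_act r hr k h1 h2 h o hn (ρ r).bits (digits ρ) [] rfl (by simpa using hs)
  refine TuringTransducer.Runs.trans (b := conf K .act ⟨_, h1⟩ h (digits ρ) (headAt r 1) o) ?_ ?_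
  · simpa [Dir.move, Nat.min_eq_left hn] using this
  · simpa [incDigits_bits, digits_update] using h3

theorem runs_clear_wipe (r : ℕ) (hr : r < K) (k : List Prog) (h1 : clear r :: k ∈ P.conts [] ∪ {[]})
    (h2 : k ∈ P.conts [] ∪ {[]}) (h : ℕ) (o : List Sym) (hn : h ≤ n + 1) (v : List Bool) :
    ∀ (ls : ℕ → List Bool), ls r = v → v.length ≤ s →
    (P.machine K).Runs n s (conf K .wipe ⟨_, h1⟩ h ls (headAt r v.length) o)
      (conf K .ready ⟨k, h2⟩ h (Function.update ls r []) (fun _ => 0) o) := by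
  induction v using List.reverseRecOn with
  | nil =>
    intro ls hl hs
    have := runs_step (n := n) (s := s) (P := P) (ph := .wipe) (k := ⟨_, h1⟩) (h := h) (ls := ls)
      (hd := headAt r 0) (o := o)
      (a := ⟨(.ready, k), fun i : Fin K => tapeOf (ls i) (headAt r 0 i), fun _ => .stay, .stay, none⟩)
      ⟨k, h2⟩ (Function.update ls r []) (fun _ => 0)
      (by simp [delta, readCell_of_lt _ hr, headAt, tapeOf]) rfl
      (by intro i hi; simp [headAt])
      (by
        intro i
        by_cases hi : i.1 = r
        · simp [hi, hl]
        · simp [hi])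
      (by intro i; simp [Dir.move, headAt])
    simpa [Dir.move, Nat.min_eq_left hn] using this
  | append_singleton v b ih =>
    intro ls hl hs
    simp only [List.length_append, List.length_singleton] at hs
    have := runs_step (n := n) (s := s) (P := P) (ph := .wipe) (k := ⟨_, h1⟩) (h := h) (ls := ls)
      (hd := headAt r (v.length + 1)) (o := o)
      (a := ⟨(.wipe, clear r :: k), writeCell (fun i : Fin K => tapeOf (ls i)
        (headAt r (v.length + 1) i)) r .blank, moveAt r .left, .stay, none⟩)
      ⟨_, h1⟩ (Function.update ls r v) (headAt r v.length)
      (by simp [delta, readCell_of_lt _ hr, headAt, hl, tapeOf_append_cons]) rfl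
      (by intro i hi; simp only [headAt]; split <;> omega)
      (by
        intro i
        by_cases hi : i.1 = r
        · simp [hi, writeCell, headAt, hl, update_tapeOf_blank]
        · simp [hi, writeCell])
      (by intro i; simp only [moveAt, headAt]; split <;> simp [Dir.move])
    refine TuringTransducer.Runs.trans (b := conf K .wipe ⟨_, h1⟩ h (Function.update ls r v)
      (headAt r v.length) o) ?_ ?_
    · simpa [Dir.move, Nat.min_eq_left hn] using this
    · simpa using ih (Function.update ls r v) (by simp) (by omega)

theorem runs_clear_act (r : ℕ) (hr : r < K) (k : List Prog) (h1 : clear r :: k ∈ P.conts [] ∪ {[]})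
    (h : ℕ) (o : List Sym) (hn : h ≤ n + 1) (ls : ℕ → List Bool) (v : List Bool) :
    ∀ u : List Bool, ls r = u ++ v → u.length + v.length + 1 ≤ s →
    (P.machine K).Runs n s (conf K .act ⟨_, h1⟩ h ls (headAt r (u.length + 1)) o)
      (conf K .wipe ⟨_, h1⟩ h ls (headAt r (u.length + v.length)) o) := by
  induction v with
  | nil =>
    intro u hu hs
    rw [List.append_nil] at hu
    have := runs_step (n := n) (s := s) (P := P) (ph := .act) (k := ⟨_, h1⟩) (h := h) (ls := ls)
      (hd := headAt r (u.length + 1)) (o := o)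
      (a := ⟨(.wipe, clear r :: k), fun i : Fin K => tapeOf (ls i) (headAt r (u.length + 1) i),
        moveAt r .left, .stay, none⟩)
      ⟨_, h1⟩ ls (headAt r u.length)
      (by simp only [delta, readCell_of_lt _ hr, headAt, if_true, hu, tapeOf_length]) rfl
      (by intro i hi; simp only [headAt, List.length_nil] at hs ⊢; split <;> omega)
      (by intro i; simp)
      (by intro i; simp only [moveAt, headAt]; split <;> simp [Dir.move])
    simpa [Dir.move, Nat.min_eq_left hn] using this
  | cons b v ih =>
    intro u hu hs
    simp only [List.length_cons] at hs
    have := runs_step (n := n) (s := s) (P := P) (ph := .act) (k := ⟨_, h1⟩) (h := h) (ls := ls)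
      (hd := headAt r (u.length + 1)) (o := o)
      (a := ⟨(.act, clear r :: k), fun i : Fin K => tapeOf (ls i) (headAt r (u.length + 1) i),
        moveAt r .right, .stay, none⟩)
      ⟨_, h1⟩ ls (headAt r (u.length + 1 + 1))
      (by simp [delta, readCell_of_lt _ hr, headAt, hu, tapeOf_append_cons]) rfl
      (by intro i hi; simp only [headAt] at hs ⊢; split <;> omega)
      (by intro i; simp)
      (by intro i; simp only [moveAt, headAt]; split <;> simp [Dir.move])
    have h3 := ih (u ++ [b]) (by simp [hu]) (by simp; omega)
    refine TuringTransducer.Runs.trans (b := conf K .act ⟨_, h1⟩ h ls (headAt r (u.length + 1 + 1)) o)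
      ?_ ?_
    · simpa [Dir.move, Nat.min_eq_left hn] using this
    · simpa [add_assoc, add_comm, add_left_comm] using h3

theorem runs_clear (r : ℕ) (hr : r < K) (k : List Prog) (h1 : clear r :: k ∈ P.conts [] ∪ {[]})
    (h2 : k ∈ P.conts [] ∪ {[]}) (h : ℕ) (o : List Sym) (hn : h ≤ n + 1) (ρ : ℕ → ℕ)
    (hs : (ρ r).bits.length + 1 ≤ s) :
    (P.machine K).Runs n s (conf K .ready ⟨_, h1⟩ h (digits ρ) (fun _ => 0) o)
      (conf K .ready ⟨k, h2⟩ h (digits (Function.update ρ r 0)) (fun _ => 0) o) := by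
  have := runs_step (n := n) (s := s) (P := P) (ph := .ready) (k := ⟨_, h1⟩) (h := h)
    (ls := digits ρ) (hd := fun _ => 0) (o := o)
    (a := ⟨(.act, clear r :: k), fun i : Fin K => tapeOf (digits ρ i) 0, moveAt r .right, .stay,
      none⟩)
    ⟨_, h1⟩ (digits ρ) (headAt r 1) (by simp only [delta]) rfl (by simp) (by simp)
    (by intro i; simp only [moveAt, headAt]; split <;> simp [Dir.move])
  have h3 := runs_clear_act (s := s) r hr k h1 h o hn (digits ρ) (ρ r).bits [] rfl (by simpa using hs)
  have h4 := runs_clear_wipe (s := s) r hr k h1 h2 h o hn (ρ r).bits (digits ρ) rfl (by omega)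
  refine TuringTransducer.Runs.trans (b := conf K .act ⟨_, h1⟩ h (digits ρ) (headAt r 1) o) ?_
    (TuringTransducer.Runs.trans (b := conf K .wipe ⟨_, h1⟩ h (digits ρ)
      (headAt r (ρ r).bits.length) o) ?_ ?_)
  · simpa [Dir.move, Nat.min_eq_left hn] using this
  · simpa using h3
  · simpa [digits_update] using h4

/-- Positions of the heads during a comparison. -/
def headsAt (a b p : ℕ) : ℕ → ℕ := fun i => if i = a ∨ i = b then p else 0

theorem runs_compare_act (a b : ℕ) (ha : a < K) (hb : b < K) (cur k k' : List Prog)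
    (h0 : cur ∈ P.conts [] ∪ {[]}) (hk : k ∈ P.conts [] ∪ {[]}) (hk' : k' ∈ P.conts [] ∪ {[]})
    (hδ : ∀ (i : InSym) (t : Fin K → Cell), delta .act cur i t = some (compare t a b cur k k'))
    (h : ℕ) (o : List Sym) (hn : h ≤ n + 1) (ls : ℕ → List Bool) (v : List Bool) :
    ∀ u w : List Bool, ls a = u ++ v → ls b = u ++ w → u.length + v.length + 1 ≤ s →
    (P.machine K).Runs n s (conf K .act ⟨_, h0⟩ h ls (headsAt a b (u.length + 1)) o)
      (conf K .ready (if v = w then ⟨k, hk⟩ else ⟨k', hk'⟩) h ls (fun _ => 0) o) := by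
  have key : ∀ (u : List Bool) (l : ↥(P.conts [] ∪ {[]})), u.length + 1 ≤ s →
      compare (fun i : Fin K => tapeOf (ls i) (headsAt a b (u.length + 1) i)) a b cur k k' =
        ⟨(.ret, l.1), fun i : Fin K => tapeOf (ls i) (headsAt a b (u.length + 1) i),
          fun _ => .stay, .stay, none⟩ →
      (P.machine K).Runs n s (conf K .act ⟨_, h0⟩ h ls (headsAt a b (u.length + 1)) o)
        (conf K .ready l h ls (fun _ => 0) o) := by
    intro u l hs he
    have := runs_step (n := n) (s := s) (P := P) (ph := .act) (k := ⟨_, h0⟩) (h := h) (ls := ls)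
      (hd := headsAt a b (u.length + 1)) (o := o) (a := _)
      l ls (headsAt a b (u.length + 1)) ((hδ _ _).trans (congrArg some he)) rfl
      (by intro i hi; simp only [headsAt]; split <;> omega) (by intro i; simp)
      (by intro i; simp [Dir.move])
    refine TuringTransducer.Runs.trans ?_ (runs_ret l h ls o hn s (headsAt a b (u.length + 1)) le_rfl
      (by intro i hi; simp only [headsAt]; split <;> omega))
    simpa [Dir.move, Nat.min_eq_left hn] using this
  have ra : ∀ p, readCell (fun i : Fin K => tapeOf (ls i) (headsAt a b p i)) a = tapeOf (ls a) p := by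
    intro p; simp [readCell_of_lt _ ha, headsAt]
  have rb : ∀ p, readCell (fun i : Fin K => tapeOf (ls i) (headsAt a b p i)) b = tapeOf (ls b) p := by
    intro p; simp [readCell_of_lt _ hb, headsAt]
  induction v with
  | nil =>
    intro u w hu hw hs
    rw [List.append_nil] at hu
    cases w with
    | nil =>
      rw [List.append_nil] at hw
      refine key u _ (by simpa using hs) ?_
      simp only [compare, ra, rb, hu, hw, tapeOf_length, if_true]
    | cons c w =>
      refine key u _ (by simpa using hs) ?_
      simp [compare, ra, rb, hu, hw, tapeOf_length, tapeOf_append_cons]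
  | cons c v ih =>
    intro u w hu hw hs
    simp only [List.length_cons] at hs
    cases w with
    | nil =>
      rw [List.append_nil] at hw
      refine key u _ (by omega) ?_
      simp [compare, ra, rb, hu, hw, tapeOf_length, tapeOf_append_cons]
    | cons d w =>
      by_cases hcd : c = d
      · subst hcd
        have := runs_step (n := n) (s := s) (P := P) (ph := .act) (k := ⟨_, h0⟩) (h := h) (ls := ls)
          (hd := headsAt a b (u.length + 1)) (o := o)
          (a := ⟨(.act, cur), fun i : Fin K => tapeOf (ls i) (headsAt a b (u.length + 1) i),
            moveBoth a b, .stay, none⟩)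
          ⟨_, h0⟩ ls (headsAt a b (u.length + 1 + 1))
          (by rw [hδ]; simp [compare, ra, rb, hu, hw, tapeOf_append_cons]) rfl
          (by intro i hi; simp only [headsAt]; split <;> omega) (by intro i; simp)
          (by intro i; simp only [moveBoth, headsAt]; split <;> simp [Dir.move])
        have h3 := ih (u ++ [c]) w (by simp [hu]) (by simp [hw]) (by simp; omega)
        refine TuringTransducer.Runs.trans (b := conf K .act ⟨_, h0⟩ h ls
          (headsAt a b (u.length + 1 + 1)) o) ?_ ?_
        · simpa [Dir.move, Nat.min_eq_left hn] using this
        · simpa using h3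
      · refine key u _ (by omega) ?_
        simp [compare, ra, rb, hu, hw, tapeOf_append_cons, hcd]

theorem runs_compare (a b : ℕ) (ha : a < K) (hb : b < K) (cur k k' : List Prog)
    (h0 : cur ∈ P.conts [] ∪ {[]}) (hk : k ∈ P.conts [] ∪ {[]}) (hk' : k' ∈ P.conts [] ∪ {[]})
    (hδ : ∀ (i : InSym) (t : Fin K → Cell), delta .act cur i t = some (compare t a b cur k k'))
    (hr : ∀ (i : InSym) (t : Fin K → Cell),
      delta .ready cur i t = some ⟨(.act, cur), t, moveBoth a b, .stay, none⟩)
    (h : ℕ) (o : List Sym) (hn : h ≤ n + 1) (ρ : ℕ → ℕ) (hs : (ρ a).bits.length + 1 ≤ s) :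
    (P.machine K).Runs n s (conf K .ready ⟨_, h0⟩ h (digits ρ) (fun _ => 0) o)
      (conf K .ready (if ρ a = ρ b then ⟨k, hk⟩ else ⟨k', hk'⟩) h (digits ρ) (fun _ => 0) o) := by
  have := runs_step (n := n) (s := s) (P := P) (ph := .ready) (k := ⟨_, h0⟩) (h := h)
    (ls := digits ρ) (hd := fun _ => 0) (o := o) (a := _)
    ⟨_, h0⟩ (digits ρ) (headsAt a b 1) (hr _ _) rfl (by simp) (by simp)
    (by intro i; simp only [moveBoth, headsAt]; split <;> simp [Dir.move])
  have h3 := runs_compare_act a b ha hb cur k k' h0 hk hk' hδ h o hn (digits ρ) (ρ a).bits []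
    (ρ b).bits rfl rfl (by simpa using hs)
  have h4 : (ρ a).bits = (ρ b).bits ↔ ρ a = ρ b := by
    refine ⟨fun h => ?_, fun h => by rw [h]⟩
    have inj : ∀ x y : ℕ, x.bits = y.bits → x = y := by
      intro x
      induction x using Nat.binaryRec' with
      | zero =>
        intro y hy
        by_contra h
        have := congrArg List.length hy
        rw [Nat.size_eq_bits_len, Nat.size_eq_bits_len, Nat.size_zero] at this
        exact h (Nat.size_eq_zero.1 this.symm).symm
      | bit b x hb ih =>
        intro y hy
        induction y using Nat.binaryRec' with
        | zero => rw [Nat.bits_append_bit _ _ hb] at hy; simp at hy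
        | bit c y hc _ =>
          rw [Nat.bits_append_bit _ _ hb, Nat.bits_append_bit _ _ hc] at hy
          simp only [List.cons.injEq] at hy
          rw [hy.1, ih y hy.2]
    exact inj _ _ h
  simp only [h4] at h3
  refine TuringTransducer.Runs.trans (b := conf K .act ⟨_, h0⟩ h (digits ρ) (headsAt a b 1) o) ?_ ?_
  · simpa [Dir.move, Nat.min_eq_left hn] using this
  · simpa using h3

/-- A step that only changes the continuation and prints. -/
theorem runs_plain (k k' : List Prog) (h0 : k ∈ P.conts [] ∪ {[]}) (h1 : k' ∈ P.conts [] ∪ {[]})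
    (w : Option Sym) (h : ℕ) (d : Dir) (ls : ℕ → List Bool) (o : List Sym)
    (hδ : ∀ t : Fin K → Cell, delta .ready k (inputTape n h) t =
      some ⟨(.ready, k'), t, fun _ => .stay, d, w⟩) :
    (P.machine K).Runs n s (conf K .ready ⟨_, h0⟩ h ls (fun _ => 0) o)
      (conf K .ready ⟨k', h1⟩ (min (d.move h) (n + 1)) ls (fun _ => 0) (o ++ w.toList)) :=
  runs_step (n := n) (s := s) (P := P) (ph := .ready) (k := ⟨_, h0⟩) (h := h) (ls := ls)
    (hd := fun _ => 0) (o := o) (a := _) ⟨_, h1⟩ ls (fun _ => 0) (hδ _) rfl (by simp) (by simp)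
    (by intro i; simp [Dir.move])

theorem Exec.le {B : ℕ} {p : Prog} {ρ ρ' : ℕ → ℕ} {w : List Sym} (h : Exec B p ρ w ρ')
    (hρ : ∀ r, ρ r ≤ B) : ∀ r, ρ' r ≤ B := by
  induction h with
  | @inc r ρ h =>
    intro i
    by_cases hi : i = r
    · subst hi; simpa using h
    · simpa [hi] using hρ i
  | @clear r ρ =>
    intro i
    by_cases hi : i = r
    · subst hi; simp
    · simpa [hi] using hρ i
  | print => exact hρ
  | skip => exact hρ
  | seq _ _ ih1 ih2 => exact ih2 (ih1 hρ)
  | ifEq_pos _ _ ih => exact ih hρ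
  | ifEq_neg _ _ ih => exact ih hρ
  | while_exit => exact hρ
  | while_step _ _ _ ih1 ih2 => exact ih2 (ih1 hρ)

/-- The machine executes programs. -/
theorem Exec.runs {B : ℕ} {p : Prog} {ρ ρ' : ℕ → ℕ} {w : List Sym} (he : Exec B p ρ w ρ')
    (hs : B.size + 1 ≤ s) (h : ℕ) (hn : h ≤ n + 1) :
    ∀ (k : List Prog) (o : List Sym) (h0 : p :: k ∈ P.conts [] ∪ {[]})
      (hk : k ∈ P.conts [] ∪ {[]}), (∀ r, ρ r ≤ B) → p.conts k ⊆ P.conts [] ∪ {[]} → p.width ≤ K →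
    (P.machine K).Runs n s (conf K .ready ⟨_, h0⟩ h (digits ρ) (fun _ => 0) o)
      (conf K .ready ⟨k, hk⟩ h (digits ρ') (fun _ => 0) (o ++ w)) := by
  have hsize : ∀ {ρ : ℕ → ℕ}, (∀ r, ρ r ≤ B) → ∀ r, (ρ r).bits.length + 1 ≤ s := by
    intro ρ hρ r
    rw [Nat.size_eq_bits_len]
    have := Nat.size_le_size (hρ r)
    omega
  induction he with
  | @inc r ρ _ =>
    intro k o h0 hk hρ _ hw
    simpa using runs_inc r hw k h0 hk h o hn ρ (hsize hρ r)
  | @clear r ρ =>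
    intro k o h0 hk hρ _ hw
    simpa using runs_clear r hw k h0 hk h o hn ρ (hsize hρ r)
  | @print c ρ =>
    intro k o h0 hk hρ _ _
    simpa [Dir.move, Nat.min_eq_left hn] using
      runs_plain (K := K) (n := n) (s := s) _ k h0 hk (some c) h .stay (digits ρ) o (fun t => by simp only [delta])
  | @skip ρ =>
    intro k o h0 hk hρ _ _
    simpa [Dir.move, Nat.min_eq_left hn] using
      runs_plain (K := K) (n := n) (s := s) _ k h0 hk none h .stay (digits ρ) o (fun t => by simp only [delta])
  | @seq p q ρ ρ' ρ'' v w hp hq ihp ihq =>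
    intro k o h0 hk hρ hc hw
    simp only [width, max_le_iff] at hw
    have c1 : p.conts (q :: k) ⊆ P.conts [] ∪ {[]} := fun x hx => hc (Or.inr (Or.inl hx))
    have c2 : q.conts k ⊆ P.conts [] ∪ {[]} := fun x hx => hc (Or.inr (Or.inr hx))
    have m1 := c1 (cons_mem_conts p _)
    have m2 := c2 (cons_mem_conts q _)
    have := runs_plain (n := n) (s := s) (K := K) _ (p :: q :: k) h0 m1 none h .stay (digits ρ) o
      (fun t => by simp only [delta])
    refine TuringTransducer.Runs.trans (b := conf K .ready ⟨_, m1⟩ h (digits ρ) (fun _ => 0) o) ?_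
      (TuringTransducer.Runs.trans (ihp (q :: k) o m1 m2 hρ c1 hw.1) ?_)
    · simpa [Dir.move, Nat.min_eq_left hn] using this
    · simpa using ihq k (o ++ v) m2 hk (hp.le hρ) c2 hw.2
  | @ifEq_pos a b p q ρ ρ' w hab hp ih =>
    intro k o h0 hk hρ hc hw
    simp only [width, max_le_iff] at hw
    have c1 : p.conts k ⊆ P.conts [] ∪ {[]} := fun x hx => hc (Or.inr (Or.inl hx))
    have c2 : q.conts k ⊆ P.conts [] ∪ {[]} := fun x hx => hc (Or.inr (Or.inr hx))
    have m1 := c1 (cons_mem_conts p _)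
    have m2 := c2 (cons_mem_conts q _)
    have := runs_compare (K := K) (s := s) a b (by omega) (by omega) _ (p :: k) (q :: k) h0 m1 m2
      (fun i t => by simp only [delta]) (fun i t => by simp only [delta]) h o hn ρ (hsize hρ a)
    rw [if_pos hab] at this
    exact this.trans (ih k o m1 hk hρ c1 hw.2.1)
  | @ifEq_neg a b p q ρ ρ' w hab hp ih =>
    intro k o h0 hk hρ hc hw
    simp only [width, max_le_iff] at hw
    have c1 : p.conts k ⊆ P.conts [] ∪ {[]} := fun x hx => hc (Or.inr (Or.inl hx))
    have c2 : q.conts k ⊆ P.conts [] ∪ {[]} := fun x hx => hc (Or.inr (Or.inr hx))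
    have m1 := c1 (cons_mem_conts p _)
    have m2 := c2 (cons_mem_conts q _)
    have := runs_compare (K := K) (s := s) a b (by omega) (by omega) _ (p :: k) (q :: k) h0 m1 m2
      (fun i t => by simp only [delta]) (fun i t => by simp only [delta]) h o hn ρ (hsize hρ a)
    rw [if_neg hab] at this
    exact this.trans (ih k o m2 hk hρ c2 hw.2.2)
  | @while_exit a b p ρ hab =>
    intro k o h0 hk hρ hc hw
    simp only [width, max_le_iff] at hw
    have c1 : p.conts (whileNe a b p :: k) ⊆ P.conts [] ∪ {[]} := fun x hx => hc (Or.inr hx)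
    have := runs_compare (K := K) (s := s) a b (by omega) (by omega) _ k (p :: whileNe a b p :: k) h0 hk
      (c1 (cons_mem_conts p _))
      (fun i t => by simp only [delta]) (fun i t => by simp only [delta]) h o hn ρ (hsize hρ a)
    rw [if_pos hab] at this
    simpa using this
  | @while_step a b p ρ ρ' ρ'' v w hab hp hq ihp ihq =>
    intro k o h0 hk hρ hc hw
    have hw' := hw
    simp only [width, max_le_iff] at hw
    have c1 : p.conts (whileNe a b p :: k) ⊆ P.conts [] ∪ {[]} := fun x hx => hc (Or.inr hx)
    have m1 := c1 (cons_mem_conts p _)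
    have := runs_compare (K := K) (s := s) a b (by omega) (by omega) _ k (p :: whileNe a b p :: k) h0 hk m1
      (fun i t => by simp only [delta]) (fun i t => by simp only [delta]) h o hn ρ (hsize hρ a)
    rw [if_neg hab] at this
    refine this.trans ((ihp _ o m1 h0 hρ c1 hw.2).trans ?_)
    simpa using ihq k (o ++ v) h0 hk (hp.le hρ) hc hw'

end Run

theorem runs_load {P : Prog} {K n s : ℕ} (k : List Prog)
    (h0 : load 0 :: k ∈ P.conts [] ∪ {[]}) (h1 : inc 0 :: load 0 :: k ∈ P.conts [] ∪ {[]})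
    (hk : k ∈ P.conts [] ∪ {[]}) (hK : 0 < K) (hs : (n + 1).size + 1 ≤ s) (o : List Sym) :
    (P.machine K).Runs n s (conf K .ready ⟨_, h0⟩ 0 (digits fun _ => 0) (fun _ => 0) o)
      (conf K .ready ⟨k, hk⟩ (n + 1) (digits (Function.update (fun _ => 0) 0 n)) (fun _ => 0) o) := by
  have main : ∀ d h : ℕ, h + d = n → (P.machine K).Runs n s
      (conf K .ready ⟨_, h0⟩ (h + 1) (digits (Function.update (fun _ => 0) 0 h)) (fun _ => 0) o)
      (conf K .ready ⟨k, hk⟩ (n + 1) (digits (Function.update (fun _ => 0) 0 n)) (fun _ => 0) o) := by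
    intro d
    induction d with
    | zero =>
      intro h hd
      obtain rfl : h = n := by omega
      have := runs_plain (s := s) (n := h) (K := K) _ k h0 hk none (h + 1) .stay
        (digits (Function.update (fun _ => 0) 0 h)) o (fun t => by simp [delta, inputTape])
      simpa [Dir.move] using this
    | succ d ih =>
      intro h hd
      have e1 := runs_plain (s := s) (n := n) (K := K) _ (inc 0 :: load 0 :: k) h0 h1 none (h + 1)
        .right (digits (Function.update (fun _ => 0) 0 h)) o
        (fun t => by
          have : inputTape n (h + 1) = .one := by
            rw [inputTape, if_neg (by omega), if_pos (by omega)]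
          simp [delta, this])
      have e2 := runs_inc 0 hK _ h1 h0 (h + 1 + 1) o (by omega : h + 1 + 1 ≤ n + 1)
        (Function.update (fun _ => 0) 0 h) (s := s) (by
          have := Nat.size_le_size (show h ≤ n + 1 by omega)
          simp only [Function.update_self, Nat.size_eq_bits_len]; omega)
      simp only [Function.update_self, Function.update_idem] at e2
      have e3 : min (Dir.right.move (h + 1)) (n + 1) = h + 1 + 1 := by simp [Dir.move]; omega
      rw [e3] at e1
      simp only [Option.toList_none, List.append_nil] at e1
      exact e1.trans (e2.trans (ih (h + 1) (by omega)))
  have e1 := runs_plain (s := s) (n := n) (K := K) _ (load 0 :: k) h0 h0 none 0 .right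
    (digits fun _ => 0) o (fun t => by simp [delta, inputTape])
  have e2 := main n 0 (by omega)
  have e3 : Function.update (fun _ : ℕ => 0) 0 0 = fun _ => 0 := Function.update_eq_self _ _
  rw [e3] at e2
  refine TuringTransducer.Runs.trans ?_ e2
  simpa [Dir.move] using e1

theorem size_pow_le (c n : ℕ) : ((n + 2) ^ c).size ≤ c * (Nat.log 2 n + 2) + 1 := by
  rw [Nat.size_le]
  have h1 : n < 2 ^ (Nat.log 2 n + 1) := Nat.lt_pow_succ_log_self (by norm_num) n
  have h3 : 2 ≤ 2 ^ (Nat.log 2 n + 1) := by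
    calc 2 = 2 ^ 1 := rfl
      _ ≤ _ := Nat.pow_le_pow_right (by norm_num) (by omega)
  have h2 : n + 2 ≤ 2 ^ (Nat.log 2 n + 2) := by rw [pow_succ]; omega
  calc (n + 2) ^ c ≤ (2 ^ (Nat.log 2 n + 2)) ^ c := Nat.pow_le_pow_left h2 c
    _ = 2 ^ (c * (Nat.log 2 n + 2)) := by rw [← pow_mul, mul_comm]
    _ < _ := Nat.pow_lt_pow_right (by norm_num) (by omega)

/-- A program whose registers stay polynomially bounded is executed in logarithmic space. -/
theorem exists_machine (p : Prog) (c : ℕ) (w : ℕ → List Sym)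
    (h : ∀ n, ∃ ρ', Exec ((n + 2) ^ c) p (Function.update (fun _ => 0) 0 n) (w n) ρ') (hc : 1 ≤ c) :
    ∃ M : TuringTransducer Sym, M.IsLogSpace ∧ ∀ n, M.Outputs n (w n) := by
  set P := seq (load 0) p with hP
  set K := P.width with hK
  have key : ∀ n, ∃ ls, (P.machine K).Runs n (((n + 2) ^ c).size + 1) (P.machine K).init
      (conf K .ready ⟨[], Or.inr rfl⟩ (n + 1) ls (fun _ => 0) (w n)) := by
    intro n
    obtain ⟨ρ', he⟩ := h n
    set s := ((n + 2) ^ c).size + 1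
    have m0 : [P] ∈ P.conts [] ∪ {[]} := Or.inl (cons_mem_conts P [])
    have mc : p.conts [] ⊆ P.conts [] ∪ {[]} := fun x hx => Or.inl (Or.inr (Or.inr hx))
    have m1 : [p] ∈ P.conts [] ∪ {[]} := mc (cons_mem_conts p [])
    have m2 : [load 0, p] ∈ P.conts [] ∪ {[]} := Or.inl (Or.inr (Or.inl (by simp [conts])))
    have m3 : [inc 0, load 0, p] ∈ P.conts [] ∪ {[]} := Or.inl (Or.inr (Or.inl (by simp [conts])))
    have e0 : (P.machine K).Runs n s (P.machine K).init
        (conf K .ready ⟨[P], m0⟩ 0 (digits fun _ => 0) (fun _ => 0) []) := by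
      refine Relation.ReflTransGen.single ⟨?_, fun i => Nat.zero_le _⟩
      simp only [TuringTransducer.step, TuringTransducer.init, machine, delta, Option.map_some, conf,
        Option.some.injEq]
      have hm : ([P] : List Prog) ∈ P.conts [] ∪ {[]} := m0
      rw [dif_pos hm]
      congr 1
      funext i
      funext q
      rcases q with _ | q
      · simp [tapeOf]
      · simp [tapeOf, digits]
    have e1 := runs_plain (s := s) (n := n) (K := K) [P] [load 0, p] m0 m2 none 0 .stay
      (digits fun _ => 0) [] (fun t => by rw [hP]; simp only [delta])
    have e2 := runs_load (n := n) (s := s) (P := P) (K := K) [p] m2 m3 m1 (by rw [hK, hP]; simp [width])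
      (by
        have : n + 1 ≤ (n + 2) ^ c := by
          calc n + 1 ≤ (n + 2) ^ 1 := by rw [pow_one]; omega
            _ ≤ _ := Nat.pow_le_pow_right (by omega) hc
        have := Nat.size_le_size this
        omega) []
    have e3 := he.runs (P := P) (K := K) (n := n) (s := s) le_rfl (n + 1) le_rfl [] [] m1 (Or.inr rfl)
      (by
        intro r
        by_cases hr : r = 0
        · subst hr
          simp only [Function.update_self]
          calc n ≤ (n + 2) ^ 1 := by rw [pow_one]; omega
            _ ≤ _ := Nat.pow_le_pow_right (by omega) hc
        · simp [hr])
      mc (by rw [hK, hP]; simp [width])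
    simp only [Dir.move, Option.toList_none, List.append_nil] at e1
    exact ⟨_, e0.trans (e1.trans (e2.trans (by simpa using e3)))⟩
  have hhalt : ∀ n ls, (P.machine K).step n
      (conf K .ready ⟨[], Or.inr rfl⟩ (n + 1) ls (fun _ => 0) (w n)) = none := by
    intro n ls
    simp [TuringTransducer.step, conf, machine, delta]
  refine ⟨P.machine K, ⟨2 * c + 2, fun n x hx i => ?_⟩, fun n => ?_⟩
  · obtain ⟨ls, hr⟩ := key n
    refine (hr.head_le (hhalt n ls) (fun i => Nat.zero_le _) hx i).trans ?_
    have := size_pow_le c n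
    nlinarith
  · obtain ⟨ls, hr⟩ := key n
    exact ⟨_, StateTransition.mem_eval.2 ⟨hr.reaches, hhalt n ls⟩, rfl⟩

end Prog

/-! ### Functions computed with polynomially bounded registers -/

section Calculus

variable {α β : Type}

/-- On the domain `D`, the function `f` is bounded by a polynomial in the size `n`. -/
def PolyBounded (D : Set α) (n f : α → ℕ) : Prop := ∃ c, ∀ a ∈ D, f a ≤ (n a + 2) ^ c

theorem pow_le_pow_of_le_max {m c d B : ℕ} (h : (m + 2) ^ max c d ≤ B) :
    (m + 2) ^ c ≤ B ∧ (m + 2) ^ d ≤ B :=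
  ⟨(Nat.pow_le_pow_right (by omega) (le_max_left _ _)).trans h,
    (Nat.pow_le_pow_right (by omega) (le_max_right _ _)).trans h⟩

theorem PolyBounded.mono {D : Set α} {n f g : α → ℕ} (hf : PolyBounded D n f)
    (h : ∀ a ∈ D, g a ≤ f a) : PolyBounded D n g :=
  hf.imp fun _ hc a ha => (h a ha).trans (hc a ha)

theorem PolyBounded.mul {D : Set α} {n f g : α → ℕ} (hf : PolyBounded D n f)
    (hg : PolyBounded D n g) : PolyBounded D n (fun a => f a * g a) := by
  obtain ⟨c, hc⟩ := hf
  obtain ⟨d, hd⟩ := hg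
  exact ⟨c + d, fun a ha => by rw [pow_add]; exact Nat.mul_le_mul (hc a ha) (hd a ha)⟩

theorem PolyBounded.const (D : Set α) (n : α → ℕ) (m : ℕ) : PolyBounded D n (fun _ => m) :=
  ⟨m, fun a _ => (Nat.lt_two_pow_self (n := m)).le.trans (Nat.pow_le_pow_left (by omega) m)⟩

theorem PolyBounded.size (D : Set α) (n : α → ℕ) : PolyBounded D n n :=
  ⟨1, fun a _ => by rw [pow_one]; omega⟩

theorem PolyBounded.add {D : Set α} {n f g : α → ℕ} (hf : PolyBounded D n f)
    (hg : PolyBounded D n g) : PolyBounded D n (fun a => f a + g a) := by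
  obtain ⟨c, hc⟩ := hf
  obtain ⟨d, hd⟩ := hg
  refine ⟨max c d + 1, fun a ha => ?_⟩
  obtain ⟨h1, h2⟩ := pow_le_pow_of_le_max (le_refl ((n a + 2) ^ max c d))
  have := hc a ha
  have := hd a ha
  rw [pow_succ]
  nlinarith [Nat.zero_le (n a)]

theorem PolyBounded.pow {D : Set α} {n f : α → ℕ} (hf : PolyBounded D n f) (e : ℕ) :
    PolyBounded D n (fun a => f a ^ e) := by
  induction e with
  | zero => simpa using PolyBounded.const D n 1
  | succ e ih => simpa [pow_succ] using ih.mul hf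

theorem PolyBounded.comp {D : Set α} {n f : α → ℕ} (hf : PolyBounded D n f) {D' : Set β}
    {n' : β → ℕ} {φ : β → α} (hφ : Set.MapsTo φ D' D) (hn : PolyBounded D' n' fun b => n (φ b) + 2) :
    PolyBounded D' n' (fun b => f (φ b)) := by
  obtain ⟨c, hc⟩ := hf
  obtain ⟨d, hd⟩ := hn
  refine ⟨d * c, fun b hb => (hc _ (hφ hb)).trans ?_⟩
  rw [pow_mul]
  exact Nat.pow_le_pow_left (hd b hb) c

/-- There is a program that prints `o a` and computes `F 0 a, …, F (m - 1) a`, when it finds the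
values `x a`, `x ∈ X`, in registers below `k`. It leaves these registers unchanged and stores its
results in the registers from `k` on; all values are bounded by a polynomial in `n a`. The invariant
`I` records in which registers the values are found. -/
def Runs (D : Set α) (n : α → ℕ) (X : List (α → ℕ)) (o : α → List Sym) (m : ℕ) (F : ℕ → α → ℕ) :
    Prop :=
  ∀ (k : ℕ) (I : α → (ℕ → ℕ) → Prop),
    (∀ x ∈ X, ∃ q < k, ∀ a ∈ D, ∀ ρ, I a ρ → ρ q = x a) →
    ∃ (c : ℕ) (p : Prog), ∀ a ∈ D, ∀ B, (n a + 2) ^ c ≤ B → ∀ ρ : ℕ → ℕ, (∀ i, ρ i ≤ B) → I a ρ →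
      ∃ ρ', Prog.Exec B p ρ (o a) ρ' ∧ (∀ i < k, ρ' i = ρ i) ∧ ∀ j < m, ρ' (k + j) = F j a

/-- A number-valued function that is computed, from the functions in `X`, with polynomially bounded
registers. -/
def LS (D : Set α) (n : α → ℕ) (X : List (α → ℕ)) (f : α → ℕ) : Prop :=
  PolyBounded D n f ∧ Runs D n X (fun _ => []) 1 (fun _ => f)

/-- A string-valued function whose values are printed, given the functions in `X`, with polynomially
bounded registers. -/
def Prints (D : Set α) (n : α → ℕ) (X : List (α → ℕ)) (o : α → List Sym) : Prop :=
  Runs D n X o 0 (fun _ _ => 0)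

/-- Copy register `t` to register `s`. -/
def Prog.copy (s t : ℕ) : Prog := .seq (.clear s) (.whileNe s t (.inc s))

theorem Prog.exec_copy {B s t : ℕ} {ρ : ℕ → ℕ} (hst : s ≠ t) (hB : ρ t ≤ B) :
    Exec B (copy s t) ρ [] (Function.update ρ s (ρ t)) := by
  have main : ∀ d v : ℕ, v + d = ρ t →
      Exec B (.whileNe s t (.inc s)) (Function.update ρ s v) [] (Function.update ρ s (ρ t)) := by
    intro d
    induction d with
    | zero =>
      intro v hv
      obtain rfl : v = ρ t := by omega
      exact .while_exit (by simp [Function.update_of_ne hst.symm])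
    | succ d ih =>
      intro v hv
      have e : Exec B (.inc s) (Function.update ρ s v) [] (Function.update ρ s (v + 1)) := by
        have := Exec.inc (B := B) (r := s) (ρ := Function.update ρ s v)
          (by simp only [Function.update_self]; omega)
        simpa using this
      exact .while_step (v := []) (w := [])
        (by simp only [Function.update_self, Function.update_of_ne hst.symm]; omega) e
        (ih (v + 1) (by omega))
  exact Exec.seq (v := []) (w := []) Exec.clear (main (ρ t) 0 (by omega))

/-- Copy `m` registers from `u` on to those from `w` on. -/
def Prog.copyRange (w u : ℕ) : ℕ → Prog
  | 0 => .skip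
  | m + 1 => .seq (copyRange w u m) (copy (w + m) (u + m))

theorem Prog.exec_copyRange {B w u : ℕ} {ρ : ℕ → ℕ} (hwu : w < u) (hB : ∀ i, ρ i ≤ B) (m : ℕ) :
    ∃ ρ', Exec B (copyRange w u m) ρ [] ρ' ∧ (∀ i, i < w ∨ w + m ≤ i → ρ' i = ρ i) ∧
      ∀ j < m, ρ' (w + j) = ρ (u + j) := by
  induction m with
  | zero => exact ⟨ρ, .skip, fun _ _ => rfl, fun j hj => absurd hj (by omega)⟩
  | succ m ih =>
    obtain ⟨ρ', h1, h2, h3⟩ := ih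
    have h4 : ρ' (u + m) = ρ (u + m) := h2 _ (Or.inr (by omega))
    refine ⟨_, Exec.seq (v := []) (w := []) h1 (exec_copy (by omega) (h1.le hB _)), ?_, ?_⟩
    · intro i hi
      rw [Function.update_of_ne (by omega)]
      exact h2 i (by omega)
    · intro j hj
      by_cases hjm : j = m
      · subst hjm; simp [h4]
      · rw [Function.update_of_ne (by omega)]
        exact h3 j (by omega)

namespace Runs

variable {D : Set α} {n : α → ℕ} {X : List (α → ℕ)} {o o' : α → List Sym} {m m' : ℕ}
  {F G : ℕ → α → ℕ}

theorem congr (h : Runs D n X o m F) (ho : ∀ a ∈ D, o a = o' a)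
    (hF : ∀ a ∈ D, ∀ j < m, F j a = G j a) : Runs D n X o' m G := by
  intro k I hI
  obtain ⟨c, p, hp⟩ := h k I hI
  refine ⟨c, p, fun a ha B hB ρ hρ hi => ?_⟩
  obtain ⟨ρ', h1, h2, h3⟩ := hp a ha B hB ρ hρ hi
  exact ⟨ρ', ho a ha ▸ h1, h2, fun j hj => (h3 j hj).trans (hF a ha j hj)⟩

theorem mono {X' : List (α → ℕ)} (h : Runs D n X o m F) (hX : X ⊆ X') : Runs D n X' o m F :=
  fun k I hI => h k I fun x hx => hI x (hX hx)

theorem mono_dom {D' : Set α} (h : Runs D n X o m F) (hD : D' ⊆ D) : Runs D' n X o m F := by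
  intro k I hI
  obtain ⟨c, p, hp⟩ := h k (fun a ρ => a ∈ D' ∧ I a ρ) (fun x hx => by
    obtain ⟨q, hq, h⟩ := hI x hx
    exact ⟨q, hq, fun a _ ρ hi => h a hi.1 ρ hi.2⟩)
  exact ⟨c, p, fun a ha B hB ρ hρ hi => hp a (hD ha) B hB ρ hρ ⟨ha, hi⟩⟩

theorem comp (h : Runs D n X o m F) {D' : Set β} {n' : β → ℕ} {φ : β → α} (hφ : Set.MapsTo φ D' D)
    (hn : PolyBounded D' n' fun b => n (φ b) + 2) :
    Runs D' n' (X.map fun x b => x (φ b)) (fun b => o (φ b)) m (fun j b => F j (φ b)) := by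
  intro k I hI
  obtain ⟨c, p, hp⟩ := h k (fun a ρ => ∃ b ∈ D', φ b = a ∧ I b ρ) (fun x hx => by
    obtain ⟨q, hq, h⟩ := hI (fun b => x (φ b)) (List.mem_map.2 ⟨x, hx, rfl⟩)
    refine ⟨q, hq, ?_⟩
    rintro _ _ ρ ⟨b, hb, rfl, hi⟩
    exact h b hb ρ hi)
  obtain ⟨d, hd⟩ := hn
  refine ⟨d * c, p, fun b hb B hB ρ hρ hi => hp (φ b) (hφ hb) B ?_ ρ hρ ⟨b, hb, rfl, hi⟩⟩
  rw [pow_mul] at hB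
  exact (Nat.pow_le_pow_left (hd b hb) c).trans hB

/-- The second program may use the results of the first. -/
theorem bind (h : Runs D n X o m F) {X' : List (α → ℕ)} (h' : Runs D n X' o' m' G)
    (hX : ∀ x ∈ X', x ∈ X ∨ ∃ j < m, x = F j) :
    Runs D n X (fun a => o a ++ o' a) (m + m') (fun j => if j < m then F j else G (j - m)) := by
  intro k I hI
  obtain ⟨c, p, hp⟩ := h k I hI
  obtain ⟨d, q, hq⟩ := h' (k + m)
    (fun a ρ => (∃ ρ₀, I a ρ₀ ∧ ∀ i < k, ρ i = ρ₀ i) ∧ ∀ j < m, ρ (k + j) = F j a) (fun x hx => by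
      rcases hX x hx with hx | ⟨j, hj, rfl⟩
      · obtain ⟨q, hq, h⟩ := hI x hx
        refine ⟨q, by omega, ?_⟩
        rintro a ha ρ ⟨⟨ρ₀, hi, h0⟩, -⟩
        rw [h0 q hq, h a ha ρ₀ hi]
      · exact ⟨k + j, by omega, fun a _ ρ hi => hi.2 j hj⟩)
  refine ⟨max c d, .seq p q, fun a ha B hB ρ hρ hi => ?_⟩
  obtain ⟨hB1, hB2⟩ := pow_le_pow_of_le_max hB
  obtain ⟨ρ', h1, h2, h3⟩ := hp a ha B hB1 ρ hρ hi
  obtain ⟨ρ'', h4, h5, h6⟩ := hq a ha B hB2 ρ' (h1.le hρ) ⟨⟨ρ, hi, h2⟩, h3⟩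
  refine ⟨ρ'', h1.seq h4, fun i hik => (h5 i (by omega)).trans (h2 i hik), fun j hj => ?_⟩
  simp only
  split
  · rename_i hjm
    rw [h5 _ (by omega), h3 j hjm]
  · rename_i hjm
    rw [← h6 (j - m) (by omega)]
    congr 1
    omega

/-- Intermediate results are forgotten. -/
theorem drop (h : Runs D n X o (m + m') F) (hm : 0 < m) :
    Runs D n X o m' (fun j => F (m + j)) := by
  intro k I hI
  obtain ⟨c, p, hp⟩ := h k I hI
  refine ⟨c, .seq p (.copyRange k (k + m) m'), fun a ha B hB ρ hρ hi => ?_⟩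
  obtain ⟨ρ', h1, h2, h3⟩ := hp a ha B hB ρ hρ hi
  obtain ⟨ρ'', h4, h5, h6⟩ := Prog.exec_copyRange (w := k) (u := k + m) (by omega) (h1.le hρ) m'
  refine ⟨ρ'', by simpa using h1.seq h4, fun i hik => (h5 i (Or.inl hik)).trans (h2 i hik),
    fun j hj => ?_⟩
  rw [h6 j hj, show k + m + j = k + (m + j) by omega, h3 (m + j) (by omega)]

theorem lets_one {f : α → ℕ} (hf : LS D n X f) (h : Runs D n (f :: X) o m F) : Runs D n X o m F := by
  have h1 := (hf.2.bind h (fun x hx => by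
    rcases List.mem_cons.1 hx with rfl | hx
    · exact Or.inr ⟨0, by omega, rfl⟩
    · exact Or.inl hx)).drop one_pos
  exact h1.congr (fun a _ => rfl) (fun a _ j _ => by simp)

/-- Functions that can be computed may be used. -/
theorem lets {Y : List (α → ℕ)} (h : Runs D n Y o m F) (hY : ∀ y ∈ Y, LS D n X y) :
    Runs D n X o m F := by
  have main : ∀ L : List (α → ℕ), (∀ y ∈ L, LS D n X y) → Runs D n (L ++ X) o m F →
      Runs D n X o m F := by
    intro L
    induction L with
    | nil => exact fun _ h => h
    | cons f L ih =>
      intro hL h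
      refine ih (fun y hy => hL y (List.mem_cons_of_mem _ hy)) (lets_one ?_ h)
      exact ⟨(hL f List.mem_cons_self).1, (hL f List.mem_cons_self).2.mono
        (List.subset_append_right _ _)⟩
  exact main Y hY (h.mono (List.subset_append_left _ _))

theorem skip : Runs D n X (fun _ => []) 0 F := fun _ _ _ =>
  ⟨0, .skip, fun _ _ _ _ ρ _ _ => ⟨ρ, .skip, fun _ _ => rfl, fun j hj => absurd hj (by omega)⟩⟩

theorem print (s : Sym) : Runs D n X (fun _ => [s]) 0 F := fun _ _ _ =>
  ⟨0, .print s, fun _ _ _ _ ρ _ _ => ⟨ρ, .print, fun _ _ => rfl, fun j hj => absurd hj (by omega)⟩⟩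

/-- Several results are computed one after another. -/
theorem vec (h : ∀ j < m, LS D n X (F j)) : Runs D n X (fun _ => []) m F := by
  induction m with
  | zero => exact skip
  | succ m ih =>
    have := (ih fun j hj => h j (by omega)).bind (h m (by omega)).2 (fun x hx => Or.inl hx)
    refine this.congr (fun _ _ => rfl) (fun a _ j hj => ?_)
    split
    · rfl
    · rw [show j = m by omega]

/-- Case distinction. -/
theorem ite_eq {f g : α → ℕ} (hf : LS D n X f) (hg : LS D n X g)
    (h : Runs (D ∩ {a | f a = g a}) n X o m F) (h' : Runs (D ∩ {a | f a ≠ g a}) n X o' m G) :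
    Runs D n X (fun a => if f a = g a then o a else o' a) m
      (fun j a => if f a = g a then F j a else G j a) := by
  intro k I hI
  have hfg : Runs D n X (fun _ => []) 2 (fun j => if j < 1 then f else g) :=
    hf.2.bind hg.2 (fun x hx => Or.inl hx)
  obtain ⟨c, p, hp⟩ := hfg k I hI
  have hJ : ∀ x ∈ X, ∃ q < k, ∀ a ∈ D, ∀ ρ : ℕ → ℕ,
      (∃ ρ₀, I a ρ₀ ∧ ∀ i < k, ρ i = ρ₀ i) → ρ q = x a := by
    intro x hx
    obtain ⟨q, hq, h⟩ := hI x hx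
    refine ⟨q, hq, ?_⟩
    rintro a ha ρ ⟨ρ₀, hi, h0⟩
    rw [h0 q hq, h a ha ρ₀ hi]
  obtain ⟨d, q, hq⟩ := h k (fun a ρ => ∃ ρ₀, I a ρ₀ ∧ ∀ i < k, ρ i = ρ₀ i) (fun x hx =>
    (hJ x hx).imp fun q hq => ⟨hq.1, fun a ha => hq.2 a ha.1⟩)
  obtain ⟨e, r, hr⟩ := h' k (fun a ρ => ∃ ρ₀, I a ρ₀ ∧ ∀ i < k, ρ i = ρ₀ i) (fun x hx =>
    (hJ x hx).imp fun q hq => ⟨hq.1, fun a ha => hq.2 a ha.1⟩)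
  refine ⟨max c (max d e), .seq p (.ifEq k (k + 1) q r), fun a ha B hB ρ hρ hi => ?_⟩
  obtain ⟨hB1, hB2⟩ := pow_le_pow_of_le_max hB
  obtain ⟨hB2, hB3⟩ := pow_le_pow_of_le_max hB2
  obtain ⟨ρ', h1, h2, h3⟩ := hp a ha B hB1 ρ hρ hi
  have e0 : ρ' k = f a := by simpa using h3 0 (by omega)
  have e1 : ρ' (k + 1) = g a := by simpa using h3 1 (by omega)
  by_cases hc : f a = g a
  · obtain ⟨ρ'', h4, h5, h6⟩ := hq a ⟨ha, hc⟩ B hB2 ρ' (h1.le hρ) ⟨ρ, hi, h2⟩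
    exact ⟨ρ'', by simpa [hc] using h1.seq (.ifEq_pos (by rw [e0, e1, hc]) h4),
      fun i hik => (h5 i hik).trans (h2 i hik), fun j hj => by simpa [hc] using h6 j hj⟩
  · obtain ⟨ρ'', h4, h5, h6⟩ := hr a ⟨ha, hc⟩ B hB3 ρ' (h1.le hρ) ⟨ρ, hi, h2⟩
    exact ⟨ρ'', by simpa [hc] using h1.seq (.ifEq_neg (by rwa [e0, e1]) h4),
      fun i hik => (h5 i hik).trans (h2 i hik), fun j hj => by simpa [hc] using h6 j hj⟩

/-- The domain of the body of a loop. -/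
def _root_.CircuitComplexity.loopDom (D : Set α) (count : α → ℕ) : Set (α × ℕ) :=
  {p | p.1 ∈ D ∧ p.2 < count p.1}

/-- A loop that is run through `count` times. In iteration `i` it prints `o (·, i)` and replaces the
values `F j · i` of `m` variables by `F j · (i + 1)`. -/
theorem loop {count : α → ℕ} {F : ℕ → α → ℕ → ℕ} {o : α × ℕ → List Sym} (hc : LS D n X count)
    (h0 : Runs D n X (fun _ => []) m (fun j a => F j a 0))
    (hs : Runs (loopDom D count) (fun p => n p.1)
      (X.map (fun x p => x p.1) ++ (Prod.snd :: (List.range m).map fun j p => F j p.1 p.2))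
      o m (fun j p => F j p.1 (p.2 + 1))) :
    Runs D n X (fun a => (List.range (count a)).flatMap fun i => o (a, i)) m
      (fun j a => F j a (count a)) := by
  intro k I hI
  obtain ⟨c, p, hp⟩ := hc.2 k I hI
  obtain ⟨d, q, hq⟩ := h0 (k + 2) (fun a ρ => ∃ ρ₀, I a ρ₀ ∧ ∀ i < k, ρ i = ρ₀ i) (fun x hx => by
    obtain ⟨q, hq, h⟩ := hI x hx
    refine ⟨q, by omega, ?_⟩
    rintro a ha ρ ⟨ρ₀, hi, h0⟩
    rw [h0 q hq, h a ha ρ₀ hi])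
  obtain ⟨e, r, hr⟩ := hs (k + 3 + m) (fun p ρ => (∃ ρ₀, I p.1 ρ₀ ∧ ∀ i < k, ρ i = ρ₀ i) ∧
      ρ (k + 1) = p.2 ∧ ∀ j < m, ρ (k + 2 + j) = F j p.1 p.2) (fun x hx => by
    simp only [List.mem_append, List.mem_map, List.mem_cons, List.mem_range] at hx
    rcases hx with ⟨x, hx, rfl⟩ | rfl | ⟨j, hj, rfl⟩
    · obtain ⟨q, hq, h⟩ := hI x hx
      refine ⟨q, by omega, ?_⟩
      rintro a ha ρ ⟨⟨ρ₀, hi, h0⟩, -⟩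
      rw [h0 q hq, h a.1 ha.1 ρ₀ hi]
    · exact ⟨k + 1, by omega, fun a _ ρ hi => hi.2.1⟩
    · exact ⟨k + 2 + j, by omega, fun a _ ρ hi => hi.2.2 j hj⟩)
  set body : Prog := .seq r (.seq (.copyRange (k + 2) (k + 3 + m) m) (.inc (k + 1)))
  refine ⟨max c (max d e), .seq p (.seq (.clear (k + 1)) (.seq q (.seq (.whileNe (k + 1) k body)
    (.copyRange k (k + 2) m)))), fun a ha B hB ρ hρ hi => ?_⟩
  obtain ⟨hB1, hB2⟩ := pow_le_pow_of_le_max hB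
  obtain ⟨hB2, hB3⟩ := pow_le_pow_of_le_max hB2
  obtain ⟨ρ₁, h1, h2, h3⟩ := hp a ha B hB1 ρ hρ hi
  have b1 := h1.le hρ
  have h4 : Prog.Exec B (.clear (k + 1)) ρ₁ [] (Function.update ρ₁ (k + 1) 0) := .clear
  have b2 := h4.le b1
  obtain ⟨ρ₂, h5, h6, h7⟩ := hq a ha B hB2 _ b2 ⟨ρ, hi, fun i hik => by
    rw [Function.update_of_ne (by omega), h2 i hik]⟩
  have b3 := h5.le b2
  have main : ∀ t i : ℕ, i + t = count a → ∀ σ : ℕ → ℕ, (∀ i, σ i ≤ B) → (∀ i < k, σ i = ρ i) →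
      σ k = count a → σ (k + 1) = i → (∀ j < m, σ (k + 2 + j) = F j a i) →
      ∃ σ', Prog.Exec B (.whileNe (k + 1) k body) σ
          ((List.range' i t).flatMap fun i => o (a, i)) σ' ∧
        (∀ i < k, σ' i = ρ i) ∧ (∀ j < m, σ' (k + 2 + j) = F j a (count a)) := by
    intro t
    induction t with
    | zero =>
      intro i hit σ hσ g1 g2 g3 g4
      refine ⟨σ, ?_, g1, ?_⟩
      · exact Prog.Exec.while_exit (by omega)
      · rw [show count a = i by omega]; exact g4
    | succ t ih =>
      intro i hit σ hσ g1 g2 g3 g4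
      obtain ⟨σ₁, e1, e2, e3⟩ := hr (a, i) ⟨ha, show i < count a by omega⟩ B hB3 σ hσ
        ⟨⟨ρ, hi, g1⟩, g3, g4⟩
      obtain ⟨σ₂, e4, e5, e6⟩ := Prog.exec_copyRange (w := k + 2) (u := k + 3 + m) (by omega)
        (e1.le hσ) m
      have e7 : σ₂ (k + 1) = i := by rw [e5 _ (Or.inl (by omega)), e2 _ (by omega), g3]
      have hck := hσ k
      have e8 : Prog.Exec B (.inc (k + 1)) σ₂ [] (Function.update σ₂ (k + 1) (i + 1)) := by
        have := Prog.Exec.inc (B := B) (r := k + 1) (ρ := σ₂) (by rw [e7]; omega)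
        rwa [e7] at this
      obtain ⟨σ', f1, f2, f3⟩ := ih (i + 1) (by omega) (Function.update σ₂ (k + 1) (i + 1))
        (e8.le (e4.le (e1.le hσ)))
        (fun l hl => by
          rw [Function.update_of_ne (by omega), e5 _ (Or.inl (by omega)), e2 _ (by omega), g1 l hl])
        (by rw [Function.update_of_ne (by omega), e5 _ (Or.inl (by omega)), e2 _ (by omega), g2])
        (by simp)
        (fun j hj => by rw [Function.update_of_ne (by omega), e6 j hj, e3 j hj])
      refine ⟨σ', ?_, f2, f3⟩
      have := Prog.Exec.while_step (a := k + 1) (b := k) (by omega) (e1.seq (e4.seq e8)) f1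
      simpa [List.range'_succ] using this
  obtain ⟨ρ₃, h8, h9, h10⟩ := main (count a) 0 (by omega) ρ₂ b3
    (fun i hik => by rw [h6 i (by omega), Function.update_of_ne (by omega), h2 i hik])
    (by rw [h6 k (by omega), Function.update_of_ne (by omega)]; exact h3 0 one_pos)
    (by rw [h6 _ (by omega), Function.update_self])
    h7
  obtain ⟨ρ₄, h11, h12, h13⟩ := Prog.exec_copyRange (w := k) (u := k + 2) (by omega) (h8.le b3) m
  refine ⟨ρ₄, ?_, fun i hik => by rw [h12 i (Or.inl hik), h9 i hik],
    fun j hj => by rw [h13 j hj, h10 j hj]⟩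
  have := h1.seq (h4.seq (h5.seq (h8.seq h11)))
  simpa [List.range_eq_range'] using this

end Runs

namespace LS

variable {D : Set α} {n : α → ℕ} {X : List (α → ℕ)} {f g : α → ℕ}

theorem congr (h : LS D n X f) (hfg : ∀ a ∈ D, f a = g a) : LS D n X g :=
  ⟨h.1.mono fun a ha => (hfg a ha).ge, h.2.congr (fun _ _ => rfl) (fun a ha _ _ => hfg a ha)⟩

theorem mono_dom {D' : Set α} (h : LS D n X f) (hD : D' ⊆ D) : LS D' n X f :=
  ⟨h.1.imp fun _ hc a ha => hc a (hD ha), h.2.mono_dom hD⟩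

theorem comp {Y : List (β → ℕ)} (h : LS D n X f) {D' : Set β} {n' : β → ℕ} {φ : β → α}
    (hφ : Set.MapsTo φ D' D)
    (hn : PolyBounded D' n' fun b => n (φ b) + 2) (hY : ∀ x ∈ X, LS D' n' Y fun b => x (φ b)) :
    LS D' n' Y (fun b => f (φ b)) := by
  refine ⟨h.1.comp hφ hn, (h.2.comp hφ hn).lets fun y hy => ?_⟩
  obtain ⟨x, hx, rfl⟩ := List.mem_map.1 hy
  exact hY x hx

theorem var (hf : f ∈ X) (hb : PolyBounded D n f) : LS D n X f := by
  refine ⟨hb, fun k I hI => ?_⟩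
  obtain ⟨q, hq, h⟩ := hI f hf
  refine ⟨0, .copy k q, fun a ha B hB ρ hρ hi =>
    ⟨_, Prog.exec_copy (by omega) (hρ q), fun i hik => ?_, fun j hj => ?_⟩⟩
  · rw [Function.update_of_ne (by omega)]
  · obtain rfl : j = 0 := by omega
    simpa using h a ha ρ hi

theorem zero : LS D n X (fun _ => 0) := by
  refine ⟨⟨0, fun _ _ => Nat.zero_le _⟩, fun k I _ => ⟨0, .clear k, fun a _ B _ ρ _ _ =>
    ⟨_, .clear, fun i hik => ?_, fun j hj => ?_⟩⟩⟩
  · rw [Function.update_of_ne (by omega)]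
  · obtain rfl : j = 0 := by omega
    simp

theorem succ (hf : LS D n X f) : LS D n X (fun a => f a + 1) := by
  have hb : PolyBounded D n (fun a => f a + 1) := hf.1.add (.const D n 1)
  refine ⟨hb, fun k I hI => ?_⟩
  obtain ⟨c, p, hp⟩ := hf.2 k I hI
  obtain ⟨d, hd⟩ := hb
  refine ⟨max c d, .seq p (.inc k), fun a ha B hB ρ hρ hi => ?_⟩
  obtain ⟨hB1, hB2⟩ := pow_le_pow_of_le_max hB
  obtain ⟨ρ', h1, h2, h3⟩ := hp a ha B hB1 ρ hρ hi
  have h4 : ρ' k = f a := h3 0 one_pos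
  have h5 : f a + 1 ≤ _ := hd a ha
  refine ⟨_, h1.seq (w := []) (.inc (by omega)), fun i hik => ?_, fun j hj => ?_⟩
  · rw [Function.update_of_ne (by omega), h2 i hik]
  · obtain rfl : j = 0 := by omega
    simp [h4]

theorem const (c : ℕ) : LS D n X (fun _ => c) := by
  induction c with
  | zero => exact zero
  | succ c ih => exact ih.succ

theorem ite_eq {u v : α → ℕ} (hf : LS D n X f) (hg : LS D n X g)
    (hu : LS (D ∩ {a | f a = g a}) n X u) (hv : LS (D ∩ {a | f a ≠ g a}) n X v) :
    LS D n X (fun a => if f a = g a then u a else v a) := by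
  refine ⟨?_, ?_⟩
  · obtain ⟨c, hc⟩ := hu.1
    obtain ⟨d, hd⟩ := hv.1
    refine ⟨max c d, fun a ha => ?_⟩
    obtain ⟨h1, h2⟩ := pow_le_pow_of_le_max (le_refl ((n a + 2) ^ max c d))
    simp only
    split
    · rename_i h; exact (hc a ⟨ha, h⟩).trans h1
    · rename_i h; exact (hd a ⟨ha, h⟩).trans h2
  · exact (Runs.ite_eq hf hg hu.2 hv.2).congr (fun _ _ => by simp) (fun _ _ _ _ => rfl)

/-- Simultaneous recursion. The values of the `m` variables before iteration `i` are `F j · i`; it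
suffices to compute `F j · (i + 1)` from them and from the functions that can be computed outside of
the loop. -/
theorem loop {count : α → ℕ} {m : ℕ} {F : ℕ → α → ℕ → ℕ} (hc : LS D n X count)
    (hb : ∀ j < m, ∃ c, ∀ a ∈ D, ∀ i ≤ count a, F j a i ≤ (n a + 2) ^ c)
    (h0 : ∀ j < m, LS D n X (fun a => F j a 0))
    (hs : ∀ Y : List (α × ℕ → ℕ),
      (∀ g, LS D n X g → LS (loopDom D count) (fun p => n p.1) Y (fun p => g p.1)) →
      LS (loopDom D count) (fun p => n p.1) Y (fun p => p.2) →
      (∀ j < m, LS (loopDom D count) (fun p => n p.1) Y (fun p => F j p.1 p.2)) →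
      ∀ j < m, LS (loopDom D count) (fun p => n p.1) Y (fun p => F j p.1 (p.2 + 1))) :
    ∀ j < m, LS D n X (fun a => F j a (count a)) := by
  have main : Runs D n X (fun _ => []) m (fun j a => F j a (count a)) := by
    refine Runs.congr (o := fun a => (List.range (count a)).flatMap fun i => []) ?_
      (fun _ _ => by simp) (fun _ _ _ _ => rfl)
    refine Runs.loop (o := fun _ => []) hc (Runs.vec h0) (Runs.vec (hs _ ?_ ?_ ?_))
    · intro g hg
      have hφ : Set.MapsTo Prod.fst (loopDom D count) D := fun p hp => hp.1
      have hn : PolyBounded (loopDom D count) (fun p => n p.1) (fun p => n p.1 + 2) :=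
        ⟨1, fun p _ => by simp⟩
      exact ⟨hg.1.comp hφ hn, (hg.2.comp hφ hn).mono (List.subset_append_left _ _)⟩
    · refine var (by simp) ?_
      obtain ⟨c, hc⟩ := hc.1
      exact ⟨c, fun p hp => hp.2.le.trans (hc p.1 hp.1)⟩
    · intro j hj
      refine var (List.mem_append_right _ (List.mem_cons_of_mem _
        (List.mem_map.2 ⟨j, List.mem_range.2 hj, rfl⟩))) ?_
      obtain ⟨c, hc⟩ := hb j hj
      exact ⟨c, fun p hp => hc p.1 hp.1 p.2 (le_of_lt hp.2)⟩
  intro j hj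
  refine ⟨(hb j hj).imp fun c h a ha => h a ha _ le_rfl, ?_⟩
  rcases j with _ | j
  · intro k I hI
    obtain ⟨c, p, hp⟩ := main k I hI
    refine ⟨c, p, fun a ha B hB ρ hρ hi => ?_⟩
    obtain ⟨ρ', h1, h2, h3⟩ := hp a ha B hB ρ hρ hi
    refine ⟨ρ', by simpa using h1, h2, fun i hi => ?_⟩
    obtain rfl : i = 0 := by omega
    exact h3 0 (by omega)
  · obtain ⟨e, rfl⟩ : ∃ e, m = (j + 1) + (1 + e) := ⟨m - j - 2, by omega⟩
    have := main.drop (m := j + 1) (by omega)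
    intro k I hI
    obtain ⟨c, p, hp⟩ := this k I hI
    refine ⟨c, p, fun a ha B hB ρ hρ hi => ?_⟩
    obtain ⟨ρ', h1, h2, h3⟩ := hp a ha B hB ρ hρ hi
    refine ⟨ρ', by simpa using h1, h2, fun i hi => ?_⟩
    obtain rfl : i = 0 := by omega
    exact h3 0 (by omega)

/-- Recursion with a single variable. -/
theorem loop_one {count : α → ℕ} (F : α → ℕ → ℕ) (hc : LS D n X count)
    (hb : ∃ c, ∀ a ∈ D, ∀ i ≤ count a, F a i ≤ (n a + 2) ^ c)
    (h0 : LS D n X (fun a => F a 0))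
    (hs : ∀ Y : List (α × ℕ → ℕ),
      (∀ g, LS D n X g → LS (loopDom D count) (fun p => n p.1) Y (fun p => g p.1)) →
      LS (loopDom D count) (fun p => n p.1) Y (fun p => p.2) →
      LS (loopDom D count) (fun p => n p.1) Y (fun p => F p.1 p.2) →
      LS (loopDom D count) (fun p => n p.1) Y (fun p => F p.1 (p.2 + 1))) :
    LS D n X (fun a => F a (count a)) :=
  loop (m := 1) (F := fun _ => F) hc (fun _ _ => hb) (fun _ _ => h0)
    (fun Y h1 h2 h3 _ _ => hs Y h1 h2 (h3 0 one_pos)) 0 one_pos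

theorem add (hf : LS D n X f) (hg : LS D n X g) : LS D n X (fun a => f a + g a) := by
  refine loop_one (fun a i => f a + i) hg ?_ hf ?_
  · obtain ⟨c, hc⟩ := hf.1.add hg.1
    exact ⟨c, fun a ha i hi => (Nat.add_le_add_left hi _).trans (hc a ha)⟩
  · intro Y _ _ h3
    exact h3.succ

theorem mul (hf : LS D n X f) (hg : LS D n X g) : LS D n X (fun a => f a * g a) := by
  refine loop_one (fun a i => f a * i) hg ?_ zero ?_
  · obtain ⟨c, hc⟩ := hf.1.mul hg.1
    exact ⟨c, fun a ha i hi => (Nat.mul_le_mul_left _ hi).trans (hc a ha)⟩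
  · intro Y h1 _ h3
    exact (h3.add (h1 f hf)).congr fun _ _ => (Nat.mul_succ _ _).symm

theorem pred (hf : LS D n X f) : LS D n X (fun a => f a - 1) := by
  refine loop_one (fun a i => i - 1) hf ?_ zero ?_
  · obtain ⟨c, hc⟩ := hf.1
    exact ⟨c, fun a ha i hi => (Nat.sub_le _ _).trans (hi.trans (hc a ha))⟩
  · intro Y h1 h2 h3
    exact h2

theorem sub (hf : LS D n X f) (hg : LS D n X g) : LS D n X (fun a => f a - g a) := by
  refine loop_one (fun a i => f a - i) hg ?_ hf ?_
  · obtain ⟨c, hc⟩ := hf.1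
    exact ⟨c, fun a ha i hi => (Nat.sub_le _ _).trans (hc a ha)⟩
  · intro Y h1 _ h3
    exact h3.pred.congr fun _ _ => Nat.sub_sub _ _ _

theorem ite_le {u v : α → ℕ} (hf : LS D n X f) (hg : LS D n X g)
    (hu : LS (D ∩ {a | f a ≤ g a}) n X u) (hv : LS (D ∩ {a | ¬ f a ≤ g a}) n X v) :
    LS D n X (fun a => if f a ≤ g a then u a else v a) := by
  refine (ite_eq (hf.sub hg) zero (hu.mono_dom ?_) (hv.mono_dom ?_)).congr fun a _ => ?_
  · rintro a ⟨ha, h⟩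
    exact ⟨ha, Nat.sub_eq_zero_iff_le.1 h⟩
  · rintro a ⟨ha, h⟩
    exact ⟨ha, fun h' => h (Nat.sub_eq_zero_iff_le.2 h')⟩
  · simp only [Nat.sub_eq_zero_iff_le]

theorem div (hf : LS D n X f) (hg : LS D n X g) : LS D n X (fun a => f a / g a) := by
  refine loop_one (fun a i => i / g a) hf ?_ (zero.congr fun a _ => (Nat.zero_div _).symm) ?_
  · obtain ⟨c, hc⟩ := hf.1
    exact ⟨c, fun a ha i hi => (Nat.div_le_self _ _).trans (hi.trans (hc a ha))⟩
  · intro Y h1 h2 h3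
    refine (ite_eq (h3.succ.mul (h1 g hg)) h2.succ (h3.succ.mono_dom Set.inter_subset_left)
      (h3.mono_dom Set.inter_subset_left)).congr fun p _ => ?_
    simp only [Nat.succ_div]
    split
    · rename_i h
      rw [if_pos ⟨p.2 / g p.1 + 1, by rw [mul_comm]; exact h.symm⟩]
    · rename_i h
      rw [if_neg]
      · rfl
      · rintro ⟨q, hq⟩
        apply h
        rcases Nat.eq_zero_or_pos (g p.1) with h0 | h0
        · rw [h0] at hq; omega
        · have : p.2 / g p.1 = q - 1 := by
            have hq0 : 0 < q := by
              rcases Nat.eq_zero_or_pos q with rfl | h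
              · omega
              · exact h
            obtain ⟨q, rfl⟩ : ∃ q', q = q' + 1 := ⟨q - 1, by omega⟩
            rw [Nat.mul_succ] at hq
            rw [show p.2 = (g p.1 - 1) + g p.1 * q by omega, Nat.add_mul_div_left _ _ h0,
              Nat.div_eq_of_lt (by omega)]
            simp
          rw [this]
          have hq0 : 0 < q := by
            rcases Nat.eq_zero_or_pos q with rfl | h
            · omega
            · exact h
          rw [Nat.sub_add_cancel hq0, hq, mul_comm]

theorem mod (hf : LS D n X f) (hg : LS D n X g) : LS D n X (fun a => f a % g a) :=
  (hf.sub (hg.mul (hf.div hg))).congr fun _ _ => (Nat.mod_eq_sub ..).symm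

theorem min (hf : LS D n X f) (hg : LS D n X g) : LS D n X (fun a => Min.min (f a) (g a)) :=
  (ite_le hf hg (hf.mono_dom Set.inter_subset_left) (hg.mono_dom Set.inter_subset_left)).congr
    fun _ _ => (Nat.min_def).symm

theorem max (hf : LS D n X f) (hg : LS D n X g) : LS D n X (fun a => Max.max (f a) (g a)) :=
  (ite_le hf hg (hg.mono_dom Set.inter_subset_left) (hf.mono_dom Set.inter_subset_left)).congr
    fun _ _ => (Nat.max_def).symm

theorem pow (hf : LS D n X f) (e : ℕ) : LS D n X (fun a => f a ^ e) := by
  induction e with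
  | zero => simpa using const 1
  | succ e ih => simpa [pow_succ] using ih.mul hf

/-- Case distinction according to a bounded number. -/
theorem cases (b : ℕ) {G : ℕ → α → ℕ} (hf : LS D n X f) (hb : ∀ a ∈ D, f a < b)
    (hG : ∀ v < b, LS (D ∩ {a | f a = v}) n X (G v)) : LS D n X (fun a => G (f a) a) := by
  induction b generalizing D with
  | zero => exact zero.congr fun a ha => absurd (hb a ha) (by omega)
  | succ b ih =>
    refine (ite_eq hf (const b) (hG b (by omega))
      (ih (hf.mono_dom Set.inter_subset_left) ?_ ?_)).congr fun a _ => ?_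
    · rintro a ⟨ha, h⟩
      have := hb a ha
      have h : f a ≠ b := h
      omega
    · intro v hv
      exact (hG v (by omega)).mono_dom (Set.inter_subset_inter_left _ Set.inter_subset_left)
    · split
      · rename_i h; rw [h]
      · rfl

end LS

namespace Prints

variable {D : Set α} {n : α → ℕ} {X : List (α → ℕ)} {o o' : α → List Sym} {f g : α → ℕ}

theorem congr (h : Prints D n X o) (ho : ∀ a ∈ D, o a = o' a) : Prints D n X o' :=
  Runs.congr h ho (fun _ _ _ _ => rfl)

theorem mono_dom {D' : Set α} (h : Prints D n X o) (hD : D' ⊆ D) : Prints D' n X o :=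
  Runs.mono_dom h hD

theorem nil : Prints D n X (fun _ => []) := Runs.skip

theorem print (s : Sym) : Prints D n X (fun _ => [s]) := Runs.print s

theorem append (h : Prints D n X o) (h' : Prints D n X o') : Prints D n X (fun a => o a ++ o' a) :=
  (Runs.bind h h' (fun _ hx => Or.inl hx)).congr (fun _ _ => rfl) (fun _ _ j hj => absurd hj (by omega))

theorem cons (s : Sym) (h : Prints D n X o) : Prints D n X (fun a => s :: o a) := (print s).append h

theorem flatMap_list {ι : Type} (l : List ι) {O : ι → α → List Sym}
    (h : ∀ t ∈ l, Prints D n X (O t)) : Prints D n X (fun a => l.flatMap fun t => O t a) := by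
  induction l with
  | nil => exact nil
  | cons t l ih =>
    exact (h t List.mem_cons_self).append (ih fun t ht => h t (List.mem_cons_of_mem _ ht))

theorem ite_eq (hf : LS D n X f) (hg : LS D n X g) (h : Prints (D ∩ {a | f a = g a}) n X o)
    (h' : Prints (D ∩ {a | f a ≠ g a}) n X o') :
    Prints D n X (fun a => if f a = g a then o a else o' a) :=
  (Runs.ite_eq hf hg h h').congr (fun _ _ => rfl) (fun _ _ j hj => absurd hj (by omega))

theorem loop {count : α → ℕ} {o : α × ℕ → List Sym} (hc : LS D n X count)
    (hs : ∀ Y : List (α × ℕ → ℕ),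
      (∀ g, LS D n X g → LS (loopDom D count) (fun p => n p.1) Y (fun p => g p.1)) →
      LS (loopDom D count) (fun p => n p.1) Y (fun p => p.2) →
      Prints (loopDom D count) (fun p => n p.1) Y o) :
    Prints D n X (fun a => (List.range (count a)).flatMap fun i => o (a, i)) := by
  refine (Runs.loop (m := 0) (F := fun _ _ _ => 0) hc Runs.skip (hs _ ?_ ?_)).congr
    (fun _ _ => rfl) (fun _ _ j hj => absurd hj (by omega))
  · intro g hg
    have hφ : Set.MapsTo Prod.fst (loopDom D count) D := fun p hp => hp.1
    have hn : PolyBounded (loopDom D count) (fun p => n p.1) (fun p => n p.1 + 2) :=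
      ⟨1, fun p _ => by simp⟩
    exact ⟨hg.1.comp hφ hn, (hg.2.comp hφ hn).mono (List.subset_append_left _ _)⟩
  · refine LS.var (by simp) ?_
    obtain ⟨c, hc⟩ := hc.1
    exact ⟨c, fun p hp => hp.2.le.trans (hc p.1 hp.1)⟩

theorem unary (hf : LS D n X f) : Prints D n X (fun a => unary (f a)) := by
  have h1 : Prints D n X (fun a => (List.range (f a)).flatMap fun _ => [Sym.tick]) :=
    loop (o := fun _ => [Sym.tick]) hf (fun _ _ _ => print _)
  refine (h1.append (print Sym.done)).congr fun a _ => ?_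
  simp only [CircuitComplexity.unary]
  congr 1
  induction f a with
  | zero => rfl
  | succ m ih => rw [List.range_succ, List.flatMap_append, ih, List.replicate_succ']; rfl

/-- Case distinction according to a bounded number. -/
theorem cases (b : ℕ) {O : ℕ → α → List Sym} (hf : LS D n X f) (hb : ∀ a ∈ D, f a < b)
    (hO : ∀ v < b, Prints (D ∩ {a | f a = v}) n X (O v)) : Prints D n X (fun a => O (f a) a) := by
  induction b generalizing D with
  | zero => exact nil.congr fun a ha => absurd (hb a ha) (by omega)
  | succ b ih =>
    refine (ite_eq hf (.const b) (hO b (by omega))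
      (ih (hf.mono_dom Set.inter_subset_left) ?_ ?_)).congr fun a _ => ?_
    · rintro a ⟨ha, h⟩
      have := hb a ha
      have h : f a ≠ b := h
      omega
    · intro v hv
      exact (hO v (by omega)).mono_dom (Set.inter_subset_inter_left _ Set.inter_subset_left)
    · split
      · rename_i h; rw [h]
      · rfl

end Prints

/-- What is printed with polynomially bounded registers is printed in logarithmic space. -/
theorem LUniform.of_prints {C : Family}
    (h : Prints Set.univ id [id] fun n => (C n).describe) : LUniform C := by
  obtain ⟨c, p, hp⟩ := h 1 (fun n ρ => ρ 0 = n) (by simp)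
  refine Prog.exists_machine p (c + 1) _ (fun n => ?_) (by omega)
  have h1 : (n + 2) ^ c ≤ (n + 2) ^ (c + 1) := Nat.pow_le_pow_right (by omega) (by omega)
  have h2 : n + 2 ≤ (n + 2) ^ (c + 1) := Nat.le_self_pow (by omega) _
  obtain ⟨ρ', h3, -⟩ := hp n (Set.mem_univ _) _ h1 (Function.update (fun _ => 0) 0 n)
    (by
      intro i
      by_cases hi : i = 0
      · subst hi; simp; omega
      · simp [hi])
    (by simp)
  exact ⟨ρ', h3⟩

end Calculus

section Finite

variable {α : Type} {V W : Type}

/-- A function with values in a finite type all of whose numerical images are computed with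
polynomially bounded registers. -/
def LSFin (D : Set α) (n : α → ℕ) (X : List (α → ℕ)) (v : α → V) : Prop :=
  ∀ φ : V → ℕ, LS D n X (fun a => φ (v a))

namespace LSFin

variable {D : Set α} {n : α → ℕ} {X : List (α → ℕ)} {v : α → V} {w : α → W}

theorem of_code [Finite V] (e : V → ℕ) (he : Function.Injective e)
    (h : LS D n X (fun a => e (v a))) : LSFin D n X v := by
  intro φ
  obtain ⟨b, hb⟩ := (Set.finite_range e).bddAbove
  refine (LS.cases (b + 1) (G := fun m _ => Function.extend e φ 0 m) h
    (fun a _ => Nat.lt_succ_of_le (hb ⟨_, rfl⟩)) (fun m _ => LS.const _)).congr fun a _ => ?_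
  simp only [he.extend_apply]

theorem congr (h : LSFin D n X v) {v' : α → V} (hv : ∀ a ∈ D, v a = v' a) : LSFin D n X v' :=
  fun φ => (h φ).congr fun a ha => by rw [hv a ha]

theorem map (h : LSFin D n X v) (ψ : V → W) : LSFin D n X (fun a => ψ (v a)) :=
  fun φ => h (fun x => φ (ψ x))

theorem cases [Finite V] (h : LSFin D n X v) {G : V → α → ℕ}
    (hG : ∀ x, LS (D ∩ {a | v a = x}) n X (G x)) : LS D n X (fun a => G (v a) a) := by
  obtain ⟨b, ⟨e⟩⟩ := Finite.exists_equiv_fin V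
  refine (LS.cases b (G := fun m a => if hm : m < b then G (e.symm ⟨m, hm⟩) a else 0)
    (h fun x => (e x : ℕ)) (fun a _ => (e (v a)).2) (fun m hm => ?_)).congr fun a _ => ?_
  · simp only [hm, dif_pos]
    refine (hG (e.symm ⟨m, hm⟩)).mono_dom ?_
    rintro a ⟨ha, h⟩
    refine ⟨ha, ?_⟩
    rw [Set.mem_ofPred_eq, Equiv.eq_symm_apply]
    exact Fin.ext h
  · simp

theorem prod [Finite V] (h : LSFin D n X v) (h' : LSFin D n X w) :
    LSFin D n X (fun a => (v a, w a)) := fun φ =>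
  h.cases (G := fun x a => φ (x, w a)) fun x =>
    (h' fun y => φ (x, y)).mono_dom Set.inter_subset_left

theorem pi [Finite V] {k : ℕ} {v : α → Fin k → V} (h : ∀ j, LSFin D n X (fun a => v a j)) :
    LSFin D n X v := by
  induction k with
  | zero =>
    intro φ
    exact (LS.const (φ Fin.elim0)).congr fun a _ => congrArg φ (Subsingleton.elim _ _)
  | succ k ih =>
    have h1 := (h 0).prod (ih (v := fun a => Fin.tail (v a)) fun j => h j.succ)
    exact (h1.map fun p : V × (Fin k → V) => (Fin.cons p.1 p.2 : Fin (k + 1) → V)).congr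
      fun a _ => Fin.cons_self_tail _

end LSFin

end Finite

/-! ### Simulation of Turing machines with registers -/

/-- The symbols on the input tape as numbers. -/
def InSym.code : InSym → ℕ
  | .leftEnd => 0
  | .one => 1
  | .rightEnd => 2

theorem InSym.code_injective : Function.Injective InSym.code := by
  rintro (_ | _ | _) (_ | _ | _) h <;> simp_all [InSym.code]

instance : Finite InSym :=
  Finite.of_injective (β := Fin 3) (fun x => ⟨x.code, by cases x <;> simp [InSym.code]⟩)
    fun _ _ h => InSym.code_injective (congrArg Fin.val h)

instance : Finite Sym :=
  Finite.of_injective (β := Fin 7)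
    (fun | .tick => 0 | .done => 1 | .input => 2 | .neg => 3 | .conj => 4 | .disj => 5 | .output => 6)
    (by rintro (_ | _ | _ | _ | _ | _ | _) (_ | _ | _ | _ | _ | _ | _) h <;> simp_all)

theorem sum_digit_lt {g : ℕ} (f : ℕ → ℕ) (hf : ∀ p, f p < g) (N : ℕ) :
    ∑ p ∈ Finset.range N, f p * g ^ p < g ^ N := by
  induction N with
  | zero => simp
  | succ N ih =>
    rw [Finset.sum_range_succ, pow_succ]
    have := hf N
    nlinarith [Nat.zero_le (g ^ N)]

theorem sum_digit_div_mod {g : ℕ} (h : ℕ) : ∀ (f : ℕ → ℕ) (N : ℕ), (∀ p, f p < g) → h < N →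
    (∑ p ∈ Finset.range N, f p * g ^ p) / g ^ h % g = f h := by
  induction h with
  | zero =>
    intro f N hf hN
    obtain ⟨N, rfl⟩ : ∃ N', N = N' + 1 := ⟨N - 1, by omega⟩
    have : ∑ p ∈ Finset.range (N + 1), f p * g ^ p =
        f 0 + g * ∑ p ∈ Finset.range N, f (p + 1) * g ^ p := by
      rw [Finset.sum_range_succ', Finset.mul_sum, add_comm]
      simp only [pow_zero, mul_one, pow_succ]
      congr 1
      exact Finset.sum_congr rfl fun p _ => by ring
    rw [this, pow_zero, Nat.div_one, Nat.add_mul_mod_self_left, Nat.mod_eq_of_lt (hf 0)]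
  | succ h ih =>
    intro f N hf hN
    obtain ⟨N, rfl⟩ : ∃ N', N = N' + 1 := ⟨N - 1, by omega⟩
    have h0 : 0 < g := lt_of_le_of_lt (Nat.zero_le _) (hf 0)
    have : ∑ p ∈ Finset.range (N + 1), f p * g ^ p =
        f 0 + g * ∑ p ∈ Finset.range N, f (p + 1) * g ^ p := by
      rw [Finset.sum_range_succ', Finset.mul_sum, add_comm]
      simp only [pow_zero, mul_one, pow_succ]
      congr 1
      exact Finset.sum_congr rfl fun p _ => by ring
    rw [this, pow_succ', ← Nat.div_div_eq_div_mul, Nat.add_mul_div_left _ _ h0,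
      Nat.div_eq_of_lt (hf 0), zero_add]
    exact ih (fun p => f (p + 1)) N (fun p => hf _) (by omega)

theorem sum_digit_update {Γ : Type} {g : ℕ} (e : Γ → ℕ) (t : ℕ → Γ) (h N : ℕ) (x : Γ) (hN : h < N) :
    (∑ p ∈ Finset.range N, e (Function.update t h x p) * g ^ p) + e (t h) * g ^ h =
      (∑ p ∈ Finset.range N, e (t p) * g ^ p) + e x * g ^ h := by
  have hm : h ∈ Finset.range N := Finset.mem_range.2 hN
  rw [← Finset.add_sum_erase _ _ hm, ← Finset.add_sum_erase _ (fun p => e (t p) * g ^ p) hm]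
  have : ∑ p ∈ (Finset.range N).erase h, e (Function.update t h x p) * g ^ p =
      ∑ p ∈ (Finset.range N).erase h, e (t p) * g ^ p :=
    Finset.sum_congr rfl fun p hp => by
      rw [Function.update_of_ne (Finset.ne_of_mem_erase hp)]
  rw [this]
  simp only [Function.update_self]
  ring

theorem pow_log_polyBounded (g b : ℕ) :
    ∃ c, ∀ n, g ^ (b * (Nat.log 2 n + 1) + 1) ≤ (n + 2) ^ c := by
  refine ⟨2 * (g * b) + g, fun n => ?_⟩
  have h1 : 2 ^ (Nat.log 2 n + 1) ≤ (n + 2) ^ 2 := by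
    rcases Nat.eq_zero_or_pos n with rfl | hn
    · simp
    · have := Nat.pow_log_le_self 2 hn.ne'
      rw [pow_succ]
      nlinarith
  have h2 : g ≤ 2 ^ g := (Nat.lt_two_pow_self).le
  calc g ^ (b * (Nat.log 2 n + 1) + 1) ≤ (2 ^ g) ^ (b * (Nat.log 2 n + 1) + 1) :=
        Nat.pow_le_pow_left h2 _
    _ = (2 ^ (Nat.log 2 n + 1)) ^ (g * b) * 2 ^ g := by rw [← pow_mul, ← pow_mul, ← pow_add]; ring_nf
    _ ≤ ((n + 2) ^ 2) ^ (g * b) * (n + 2) ^ g :=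
        Nat.mul_le_mul (Nat.pow_le_pow_left h1 _) (Nat.pow_le_pow_left (by omega) _)
    _ = _ := by rw [← pow_mul, ← pow_add]

namespace TuringTransducer

variable {O : Type} (M : TuringTransducer O)

/-- The configuration after `i` steps on the input `1 ^ n`; a machine that has halted rests. -/
def cfgAt (n : ℕ) : ℕ → M.Cfg
  | 0 => M.init
  | i + 1 => (M.step n (cfgAt n i)).getD (cfgAt n i)

theorem reaches_cfgAt (n i : ℕ) : StateTransition.Reaches (M.step n) M.init (M.cfgAt n i) := by
  induction i with
  | zero => exact Relation.ReflTransGen.refl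
  | succ i ih =>
    rw [cfgAt]
    cases h : M.step n (M.cfgAt n i) with
    | none => exact ih
    | some c => exact ih.tail h

theorem exists_cfgAt_eq {n : ℕ} {c : M.Cfg} (h : StateTransition.Reaches (M.step n) M.init c) :
    ∃ i, M.cfgAt n i = c := by
  induction h with
  | refl => exact ⟨0, rfl⟩
  | tail _ h ih =>
    obtain ⟨i, rfl⟩ := ih
    exact ⟨i + 1, by rw [cfgAt, h]; rfl⟩

/-- What determines the next step: the state and the symbols under the heads. -/
def view (n : ℕ) (c : M.Cfg) : M.Q × InSym × (Fin M.k → M.Γ) :=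
  (c.state, inputTape n c.inputHead, fun i => c.tape i (c.head i))

/-- The action that a view leads to. -/
def act (x : M.Q × InSym × (Fin M.k → M.Γ)) : Option (Action M.Q M.Γ O M.k) := M.δ x.1 x.2.1 x.2.2

/-- The symbol printed in step `i`. -/
def printed (n i : ℕ) : Option O := (M.act (M.view n (M.cfgAt n i))).bind Action.print

theorem step_eq_none {n : ℕ} {c : M.Cfg} : M.step n c = none ↔ M.act (M.view n c) = none := by
  simp [step, act, view]

theorem out_cfgAt (n i : ℕ) :
    (M.cfgAt n i).out = (List.range i).flatMap fun i => (M.printed n i).toList := by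
  induction i with
  | zero => rfl
  | succ i ih =>
    rw [List.range_succ, List.flatMap_append, ← ih, cfgAt]
    simp only [printed, List.flatMap_cons, List.flatMap_nil, List.append_nil]
    cases h : M.act (M.view n (M.cfgAt n i)) with
    | none => simp [M.step_eq_none.2 h]
    | some a =>
      have : M.δ (M.cfgAt n i).state (inputTape n (M.cfgAt n i).inputHead)
        (fun j => (M.cfgAt n i).tape j ((M.cfgAt n i).head j)) = some a := h
      simp [step, this]

theorem inputHead_le (n i : ℕ) : (M.cfgAt n i).inputHead ≤ n + 1 := by
  induction i with
  | zero => simp [cfgAt, init]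
  | succ i ih =>
    rw [cfgAt]
    cases h : M.δ (M.cfgAt n i).state (inputTape n (M.cfgAt n i).inputHead)
        (fun j => (M.cfgAt n i).tape j ((M.cfgAt n i).head j)) with
    | none => simpa [step, h] using ih
    | some a => simp [step, h]

section Code

variable (eQ : M.Q → ℕ) (eΓ : M.Γ → ℕ) (g : ℕ) (N : ℕ → ℕ)

/-- Numbers that describe a configuration: the state, the position of the input head, the contents
of each work tape as a number in base `g`, and `g ^ p` for each work head at position `p`. -/
def codes (n : ℕ) (c : M.Cfg) (j : ℕ) : ℕ :=
  if j = 0 then eQ c.state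
  else if j = 1 then c.inputHead
  else if h : j - 2 < M.k then
    ∑ p ∈ Finset.range (N n), eΓ (c.tape ⟨j - 2, h⟩ p) * g ^ p
  else if h : j - 2 - M.k < M.k then g ^ c.head ⟨j - 2 - M.k, h⟩
  else 0

/-- The effect of a step on the codes. -/
def nextCode (n : ℕ) (x : M.Q × InSym × (Fin M.k → M.Γ)) (F : ℕ → ℕ) (j : ℕ) : ℕ :=
  match M.act x with
  | none => F j
  | some a =>
    if j = 0 then eQ a.next
    else if j = 1 then
      match a.moveInput with
      | .left => F 1 - 1
      | .stay => F 1
      | .right => min (F 1 + 1) (n + 1)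
    else if h : j - 2 < M.k then
      F j + eΓ (a.write ⟨j - 2, h⟩) * F (j + M.k) - eΓ (x.2.2 ⟨j - 2, h⟩) * F (j + M.k)
    else if h : j - 2 - M.k < M.k then
      match a.move ⟨j - 2 - M.k, h⟩ with
      | .left => max 1 (F j / g)
      | .stay => F j
      | .right => F j * g
    else 0

theorem codes_head (n : ℕ) (c : M.Cfg) (j : Fin M.k) :
    M.codes eQ eΓ g N n c (j + 2 + M.k) = g ^ c.head j := by
  have h1 : ¬ (j : ℕ) + 2 + M.k - 2 < M.k := by omega
  have h2 : (j : ℕ) + 2 + M.k - 2 - M.k = j := by omega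
  have h3 : (j : ℕ) + 2 + M.k - 2 - M.k < M.k := by omega
  rw [codes, if_neg (by omega), if_neg (by omega), dif_neg h1, dif_pos h3]
  congr 2
  exact Fin.ext h2

theorem codes_tape (n : ℕ) (c : M.Cfg) (j : Fin M.k) :
    M.codes eQ eΓ g N n c (j + 2) = ∑ p ∈ Finset.range (N n), eΓ (c.tape j p) * g ^ p := by
  rw [codes, if_neg (by omega), if_neg (by omega), dif_pos (by omega)]
  rfl

theorem codes_succ (hg : 2 ≤ g) (n i : ℕ)
    (hN : ∀ j, (M.cfgAt n i).head j < N n) (j : ℕ) :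
    M.codes eQ eΓ g N n (M.cfgAt n (i + 1)) j =
      M.nextCode eQ eΓ g n (M.view n (M.cfgAt n i)) (M.codes eQ eΓ g N n (M.cfgAt n i)) j := by
  have hi := M.inputHead_le n i
  rw [cfgAt, nextCode]
  set c := M.cfgAt n i
  cases h : M.act (M.view n c) with
  | none => simp [M.step_eq_none.2 h]
  | some a =>
    have ha : M.δ c.state (inputTape n c.inputHead) (fun j => c.tape j (c.head j)) = some a := h
    simp only [step, ha, Option.map_some, Option.getD_some]
    by_cases h0 : j = 0
    · simp [codes, h0]
    by_cases h1 : j = 1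
    · subst h1
      simp only [codes, if_neg one_ne_zero, if_true]
      cases a.moveInput with
      | left => simp [Dir.move]; omega
      | stay => simp [Dir.move, hi]
      | right => simp [Dir.move]
    by_cases h2 : j - 2 < M.k
    · have h3 : M.codes eQ eΓ g N n c (j + M.k) = g ^ c.head ⟨j - 2, h2⟩ := by
        have := M.codes_head eQ eΓ g N n c ⟨j - 2, h2⟩
        simpa [show j - 2 + 2 = j by omega] using this
      rw [h3]
      simp only [codes, if_neg h0, if_neg h1, dif_pos h2]
      have := sum_digit_update (g := g) eΓ (c.tape ⟨j - 2, h2⟩) (c.head ⟨j - 2, h2⟩) (N n)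
        (a.write ⟨j - 2, h2⟩) (hN _)
      simp only [view]
      omega
    · simp only [codes, if_neg h0, if_neg h1, dif_neg h2]
      by_cases h3 : j - 2 - M.k < M.k
      · simp only [dif_pos h3]
        cases a.move ⟨j - 2 - M.k, h3⟩ with
        | left =>
          simp only [Dir.move]
          rcases Nat.eq_zero_or_pos (c.head ⟨j - 2 - M.k, h3⟩) with h4 | h4
          · rw [h4]; simp [Nat.div_eq_of_lt (show 1 < g by omega)]
          · obtain ⟨q, hq⟩ : ∃ q, c.head ⟨j - 2 - M.k, h3⟩ = q + 1 :=
              ⟨c.head ⟨j - 2 - M.k, h3⟩ - 1, by omega⟩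
            rw [hq, pow_succ, Nat.mul_div_cancel _ (by omega), Nat.add_sub_cancel]
            exact (max_eq_right (Nat.one_le_pow _ _ (by omega))).symm
        | stay => simp [Dir.move]
        | right => simp [Dir.move, pow_succ]
      · simp only [dif_neg h3]

theorem nextCode_congr (n : ℕ) (x : M.Q × InSym × (Fin M.k → M.Γ)) {F F' : ℕ → ℕ}
    (h : ∀ j < 2 * M.k + 2, F j = F' j) {j : ℕ} (hj : j < 2 * M.k + 2) :
    M.nextCode eQ eΓ g n x F j = M.nextCode eQ eΓ g n x F' j := by
  simp only [nextCode]
  cases M.act x with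
  | none => exact h j hj
  | some a =>
    simp only
    split
    · rfl
    split
    · rw [h 1 (by omega)]
    split
    · rw [h j hj, h (j + M.k) (by omega)]
    split
    · rw [h j hj]
    · rfl

end Code

/-- The output of a machine that runs in logarithmic space, symbol by symbol, is computed with
polynomially bounded registers. -/
theorem exists_lsFin (hM : M.IsLogSpace) (w : ℕ → List O) (hw : ∀ n, M.Outputs n (w n)) :
    ∃ (τ : ℕ → ℕ) (pr : ℕ → ℕ → Option O), LS Set.univ id [id] τ ∧
      LSFin {p : ℕ × ℕ | p.2 ≤ τ p.1} Prod.fst [Prod.fst, Prod.snd] (fun p => pr p.1 p.2) ∧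
      ∀ n, w n = (List.range (τ n)).flatMap fun i => (pr n i).toList := by
  classical
  have := M.finite_Q
  have := M.finite_Γ
  obtain ⟨b, hb⟩ := hM
  obtain ⟨q, ⟨e₁⟩⟩ := Finite.exists_equiv_fin M.Q
  obtain ⟨s, ⟨e₂⟩⟩ := Finite.exists_equiv_fin M.Γ
  set eQ : M.Q → ℕ := fun x => e₁ x
  have hQ : Function.Injective eQ := Fin.val_injective.comp e₁.injective
  -- The blank symbol is coded as zero, so that the empty tape has code zero.
  set eΓ : M.Γ → ℕ := fun x => if x = M.blank then 0 else e₂ x + 1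
  have hΓ : Function.Injective eΓ := by
    intro x y hxy
    simp only [eΓ] at hxy
    split at hxy <;> split at hxy
    · simp_all
    · omega
    · omega
    · exact e₂.injective (Fin.ext (by omega))
  set g := s + 2
  have hΓg : ∀ x, eΓ x < g := by
    intro x
    simp only [eΓ, g]
    split
    · omega
    · have := (e₂ x).2; omega
  set N : ℕ → ℕ := fun n => b * (Nat.log 2 n + 1) + 1
  have hN : ∀ n i j, (M.cfgAt n i).head j < N n := fun n i j =>
    Nat.lt_succ_of_le (hb n _ (M.reaches_cfgAt n i) j)
  set F : ℕ → ℕ → ℕ → ℕ := fun j n i => M.codes eQ eΓ g N n (M.cfgAt n i) j with hF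
  have hFs : ∀ j n i, F j n (i + 1) = M.nextCode eQ eΓ g n (M.view n (M.cfgAt n i))
      (fun j => F j n i) j := fun j n i => M.codes_succ eQ eΓ g N (by omega) n i (hN n i) j
  -- a common polynomial bound for all codes
  obtain ⟨c, hc⟩ : ∃ c, ∀ j n i, F j n i ≤ (n + 2) ^ c := by
    obtain ⟨d, hd⟩ := pow_log_polyBounded g b
    refine ⟨max q (max 1 d), fun j n i => ?_⟩
    obtain ⟨h1, h2⟩ := pow_le_pow_of_le_max (le_refl ((n + 2) ^ max q (max 1 d)))
    obtain ⟨h2, h3⟩ := pow_le_pow_of_le_max h2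
    simp only [hF, codes]
    split
    · refine (le_of_lt ?_).trans h1
      calc eQ (M.cfgAt n i).state < q := (e₁ _).2
        _ ≤ 2 ^ q := Nat.lt_two_pow_self.le
        _ ≤ _ := Nat.pow_le_pow_left (by omega) _
    split
    · have := M.inputHead_le n i
      rw [pow_one] at h2
      omega
    split
    · exact ((sum_digit_lt _ (fun p => hΓg _) _).le.trans (hd n)).trans h3
    split
    · refine ((Nat.pow_le_pow_right (by omega) (hN n i _).le).trans (hd n)).trans h3
    · exact Nat.zero_le _
  -- the view is determined by the codes
  have hview : ∀ n i i', (∀ j < 2 * M.k + 2, F j n i = F j n i') →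
      M.view n (M.cfgAt n i) = M.view n (M.cfgAt n i') := by
    intro n i i' h
    have h0 : eQ (M.cfgAt n i).state = eQ (M.cfgAt n i').state := h 0 (by omega)
    have h1 : (M.cfgAt n i).inputHead = (M.cfgAt n i').inputHead := h 1 (by omega)
    have h2 : ∀ j, (M.cfgAt n i).tape j ((M.cfgAt n i).head j) =
        (M.cfgAt n i').tape j ((M.cfgAt n i').head j) := by
      intro j
      apply hΓ
      have e : ∀ i, F (j + 2) n i / F (j + 2 + M.k) n i % g =
          eΓ ((M.cfgAt n i).tape j ((M.cfgAt n i).head j)) := by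
        intro i
        simp only [hF, codes_head, codes_tape]
        exact sum_digit_div_mod _ (fun p => eΓ ((M.cfgAt n i).tape j p)) (N n) (fun p => hΓg _)
          (hN n i j)
      rw [← e i, ← e i', h (j + 2) (by omega), h (j + 2 + M.k) (by omega)]
    simp only [view, h1, hQ h0, h2]
  set τ : ℕ → ℕ := fun n => ((n + 2) ^ c + 1) ^ (2 * M.k + 2)
  -- a machine that does not halt in time would repeat a code and thus run forever
  have hhalt : ∀ n, M.step n (M.cfgAt n (τ n)) = none := by
    intro n
    obtain ⟨z, hz, -⟩ := hw n
    obtain ⟨hz1, hz2⟩ := StateTransition.mem_eval.1 hz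
    have hex : ∃ t, M.act (M.view n (M.cfgAt n t)) = none := by
      obtain ⟨t, rfl⟩ := M.exists_cfgAt_eq hz1
      exact ⟨t, M.step_eq_none.1 hz2⟩
    have hrest : ∀ t d, M.act (M.view n (M.cfgAt n t)) = none → M.cfgAt n (t + d) = M.cfgAt n t := by
      intro t d ht
      induction d with
      | zero => rfl
      | succ d ih => rw [← add_assoc, cfgAt, ih, M.step_eq_none.2 ht]; rfl
    obtain ⟨t, ht, hmin⟩ : ∃ t, M.act (M.view n (M.cfgAt n t)) = none ∧
        ∀ i < t, M.act (M.view n (M.cfgAt n i)) ≠ none :=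
      ⟨Nat.find hex, Nat.find_spec hex, fun i hi => Nat.find_min hex hi⟩
    have hshift : ∀ i i' d, (∀ j < 2 * M.k + 2, F j n i = F j n i') →
        ∀ j < 2 * M.k + 2, F j n (i + d) = F j n (i' + d) := by
      intro i i' d h
      induction d with
      | zero => exact h
      | succ d ih =>
        intro j hj
        rw [← add_assoc, ← add_assoc, hFs, hFs, hview n _ _ ih]
        exact M.nextCode_congr eQ eΓ g n _ ih hj
    have hinj : Function.Injective fun (i : Fin (t + 1)) (j : Fin (2 * M.k + 2)) =>
        (⟨F j n i, Nat.lt_succ_of_le (hc j n i)⟩ : Fin ((n + 2) ^ c + 1)) := by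
      have main : ∀ i i' : ℕ, i < i' → i' ≤ t → ¬ ∀ j < 2 * M.k + 2, F j n i = F j n i' := by
        intro i i' hii hit h
        have h1 := hview n _ _ (hshift i i' (t - i') h)
        rw [show i' + (t - i') = t by omega] at h1
        exact hmin (i + (t - i')) (by omega) (h1 ▸ ht)
      intro i i' h
      have h' : ∀ j < 2 * M.k + 2, F j n i = F j n i' := fun j hj =>
        congrArg Fin.val (congrFun h ⟨j, hj⟩)
      rcases lt_trichotomy i i' with h1 | h1 | h1
      · exact absurd h' (main i i' h1 (by omega))
      · exact h1
      · exact absurd (fun j hj => (h' j hj).symm) (main i' i h1 (by omega))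
    have hcard := Fintype.card_le_of_injective _ hinj
    simp only [Fintype.card_fin, Fintype.card_fun] at hcard
    have : τ n = t + (τ n - t) := by simp only [τ]; omega
    rw [this, hrest t _ ht]
    exact M.step_eq_none.2 ht
  have hτ : LS Set.univ id [id] τ :=
    (((LS.var (by simp) (.size _ _)).add (.const 2)).pow c |>.add (.const 1)).pow _
  refine ⟨τ, M.printed, hτ, ?_, fun n => ?_⟩
  · set D : Set (ℕ × ℕ) := {p | p.2 ≤ τ p.1}
    have hfst : LS D Prod.fst [Prod.fst, Prod.snd] Prod.fst := .var (by simp) (.size _ _)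
    have hsnd : LS D Prod.fst [Prod.fst, Prod.snd] Prod.snd := by
      refine .var (by simp) ?_
      obtain ⟨d, hd⟩ := hτ.1
      exact ⟨d, fun p hp => le_trans hp (hd p.1 (Set.mem_univ _))⟩
    -- the view is computed from the codes
    have hv : ∀ {α : Type} (D : Set α) (X : List (α → ℕ)) (n i : α → ℕ), LS D n X n →
        (∀ j < 2 * M.k + 2, LS D n X (fun a => F j (n a) (i a))) →
        LSFin D n X (fun a => M.view (n a) (M.cfgAt (n a) (i a))) := by
      intro α D X n i hn h
      refine (LSFin.of_code eQ hQ (h 0 (by omega))).prod (LSFin.prod ?_ (LSFin.pi fun j => ?_))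
      · refine LSFin.of_code InSym.code InSym.code_injective ?_
        · refine (LS.ite_eq (h 1 (by omega)) .zero (LS.const 0)
            (LS.ite_le ((h 1 (by omega)).mono_dom Set.inter_subset_left)
            (hn.mono_dom Set.inter_subset_left) (LS.const 1) (LS.const 2))).congr ?_
          intro a _
          have : F 1 (n a) (i a) = (M.cfgAt (n a) (i a)).inputHead := rfl
          simp only [this, inputTape]
          split
          · rfl
          · split <;> rfl
      · refine LSFin.of_code eΓ hΓ (((h (j + 2) (by omega)).div (h (j + 2 + M.k) (by omega))).mod
          (.const g) |>.congr fun a _ => ?_)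
        simp only [hF, codes_head, codes_tape]
        exact sum_digit_div_mod _ (fun p => eΓ ((M.cfgAt (n a) (i a)).tape j p)) (N (n a))
          (fun p => hΓg _) (hN (n a) (i a) j)
    have hall : ∀ j < 2 * M.k + 2, LS D Prod.fst [Prod.fst, Prod.snd] (fun p => F j p.1 p.2) := by
      refine LS.loop (F := fun j p i => F j p.1 i) hsnd ?_ ?_ ?_
      · exact fun j _ => ⟨c, fun p _ i _ => hc j p.1 i⟩
      · intro j _
        refine LS.congr (f := fun _ => if j = 0 then eQ M.start else if j = 1 then 0 else
          if j - 2 < M.k then 0 else if j - 2 - M.k < M.k then 1 else 0) (.const _) fun a _ => ?_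
        simp only [hF, cfgAt, codes, init]
        split
        · rfl
        split
        · rfl
        split
        · simp [eΓ]
        split <;> simp
      · intro Y h1 h2 h3 j hj
        have hn := h1 _ hfst
        have hx := hv _ Y (fun p => p.1.1) (fun p => p.2) hn h3
        refine LS.congr (f := fun p => M.nextCode eQ eΓ g p.1.1 (M.view p.1.1 (M.cfgAt p.1.1 p.2))
          (fun j => F j p.1.1 p.2) j) ?_ fun p _ => (hFs j _ _).symm
        refine hx.cases (G := fun x p => M.nextCode eQ eΓ g p.1.1 x (fun j => F j p.1.1 p.2) j)
          fun x => LS.mono_dom ?_ Set.inter_subset_left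
        simp only [nextCode]
        cases M.act x with
        | none => exact h3 j hj
        | some a =>
          simp only
          split
          · exact .const _
          split
          · cases a.moveInput with
            | left => exact (h3 1 (by omega)).pred
            | stay => exact h3 1 (by omega)
            | right => exact (h3 1 (by omega)).succ.min hn.succ
          split
          · exact ((h3 j hj).add ((LS.const _).mul (h3 _ (by omega)))).sub
              ((LS.const _).mul (h3 _ (by omega)))
          split
          · rename_i h
            cases a.move ⟨j - 2 - M.k, h⟩ with
            | left => exact (LS.const 1).max ((h3 j hj).div (.const g))
            | stay => exact h3 j hj
            | right => exact (h3 j hj).mul (.const g)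
          · exact .zero
    exact (hv D _ _ _ hfst hall).map fun x => (M.act x).bind Action.print
  · rw [← out_cfgAt]
    obtain ⟨z, hz, hzw⟩ := hw n
    have := StateTransition.mem_eval.2 ⟨M.reaches_cfgAt n (τ n), hhalt n⟩
    rw [← hzw, Part.mem_unique hz this]

end TuringTransducer

/-! ### Looking up gates in the description of a circuit -/

/-- The description of a circuit as a sequence of symbols with numerical arguments: the gates,
and then the list of outputs. -/
def Circuit.items (C : Circuit) : List (Sym × List ℕ) :=
  C.gates.map (fun
    | .input i => (Sym.input, [i])
    | .neg j => (Sym.neg, [j])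
    | .conj js => (Sym.conj, js)
    | .disj js => (Sym.disj, js)) ++ [(Sym.output, C.outputs)]

theorem Circuit.describe_eq_items (C : Circuit) :
    C.describe = C.items.flatMap fun t => t.1 :: t.2.flatMap unary := by
  simp only [describe, items, List.flatMap_append, List.flatMap_map, List.flatMap_cons,
    List.flatMap_nil, List.append_nil]
  congr 2
  funext g
  cases g <;> simp [Gate.describe]

/-- Numbers for the symbols that begin an item; `0` stands for the other symbols. -/
def Sym.kind : Sym → ℕ
  | .tick => 0
  | .done => 0
  | .input => 1
  | .neg => 2
  | .conj => 3
  | .disj => 4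
  | .output => 5

/-- The state of a scan through a description in search of a certain item: the number of items that
have begun, the number of arguments read in the last of them, and the kind, the number of arguments
and the first two arguments of the item in question. -/
structure Scan where
  started : ℕ
  done : ℕ
  kind : ℕ
  nargs : ℕ
  arg0 : ℕ
  arg1 : ℕ

namespace Scan

/-- The state before any symbol has been read. -/
def init : Scan := ⟨0, 0, 0, 0, 0, 0⟩

/-- Read one symbol in search of item `j`. -/
def step (j : ℕ) (p : Scan) : Sym → Scan
  | .tick => { p with
      arg0 := if p.started = j + 1 then if p.done = 0 then p.arg0 + 1 else p.arg0 else p.arg0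
      arg1 := if p.started = j + 1 then if p.done = 1 then p.arg1 + 1 else p.arg1 else p.arg1 }
  | .done => { p with
      done := p.done + 1
      nargs := if p.started = j + 1 then p.nargs + 1 else p.nargs }
  | s => { p with
      started := p.started + 1
      done := 0
      kind := if p.started = j then s.kind else p.kind }

/-- The components of the state, numbered so that each can be kept in a register. -/
def comp (p : Scan) : ℕ → ℕ
  | 0 => p.started
  | 1 => p.done
  | 2 => p.kind
  | 3 => p.nargs
  | 4 => p.arg0
  | _ => p.arg1

theorem comp_step_le (j : ℕ) (p : Scan) (s : Sym) (c : ℕ) :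
    (step j p s).comp c ≤ max (p.comp c + 1) 5 := by
  rcases s with _ | _ | _ | _ | _ | _ | _ <;>
    rcases c with _ | _ | _ | _ | _ | c <;> simp only [step, comp] <;>
    (repeat' split) <;> simp [Sym.kind]

theorem foldl_ticks (j t : ℕ) (p : Scan) :
    (List.replicate t Sym.tick).foldl (step j) p = { p with
      arg0 := if p.started = j + 1 then if p.done = 0 then p.arg0 + t else p.arg0 else p.arg0
      arg1 := if p.started = j + 1 then if p.done = 1 then p.arg1 + t else p.arg1 else p.arg1 } := by
  induction t generalizing p with
  | zero => simp
  | succ t ih =>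
    rw [List.replicate_succ, List.foldl_cons, ih]
    simp only [step, Scan.mk.injEq, true_and]
    constructor <;> (split <;> [split; rfl] <;> omega)

theorem foldl_args (j : ℕ) (l : List ℕ) (p : Scan) :
    (l.flatMap unary).foldl (step j) p = { p with
      done := p.done + l.length
      nargs := if p.started = j + 1 then p.nargs + l.length else p.nargs
      arg0 := if p.started = j + 1 then if p.done = 0 then p.arg0 + l.getD 0 0 else p.arg0
        else p.arg0
      arg1 := if p.started = j + 1 then
          if p.done = 0 then p.arg1 + l.getD 1 0
          else if p.done = 1 then p.arg1 + l.getD 0 0 else p.arg1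
        else p.arg1 } := by
  induction l generalizing p with
  | nil => simp
  | cons a l ih =>
    rw [List.flatMap_cons, List.foldl_append, ih, unary, List.foldl_append, foldl_ticks]
    simp only [List.foldl_cons, List.foldl_nil, step, List.length_cons, Scan.mk.injEq, true_and]
    refine ⟨by omega, ?_, ?_, ?_⟩
    · split <;> omega
    · split
      · split <;> simp_all
      · rfl
    · split
      · by_cases h0 : p.done = 0
        · simp [h0]
        · by_cases h1 : p.done = 1
          · simp [h1]
          · simp [h0, h1]
      · rfl

theorem foldl_item (j : ℕ) (s : Sym) (hs : s.kind ≠ 0) (l : List ℕ) (p : Scan) :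
    (s :: l.flatMap unary).foldl (step j) p = { p with
      started := p.started + 1
      done := l.length
      kind := if p.started = j then s.kind else p.kind
      nargs := if p.started = j then p.nargs + l.length else p.nargs
      arg0 := if p.started = j then p.arg0 + l.getD 0 0 else p.arg0
      arg1 := if p.started = j then p.arg1 + l.getD 1 0 else p.arg1 } := by
  rw [List.foldl_cons, foldl_args]
  cases s <;> simp_all [step, Sym.kind]

theorem foldl_items (j : ℕ) (l : List (Sym × List ℕ)) (hl : ∀ t ∈ l, t.1.kind ≠ 0) (p : Scan) :
    ∃ d, (l.flatMap fun t => t.1 :: t.2.flatMap unary).foldl (step j) p = { p with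
      started := p.started + l.length
      done := d
      kind := if p.started ≤ j then (l[j - p.started]?).elim p.kind (fun t => t.1.kind) else p.kind
      nargs := if p.started ≤ j then p.nargs + (l[j - p.started]?).elim 0 (fun t => t.2.length)
        else p.nargs
      arg0 := if p.started ≤ j then p.arg0 + (l[j - p.started]?).elim 0 (fun t => t.2.getD 0 0)
        else p.arg0
      arg1 := if p.started ≤ j then p.arg1 + (l[j - p.started]?).elim 0 (fun t => t.2.getD 1 0)
        else p.arg1 } := by
  induction l generalizing p with
  | nil => exact ⟨p.done, by simp⟩
  | cons t l ih =>
    obtain ⟨d, hd⟩ := ih (fun t ht => hl t (List.mem_cons_of_mem _ ht))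
      ((t.1 :: t.2.flatMap unary).foldl (step j) p)
    refine ⟨d, ?_⟩
    rw [List.flatMap_cons, List.foldl_append, hd, foldl_item j t.1 (hl t List.mem_cons_self)]
    rcases lt_trichotomy p.started j with h | h | h
    · obtain ⟨e, he⟩ : ∃ e, j - p.started = e + 1 := ⟨j - p.started - 1, by omega⟩
      have h1 : j - (p.started + 1) = e := by omega
      have h2 : p.started + 1 ≤ j := h
      simp [h.le, h.ne, he, h1, h2, add_assoc, add_comm 1]
    · subst h
      simp [add_assoc, add_comm 1]
    · have h1 : ¬ p.started ≤ j := by omega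
      have h2 : ¬ p.started + 1 ≤ j := by omega
      have h3 : p.started ≠ j := by omega
      simp [h1, h2, h3, add_assoc, add_comm 1]

end Scan

/-- The kind of item `j`; `0` if there is none. -/
def Circuit.kindAt (C : Circuit) (j : ℕ) : ℕ := (C.items[j]?).elim 0 fun t => t.1.kind

/-- The number of arguments of item `j`. -/
def Circuit.nargsAt (C : Circuit) (j : ℕ) : ℕ := (C.items[j]?).elim 0 fun t => t.2.length

/-- The first argument of item `j`. -/
def Circuit.arg0At (C : Circuit) (j : ℕ) : ℕ := (C.items[j]?).elim 0 fun t => t.2.getD 0 0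

/-- The second argument of item `j`. -/
def Circuit.arg1At (C : Circuit) (j : ℕ) : ℕ := (C.items[j]?).elim 0 fun t => t.2.getD 1 0

theorem Circuit.kind_ne_zero_of_mem_items {C : Circuit} {t : Sym × List ℕ} (ht : t ∈ C.items) :
    t.1.kind ≠ 0 := by
  simp only [items, List.mem_append, List.mem_map, List.mem_singleton] at ht
  rcases ht with ⟨g, -, rfl⟩ | rfl
  · cases g <;> simp [Sym.kind]
  · simp [Sym.kind]

/-- The gates of uniform circuits are found with polynomially bounded registers. -/
theorem LUniform.lookup {C : Family} (h : LUniform C) {α : Type} {D : Set α} {n : α → ℕ}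
    {X : List (α → ℕ)} (hn : LS D n X n) {j : α → ℕ} (hj : LS D n X j) :
    LS D n X (fun a => (C (n a)).kindAt (j a)) ∧ LS D n X (fun a => (C (n a)).nargsAt (j a)) ∧
    LS D n X (fun a => (C (n a)).arg0At (j a)) ∧ LS D n X (fun a => (C (n a)).arg1At (j a)) ∧
    LS D n X (fun a => (C (n a)).gates.length) := by
  obtain ⟨M, hM, hout⟩ := h
  obtain ⟨τ, pr, hτ, hpr, hw⟩ := M.exists_lsFin hM _ hout
  set st : ℕ → ℕ → ℕ → Scan := fun j n i =>
    ((List.range i).flatMap fun i => (pr n i).toList).foldl (Scan.step j) Scan.init with hst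
  have hst0 : ∀ j n, st j n 0 = Scan.init := fun j n => rfl
  have hsts : ∀ j n i, st j n (i + 1) = (pr n i).elim (st j n i) (Scan.step j (st j n i)) := by
    intro j n i
    simp only [hst, List.range_succ, List.flatMap_append, List.foldl_append]
    cases h : pr n i <;> simp [h]
  have hle : ∀ j n i c, (st j n i).comp c ≤ 5 + i := by
    intro j n i c
    induction i with
    | zero => rw [hst0]; rcases c with _ | _ | _ | _ | _ | c <;> simp [Scan.init, Scan.comp]
    | succ i ih =>
      rw [hsts]
      cases pr n i with
      | none => simp only [Option.elim_none]; omega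
      | some s =>
        have := Scan.comp_step_le j (st j n i) s c
        simp only [Option.elim_some]
        omega
  have hφ : Set.MapsTo n D Set.univ := fun _ _ => Set.mem_univ _
  have hτ' : LS D n X (fun a => τ (n a)) :=
    hτ.comp hφ (hn.1.add (.const _ _ 2)) (by simpa using hn)
  have hall : ∀ c < 6, LS D n X (fun a => (st (j a) (n a) (τ (n a))).comp c) := by
    refine LS.loop (F := fun c a i => (st (j a) (n a) i).comp c) hτ' ?_ ?_ ?_
    · intro c _
      obtain ⟨d, hd⟩ := (hτ'.1.add (.const D n 5))
      exact ⟨d, fun a ha i hi => (hle _ _ _ _).trans ((by omega : 5 + i ≤ τ (n a) + 5).trans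
        (hd a ha))⟩
    · intro c _
      refine LS.zero.congr fun a _ => ?_
      rw [hst0]
      rcases c with _ | _ | _ | _ | _ | c <;> rfl
    · intro Y h1 h2 h3
      have hn' := h1 _ hn
      have hj' := h1 _ hj
      have hp : LSFin (loopDom D fun a => τ (n a)) (fun p => n p.1) Y (fun p => pr (n p.1) p.2) := by
        intro ψ
        refine (hpr ψ).comp (φ := fun p : α × ℕ => (n p.1, p.2)) ?_ (hn'.1.add (.const _ _ 2)) ?_
        · rintro p ⟨_, hp⟩
          exact le_of_lt hp
        · intro x hx
          simp only [List.mem_cons, List.not_mem_nil, or_false] at hx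
          rcases hx with rfl | rfl
          · exact hn'
          · exact h2
      intro c hc
      refine LS.congr (f := fun p => ((pr (n p.1) p.2).elim (st (j p.1) (n p.1) p.2)
        (Scan.step (j p.1) (st (j p.1) (n p.1) p.2))).comp c) ?_ fun p _ => by rw [hsts]
      refine hp.cases (G := fun x p => (x.elim (st (j p.1) (n p.1) p.2)
        (Scan.step (j p.1) (st (j p.1) (n p.1) p.2))).comp c) fun x => ?_
      have k : ∀ c < 6, ∀ S, LS (loopDom D (fun a => τ (n a)) ∩ S) (fun p => n p.1) Y
          (fun p => (st (j p.1) (n p.1) p.2).comp c) := fun c hc S =>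
        (h3 c hc).mono_dom Set.inter_subset_left
      have k0 := k 0 (by omega)
      have k1 := k 1 (by omega)
      have k2 := k 2 (by omega)
      have k3 := k 3 (by omega)
      have k4 := k 4 (by omega)
      have k5 := k 5 (by omega)
      have kj : ∀ S, LS (loopDom D (fun a => τ (n a)) ∩ S) (fun p => n p.1) Y (fun p => j p.1) :=
        fun S => hj'.mono_dom Set.inter_subset_left
      cases x with
      | none => exact k c hc _
      | some s =>
        have start : ∀ m, LS (loopDom D (fun a => τ (n a)) ∩ {a | pr (n a.1) a.2 = some s})
            (fun p => n p.1) Y (fun p => if (st (j p.1) (n p.1) p.2).started = j p.1 then m else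
              (st (j p.1) (n p.1) p.2).kind) := fun m =>
          LS.ite_eq (k0 _) (kj _) (.const m) (by rw [Set.inter_assoc]; exact k2 _)
        have tick : ∀ e < 6, ∀ m, LS (loopDom D (fun a => τ (n a)) ∩ {a | pr (n a.1) a.2 = some s})
            (fun p => n p.1) Y (fun p => if (st (j p.1) (n p.1) p.2).started = j p.1 + 1 then
              if (st (j p.1) (n p.1) p.2).done = m then (st (j p.1) (n p.1) p.2).comp e + 1 else
              (st (j p.1) (n p.1) p.2).comp e else (st (j p.1) (n p.1) p.2).comp e) := by
          intro e he m
          refine LS.ite_eq (k0 _) (kj _).succ (LS.ite_eq ?_ (.const m) ?_ ?_) ?_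
          all_goals simp only [Set.inter_assoc]
          · exact k1 _
          · exact (k e he _).succ
          · exact k e he _
          · exact k e he _
        have arg : LS (loopDom D (fun a => τ (n a)) ∩ {a | pr (n a.1) a.2 = some s})
            (fun p => n p.1) Y (fun p => if (st (j p.1) (n p.1) p.2).started = j p.1 + 1 then
              (st (j p.1) (n p.1) p.2).nargs + 1 else (st (j p.1) (n p.1) p.2).nargs) := by
          refine LS.ite_eq (k0 _) (kj _).succ ?_ ?_
          all_goals simp only [Set.inter_assoc]
          · exact (k3 _).succ
          · exact k3 _
        have e : c = 0 ∨ c = 1 ∨ c = 2 ∨ c = 3 ∨ c = 4 ∨ c = 5 := by omega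
        rcases s with _ | _ | _ | _ | _ | _ | _ <;> rcases e with rfl | rfl | rfl | rfl | rfl | rfl <;>
          first
          | exact k0 _
          | exact k1 _
          | exact k2 _
          | exact k3 _
          | exact k4 _
          | exact k5 _
          | exact (k0 _).succ
          | exact (k1 _).succ
          | exact LS.zero
          | exact start _
          | exact arg
          | exact tick 4 (by omega) 0
          | exact tick 5 (by omega) 1
  have hfin : ∀ j n, ∃ d, st j n (τ n) = ⟨(C n).items.length, d, (C n).kindAt j, (C n).nargsAt j,
      (C n).arg0At j, (C n).arg1At j⟩ := by
    intro j n
    obtain ⟨d, hd⟩ := Scan.foldl_items j (C n).items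
      (fun t ht => Circuit.kind_ne_zero_of_mem_items ht) Scan.init
    refine ⟨d, ?_⟩
    simp only [hst]
    rw [← hw, Circuit.describe_eq_items, hd]
    simp [Scan.init, Circuit.kindAt, Circuit.nargsAt, Circuit.arg0At, Circuit.arg1At]
  refine ⟨(hall 2 (by omega)).congr fun a _ => ?_, (hall 3 (by omega)).congr fun a _ => ?_,
    (hall 4 (by omega)).congr fun a _ => ?_, (hall 5 (by omega)).congr fun a _ => ?_,
    (hall 0 (by omega)).pred.congr fun a _ => ?_⟩
  all_goals
    obtain ⟨d, hd⟩ := hfin (j a) (n a)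
    simp [hd, Scan.comp, Circuit.items]

/-! ### Values and depths of gates -/

/-- The gates to which a gate refers. -/
def Gate.refs : Gate → List ℕ
  | .input _ => []
  | .neg j => [j]
  | .conj js => js
  | .disj js => js

theorem Gate.value_congr {g : Gate} {x v w : List Bool}
    (h : ∀ j ∈ g.refs, v.getD j false = w.getD j false) : g.value x v = g.value x w := by
  cases g with
  | input i => rfl
  | neg j => simp only [Gate.value]; rw [h j (by simp [Gate.refs])]
  | conj js =>
    rw [Gate.value, Gate.value, Bool.eq_iff_iff, List.all_eq_true, List.all_eq_true]
    exact forall₂_congr fun j hj => by rw [h j hj]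
  | disj js =>
    rw [Gate.value, Gate.value, Bool.eq_iff_iff, List.any_eq_true, List.any_eq_true]
    exact exists_congr fun j => and_congr_right fun hj => by rw [h j hj]

theorem Gate.depth_congr {g : Gate} {v w : List ℕ}
    (h : ∀ j ∈ g.refs, v.getD j 0 = w.getD j 0) : g.depth v = g.depth w := by
  cases g with
  | input i => rfl
  | neg j => simp only [Gate.depth]; rw [h j (by simp [Gate.refs])]
  | conj js => exact congrArg (fun l => List.foldr max 0 l + 1) (List.map_congr_left h)
  | disj js => exact congrArg (fun l => List.foldr max 0 l + 1) (List.map_congr_left h)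

theorem foldr_max_le {l : List ℕ} {b : ℕ} : l.foldr max 0 ≤ b ↔ ∀ a ∈ l, a ≤ b := by
  induction l with
  | nil => simp
  | cons a l ih => simp [ih]

theorem Gate.depth_le {g : Gate} {d : List ℕ} {b : ℕ} (h : ∀ j ∈ g.refs, d.getD j 0 ≤ b) :
    g.depth d ≤ b + 1 := by
  cases g with
  | input i => simp [Gate.depth]
  | neg j => simpa [Gate.depth, Gate.refs] using h
  | conj js => simpa [Gate.depth, foldr_max_le, Gate.refs] using h
  | disj js => simpa [Gate.depth, foldr_max_le, Gate.refs] using h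

section Extend

variable {β : Type}

/-- Extend a list of data on gates by the data on further gates; `F` finds the data on a gate from
those on the earlier gates. -/
def extend (F : List β → Gate → β) (v : List β) (gs : List Gate) : List β :=
  gs.foldl (fun v g => v ++ [F v g]) v

variable (F : List β → Gate → β)

theorem extend_cons (v : List β) (g : Gate) (gs : List Gate) :
    extend F v (g :: gs) = extend F (v ++ [F v g]) gs := rfl

theorem extend_append (v : List β) (gs hs : List Gate) :
    extend F v (gs ++ hs) = extend F (extend F v gs) hs := List.foldl_append

theorem length_extend (v : List β) (gs : List Gate) :
    (extend F v gs).length = v.length + gs.length := by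
  induction gs generalizing v with
  | nil => rfl
  | cons g gs ih => rw [extend_cons, ih]; simp; omega

theorem getD_extend_of_lt {v : List β} (gs : List Gate) {i : ℕ} (hi : i < v.length) (d : β) :
    (extend F v gs).getD i d = v.getD i d := by
  induction gs generalizing v with
  | nil => rfl
  | cons g gs ih =>
    rw [extend_cons, ih (by simp; omega), List.getD_append _ _ _ _ hi]

theorem getD_extend_take (d : β) {v : List β} {gs : List Gate} {i : ℕ} {g : Gate}
    (hg : gs[i]? = some g) : (extend F v gs).getD (v.length + i) d =
      F ((extend F v gs).take (v.length + i)) g := by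
  obtain ⟨hi, rfl⟩ := List.getElem?_eq_some_iff.1 hg
  have e : gs = gs.take i ++ gs[i] :: gs.drop (i + 1) := by simp
  have hl : (extend F v (gs.take i)).length = v.length + i := by
    rw [length_extend, List.length_take]
    omega
  have h1 : extend F v gs = extend F (extend F v (gs.take i) ++ [F (extend F v (gs.take i)) gs[i]])
      (gs.drop (i + 1)) := by
    conv_lhs => rw [e, extend_append, extend_cons]
  have h2 : (extend F v gs).take (v.length + i) = extend F v (gs.take i) := by
    refine List.ext_getElem (by rw [List.length_take, length_extend, hl]; omega) fun j h h' => ?_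
    have hj : j < v.length + i := by omega
    have h3 := getD_extend_of_lt F (gs.drop (i + 1))
      (v := extend F v (gs.take i) ++ [F (extend F v (gs.take i)) gs[i]]) (i := j)
      (by simp; omega) d
    rw [← h1, List.getD_append _ _ _ _ (by omega), List.getD_eq_getElem _ _ h',
      List.getD_eq_getElem _ _ (by rw [length_extend]; omega)] at h3
    rw [List.getElem_take, h3]
  rw [h2, h1, getD_extend_of_lt F _ (by simp; omega), ← hl]
  simp

/-- The data on a gate in terms of the complete list of data. -/
theorem getD_extend {d : β}
    (hF : ∀ g v w, (∀ j ∈ g.refs, v.getD j d = w.getD j d) → F v g = F w g)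
    {v : List β} {gs : List Gate} {i : ℕ} {g : Gate} (hg : gs[i]? = some g)
    (hr : ∀ j ∈ g.refs, j < v.length + i) :
    (extend F v gs).getD (v.length + i) d = F (extend F v gs) g := by
  rw [getD_extend_take F d hg]
  refine hF _ _ _ fun j hj => ?_
  rw [List.getD_eq_getElem?_getD, List.getElem?_take_of_lt (hr j hj), List.getD_eq_getElem?_getD]

end Extend

theorem Circuit.values_eq_extend (C : Circuit) (x : List Bool) :
    C.values x = extend (fun v g => g.value x v) [] C.gates := rfl

/-- The depths of the gates of a circuit. -/
def Circuit.depths (C : Circuit) : List ℕ := extend (fun d g => g.depth d) [] C.gates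

theorem Circuit.length_values (C : Circuit) (x : List Bool) :
    (C.values x).length = C.gates.length := by
  rw [values_eq_extend, length_extend]; simp

theorem Circuit.getD_values {C : Circuit} {x : List Bool} {i : ℕ} {g : Gate}
    (hg : C.gates[i]? = some g) (hr : ∀ j ∈ g.refs, j < i) :
    (C.values x).getD i false = g.value x (C.values x) := by
  have := getD_extend (fun v g => g.value x v) (fun _ _ _ h => Gate.value_congr h) (v := [])
    hg (by simpa using hr)
  rwa [List.length_nil, zero_add] at this

theorem Circuit.getD_depths {C : Circuit} {i : ℕ} {g : Gate}
    (hg : C.gates[i]? = some g) (hr : ∀ j ∈ g.refs, j < i) :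
    C.depths.getD i 0 = g.depth C.depths := by
  have := getD_extend (fun d g => g.depth d) (fun _ _ _ h => Gate.depth_congr h) (v := [])
    hg (by simpa using hr)
  rwa [List.length_nil, zero_add] at this

theorem Circuit.depth_le {C : Circuit} {b : ℕ} (h : ∀ i < C.gates.length, C.depths.getD i 0 ≤ b) :
    C.depth ≤ b := by
  refine foldr_max_le.2 fun a ha => ?_
  obtain ⟨i, hi, rfl⟩ := List.getElem_of_mem ha
  have hl : (extend (fun d g => g.depth d) [] C.gates).length = C.gates.length := by
    rw [length_extend]; simp
  have h' := h i (by rw [← hl]; exact hi)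
  rwa [depths, extend, List.getD_eq_getElem _ _ hi] at h'

theorem Circuit.length_eval (C : Circuit) (x : List Bool) :
    (C.eval x).length = C.outputs.length := by simp [eval]

theorem Circuit.size_le {C : Circuit} {f : ℕ} (h : ∀ g ∈ C.gates, g.fanIn ≤ f) :
    C.size ≤ C.gates.length * (f + 1) + C.outputs.length := by
  refine Nat.add_le_add_right ?_ _
  have := List.sum_le_card_nsmul (C.gates.map fun g => g.fanIn + 1) (f + 1) (by
    intro m hm
    obtain ⟨g, hg, rfl⟩ := List.mem_map.1 hm
    exact Nat.succ_le_succ (h g hg))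
  simpa using this

/-- Polynomial bounds in `n + 2` are of the form that the definition of circuit size asks for. -/
theorem exists_pow_add_le (A e : ℕ) : ∃ c, ∀ n : ℕ, A * (n + 2) ^ e ≤ n ^ c + c := by
  -- For `n ≥ 2` use `(n + 2) ^ e ≤ n ^ (2 * e)`; for `n ≤ 1` the additive constant is enough.
  refine ⟨A * 3 ^ e + 2 * e, fun n => ?_⟩
  rcases Nat.lt_or_ge n 2 with h | h
  · have : (n + 2) ^ e ≤ 3 ^ e := Nat.pow_le_pow_left (by omega) e
    have := Nat.mul_le_mul_left A this
    omega
  · have h2 : n + 2 ≤ n ^ 2 := by nlinarith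
    refine le_trans ?_ (Nat.le_add_right _ _)
    rw [pow_add, pow_mul n 2 e]
    refine Nat.mul_le_mul ?_ (Nat.pow_le_pow_left h2 e)
    refine le_trans ?_ (Nat.pow_le_pow_left h _)
    refine (Nat.le_mul_of_pos_right A (by positivity : 0 < 3 ^ e)).trans Nat.lt_two_pow_self.le

/-! ### Blocks of gates for arbitrary Boolean functions -/

/-- A list of logical gates of fan-in at most two that may refer to `m` ports, numbered `0, …, m - 1`,
and to earlier gates of the list, numbered from `m` on. -/
def IsBlock (m : ℕ) (s : List Gate) : Prop :=
  ∀ i g, s[i]? = some g → (∀ j ∈ g.refs, j < m + i) ∧ g.fanIn ≤ 2 ∧ ∀ k, g ≠ .input k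

/-- The values of the ports and gates of a block. -/
def blockValues (u : List Bool) (s : List Gate) : List Bool := extend (fun v g => g.value [] v) u s

theorem IsBlock.concat {m : ℕ} {s : List Gate} (hs : IsBlock m s) {g : Gate}
    (h1 : ∀ j ∈ g.refs, j < m + s.length) (h2 : g.fanIn ≤ 2) (h3 : ∀ k, g ≠ .input k) :
    IsBlock m (s ++ [g]) := by
  intro i g' hg
  rcases lt_trichotomy i s.length with h | rfl | h
  · exact hs i g' (by rwa [List.getElem?_append_left h] at hg)
  · obtain rfl : g = g' := by simpa using hg
    exact ⟨h1, h2, h3⟩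
  · rw [List.getElem?_eq_none (by simp; omega)] at hg
    cases hg

/-- The function `f` of `m` bits can be computed by gates added to any block. -/
def Blockable (m : ℕ) (f : List Bool → Bool) : Prop :=
  ∀ s, IsBlock m s → ∃ t j, IsBlock m (s ++ t) ∧ j < (s ++ t).length ∧
    ∀ u : List Bool, u.length = m → (blockValues u (s ++ t)).getD (m + j) false = f u

theorem blockValues_getD_append {u : List Bool} {s : List Gate} (t : List Gate) {j : ℕ}
    (hj : j < u.length + s.length) :
    (blockValues u (s ++ t)).getD j false = (blockValues u s).getD j false := by
  rw [blockValues, extend_append]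
  exact getD_extend_of_lt _ _ (by rwa [length_extend]) _

theorem blockValues_concat (u : List Bool) (s : List Gate) (g : Gate) :
    (blockValues u (s ++ [g])).getD (u.length + s.length) false = g.value [] (blockValues u s) := by
  rw [blockValues, extend_append, extend_cons, extend, List.foldl_nil]
  rw [List.getD_append_right _ _ _ _ (by rw [length_extend]), length_extend]
  simp [blockValues]

namespace Blockable

variable {m : ℕ} {f g h : List Bool → Bool}

theorem congr (hf : Blockable m f) (hfg : ∀ u : List Bool, u.length = m → f u = g u) :
    Blockable m g := by
  intro s hs
  obtain ⟨t, j, h1, h2, h3⟩ := hf s hs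
  exact ⟨t, j, h1, h2, fun u hu => (h3 u hu).trans (hfg u hu)⟩

theorem true : Blockable m fun _ => true := by
  intro s hs
  refine ⟨[.conj []], s.length, hs.concat (by simp [Gate.refs]) (by simp [Gate.fanIn])
    (by simp), by simp, fun u hu => ?_⟩
  rw [← hu, blockValues_concat]
  rfl

theorem not (hf : Blockable m f) : Blockable m fun u => !f u := by
  intro s hs
  obtain ⟨t, j, h1, h2, h3⟩ := hf s hs
  refine ⟨t ++ [.neg (m + j)], (s ++ t).length, ?_, by simp, fun u hu => ?_⟩
  · rw [← List.append_assoc]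
    exact h1.concat (by simpa [Gate.refs] using h2) (by simp [Gate.fanIn]) (by simp)
  · rw [← hu, ← List.append_assoc, blockValues_concat, hu]
    simp only [Gate.value]
    rw [h3 u hu]

theorem port {i : ℕ} (hi : i < m) : Blockable m fun u => u.getD i false := by
  have h : Blockable m fun u => !u.getD i false := by
    intro s hs
    refine ⟨[.neg i], s.length, hs.concat (by simp [Gate.refs]; omega) (by simp [Gate.fanIn])
      (by simp), by simp, fun u hu => ?_⟩
    rw [← hu, blockValues_concat]
    simp only [Gate.value]
    rw [blockValues, getD_extend_of_lt _ _ (by omega)]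
  exact h.not.congr fun u _ => by simp

theorem and (hf : Blockable m f) (hg : Blockable m g) : Blockable m fun u => f u && g u := by
  intro s hs
  obtain ⟨t, j, h1, h2, h3⟩ := hf s hs
  obtain ⟨t', j', h1', h2', h3'⟩ := hg _ h1
  refine ⟨t ++ (t' ++ [.conj [m + j, m + j']]), (s ++ t ++ t').length, ?_, by simp,
    fun u hu => ?_⟩
  · rw [← List.append_assoc, ← List.append_assoc]
    refine h1'.concat ?_ (by simp [Gate.fanIn]) (by simp)
    simp only [List.length_append] at *
    intro i hi
    simp only [Gate.refs, List.mem_cons, List.not_mem_nil, or_false] at hi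
    omega
  · rw [← hu, ← List.append_assoc, ← List.append_assoc, blockValues_concat, hu]
    simp only [Gate.value, List.all_cons, List.all_nil, Bool.and_true]
    rw [h3' u hu, blockValues_getD_append _ (by omega), h3 u hu]

theorem or (hf : Blockable m f) (hg : Blockable m g) : Blockable m fun u => f u || g u :=
  (hf.not.and hg.not).not.congr fun u _ => by simp

/-- Every Boolean function can be computed, by expansion with respect to its last variable. -/
theorem all (f : List Bool → Bool) : Blockable m f := by
  have main : ∀ k ≤ m, ∀ g : List Bool → Bool, Blockable m fun u => g (u.take k) := by
    intro k
    induction k with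
    | zero =>
      intro _ g
      cases h : g []
      · exact true.not.congr fun u _ => by simp [h]
      · exact true.congr fun u _ => by simp [h]
    | succ k ih =>
      intro hk g
      refine (((port (i := k) (by omega)).and
        (ih (by omega) fun u => g (u ++ [Bool.true]))).or
        ((port (i := k) (by omega)).not.and
        (ih (by omega) fun u => g (u ++ [Bool.false])))).congr fun u hu => ?_
      have hk' : k < u.length := by omega
      rw [List.getD_eq_getElem _ _ hk', List.take_succ_eq_append_getElem hk']
      cases u[k] <;> simp
  exact (main m le_rfl f).congr fun u hu => by rw [← hu, List.take_length]

end Blockable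

/-- Every function of `m` bits with `w` bits as its value is computed by a block. -/
theorem exists_block (m w : ℕ) (f : List Bool → ℕ → Bool) :
    ∃ (s : List Gate) (out : ℕ → ℕ), IsBlock m s ∧ (∀ j < w, out j < s.length) ∧
      ∀ u : List Bool, u.length = m → ∀ j < w,
        (blockValues u s).getD (m + out j) false = f u j := by
  induction w with
  | zero => exact ⟨[], fun _ => 0, by simp [IsBlock], by simp, by simp⟩
  | succ w ih =>
    obtain ⟨s, out, h1, h2, h3⟩ := ih
    obtain ⟨t, k, h4, h5, h6⟩ := Blockable.all (m := m) (fun u => f u w) s h1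
    refine ⟨s ++ t, Function.update out w k, h4, fun j hj => ?_, fun u hu j hj => ?_⟩
    · by_cases hjw : j = w
      · subst hjw; simpa using h5
      · rw [Function.update_of_ne hjw, List.length_append]
        have := h2 j (by omega)
        omega
    · by_cases hjw : j = w
      · subst hjw; simpa using h6 u hu
      · rw [Function.update_of_ne hjw, blockValues_getD_append _ (by
          rw [hu]; have := h2 j (by omega); omega)]
        exact h3 u hu j (by omega)

/-- Rename the gates to which a gate refers. -/
def Gate.rename (ρ : ℕ → ℕ) : Gate → Gate
  | .input i => .input i
  | .neg j => .neg (ρ j)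
  | .conj js => .conj (js.map ρ)
  | .disj js => .disj (js.map ρ)

theorem Gate.refs_rename (ρ : ℕ → ℕ) (g : Gate) : (g.rename ρ).refs = g.refs.map ρ := by
  cases g <;> rfl

theorem Gate.fanIn_rename (ρ : ℕ → ℕ) (g : Gate) : (g.rename ρ).fanIn = g.fanIn := by
  cases g <;> simp [rename, fanIn]

theorem Gate.value_rename {ρ : ℕ → ℕ} {g : Gate} (hg : ∀ k, g ≠ .input k) {x y v w : List Bool}
    (h : ∀ j ∈ g.refs, v.getD (ρ j) false = w.getD j false) :
    (g.rename ρ).value x v = g.value y w := by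
  cases g with
  | input k => exact absurd rfl (hg k)
  | neg j => simp only [rename, Gate.value]; rw [h j (by simp [Gate.refs])]
  | conj js =>
    rw [rename, Gate.value, Gate.value, Bool.eq_iff_iff, List.all_map, List.all_eq_true,
      List.all_eq_true]
    exact forall₂_congr fun j hj => by rw [Function.comp_apply, h j hj]
  | disj js =>
    rw [rename, Gate.value, Gate.value, Bool.eq_iff_iff, List.any_map, List.any_eq_true,
      List.any_eq_true]
    exact exists_congr fun j => and_congr_right fun hj => by rw [Function.comp_apply, h j hj]

/-- Where the references of a block with `m` ports go when the block is placed in a circuit from gate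
`b` on, with its ports connected to the gates `port`. -/
def wire (m : ℕ) (port : ℕ → ℕ) (b j : ℕ) : ℕ := if j < m then port j else b + (j - m)

/-- A block placed in a circuit. -/
def placed (m : ℕ) (port : ℕ → ℕ) (b : ℕ) (s : List Gate) : List Gate :=
  s.map (Gate.rename (wire m port b))

section Placed

variable {C : Circuit} {m b : ℕ} {port : ℕ → ℕ} {s : List Gate}

theorem IsBlock.wire_lt (hp : ∀ r < m, port r < b) {i j : ℕ} (hj : j < m + i) :
    wire m port b j < b + i := by
  unfold wire
  split
  · rename_i h
    have := hp j h
    omega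
  · omega

/-- A placed block computes its function from the values of the gates at its ports. -/
theorem IsBlock.values_placed (hs : IsBlock m s) (hp : ∀ r < m, port r < b)
    (hC : ∀ i < s.length, C.gates[b + i]? = (placed m port b s)[i]?) (x : List Bool) {r : ℕ}
    (hr : r < m + s.length) :
    (C.values x).getD (wire m port b r) false =
      (blockValues ((List.range m).map fun r => (C.values x).getD (port r) false) s).getD r
        false := by
  set u := (List.range m).map fun r => (C.values x).getD (port r) false with hu
  have hul : u.length = m := by simp [hu]
  induction r using Nat.strong_induction_on with
  | _ r ih =>
    by_cases hrm : r < m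
    · rw [blockValues, getD_extend_of_lt _ _ (by omega)]
      simp [wire, hrm, hu, List.getD_eq_getElem?_getD]
    · obtain ⟨i, rfl⟩ : ∃ i, r = m + i := ⟨r - m, by omega⟩
      have hi : i < s.length := by omega
      obtain ⟨h1, h2, h3⟩ := hs i _ (List.getElem?_eq_getElem hi)
      have e : wire m port b (m + i) = b + i := by simp [wire]
      have hg : C.gates[b + i]? = some (s[i].rename (wire m port b)) := by
        rw [hC i hi]; simp [placed, hi]
      have e2 := getD_extend (fun v g => g.value [] v) (fun _ _ _ h => Gate.value_congr h) (v := u)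
        (List.getElem?_eq_getElem hi) (d := false) (by rw [hul]; exact h1)
      rw [hul] at e2
      rw [e, Circuit.getD_values hg, blockValues, e2]
      · exact Gate.value_rename h3 fun j hj => ih j (h1 j hj) (by have := h1 j hj; omega)
      · intro j hj
        rw [Gate.refs_rename] at hj
        obtain ⟨j', hj', rfl⟩ := List.mem_map.1 hj
        exact IsBlock.wire_lt hp (h1 j' hj')

theorem IsBlock.depths_placed (hs : IsBlock m s) (hp : ∀ r < m, port r < b)
    (hC : ∀ i < s.length, C.gates[b + i]? = (placed m port b s)[i]?) {d : ℕ}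
    (hd : ∀ r < m, C.depths.getD (port r) 0 ≤ d) {r : ℕ} (hr : r < m + s.length) :
    C.depths.getD (wire m port b r) 0 ≤ d + (r + 1 - m) := by
  induction r using Nat.strong_induction_on with
  | _ r ih =>
    by_cases hrm : r < m
    · have := hd r hrm
      simp only [wire, hrm, if_true]
      omega
    · obtain ⟨i, rfl⟩ : ∃ i, r = m + i := ⟨r - m, by omega⟩
      have hi : i < s.length := by omega
      obtain ⟨h1, h2, h3⟩ := hs i _ (List.getElem?_eq_getElem hi)
      have e : wire m port b (m + i) = b + i := by simp [wire]
      have hg : C.gates[b + i]? = some (s[i].rename (wire m port b)) := by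
        rw [hC i hi]; simp [placed, hi]
      have href : ∀ j ∈ (s[i].rename (wire m port b)).refs, j < b + i := by
        intro j hj
        rw [Gate.refs_rename] at hj
        obtain ⟨j', hj', rfl⟩ := List.mem_map.1 hj
        exact IsBlock.wire_lt hp (h1 j' hj')
      rw [e, Circuit.getD_depths hg href]
      refine (Gate.depth_le (b := d + i) ?_).trans (by omega)
      intro j hj
      rw [Gate.refs_rename] at hj
      obtain ⟨j', hj', rfl⟩ := List.mem_map.1 hj
      have := h1 j' hj'
      have := ih j' this (by omega)
      omega

end Placed

/-! ### Finite automata in uniform `NC¹` -/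

theorem pow_add_le_pow_add {c d : ℕ} (h : c ≤ d) (n : ℕ) : n ^ c + c ≤ n ^ d + d := by
  rcases Nat.eq_zero_or_pos n with rfl | hn
  · rcases Nat.eq_zero_or_pos c with rfl | hc
    · rcases Nat.eq_zero_or_pos d with rfl | hd
      · exact le_rfl
      · rw [Nat.zero_pow hd, pow_zero]; omega
    · rw [Nat.zero_pow hc, Nat.zero_pow (by omega : 0 < d)]; omega
  · exact Nat.add_le_add (Nat.pow_le_pow_right hn h) h

theorem getElem?_flatMap_range {β : Type} (f : ℕ → List β) (S : ℕ) {P : ℕ}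
    (hf : ∀ p < P, (f p).length = S) {p i : ℕ} (hp : p < P) (hi : i < S) :
    ((List.range P).flatMap f)[p * S + i]? = (f p)[i]? := by
  have hlen : ∀ Q ≤ P, ((List.range Q).flatMap f).length = Q * S := by
    intro Q
    induction Q with
    | zero => simp
    | succ Q ih =>
      intro hQ
      rw [List.range_succ, List.flatMap_append, List.length_append, ih (by omega)]
      simp [hf Q (by omega), Nat.succ_mul]
  induction P with
  | zero => omega
  | succ P ih =>
    rw [List.range_succ, List.flatMap_append, List.flatMap_singleton]
    by_cases h : p = P
    · subst h
      rw [List.getElem?_append_right (by rw [hlen p (by omega)]; omega), hlen p (by omega)]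
      simp
    · rw [List.getElem?_append_left]
      · exact ih (fun p hp => hf p (by omega)) (by omega) fun Q hQ => hlen Q (by omega)
      · rw [hlen P (by omega)]
        have : (p + 1) * S ≤ P * S := Nat.mul_le_mul_right _ (by omega)
        rw [Nat.succ_mul] at this
        omega

theorem length_flatMap_range {β : Type} (f : ℕ → List β) (S P : ℕ)
    (hf : ∀ p < P, (f p).length = S) : ((List.range P).flatMap f).length = P * S := by
  induction P with
  | zero => simp
  | succ P ih =>
    rw [List.range_succ, List.flatMap_append, List.length_append,
      ih fun p hp => hf p (by omega)]
    simp [hf P (by omega), Nat.succ_mul]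

/-- The least power of two above `n`, at least `2`. -/
def widthOf (n : ℕ) : ℕ := 2 ^ (Nat.log 2 n + 1)

theorem lt_widthOf (n : ℕ) : n < widthOf n := Nat.lt_pow_succ_log_self (by omega) n

theorem widthOf_le (n : ℕ) : widthOf n ≤ 2 * n + 2 := by
  rcases Nat.eq_zero_or_pos n with rfl | hn
  · simp [widthOf]
  · have := Nat.pow_log_le_self 2 hn.ne'
    rw [widthOf, pow_succ]
    omega

theorem log_succ (i : ℕ) :
    Nat.log 2 (i + 1) = if i + 1 = widthOf i then Nat.log 2 i + 1 else Nat.log 2 i := by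
  have h0 := lt_widthOf i
  split
  · rename_i h
    rw [h, widthOf, Nat.log_pow (by omega)]
  · rename_i h
    have h1 : i + 1 < 2 ^ (Nat.log 2 i + 1) := by
      rw [widthOf] at h h0; omega
    refine le_antisymm (Nat.lt_succ_iff.1 ?_) (Nat.log_mono_right (by omega))
    exact Nat.log_lt_of_lt_pow (by omega) h1

theorem widthOf_succ (i : ℕ) :
    widthOf (i + 1) = if i + 1 = widthOf i then 2 * widthOf i else widthOf i := by
  conv_lhs => rw [widthOf, log_succ]
  split
  · rw [widthOf, pow_succ, mul_comm]
  · rfl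

section

variable {α : Type} {D : Set α} {n : α → ℕ} {X : List (α → ℕ)} {f : α → ℕ}

theorem LS.widthOf (hf : LS D n X f) : LS D n X (fun a => widthOf (f a)) := by
  refine loop_one (fun a i => CircuitComplexity.widthOf i) hf ?_ ((const 2).congr fun _ _ => rfl) ?_
  · obtain ⟨c, hc⟩ := (((PolyBounded.const D n 2).mul hf.1).add (.const D n 2))
    exact ⟨c, fun a ha i hi => (widthOf_le i).trans ((by omega : _ ≤ 2 * f a + 2).trans (hc a ha))⟩
  · intro Y h1 h2 h3
    exact (ite_eq h2.succ h3 (((const 2).mul h3).mono_dom Set.inter_subset_left)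
      (h3.mono_dom Set.inter_subset_left)).congr fun p _ => (widthOf_succ p.2).symm

theorem LS.log (hf : LS D n X f) : LS D n X (fun a => Nat.log 2 (f a)) := by
  refine loop_one (fun a i => Nat.log 2 i) hf ?_ (zero.congr fun _ _ => rfl) ?_
  · obtain ⟨c, hc⟩ := hf.1
    exact ⟨c, fun a ha i hi => (Nat.log_le_self 2 i).trans (hi.trans (hc a ha))⟩
  · intro Y h1 h2 h3
    exact (ite_eq h2.succ h2.widthOf (h3.succ.mono_dom Set.inter_subset_left)
      (h3.mono_dom Set.inter_subset_left)).congr fun p _ => (log_succ p.2).symm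

end

/-- The data of a circuit in the form of a complete binary tree, for inputs that consist of a head of
`q` bits and chunks of `ℓ` bits. Every node of the tree is the block `s`, whose ports are `ℓ` input
bits, `w` bits from either child, and a bit that tells leaves from inner nodes; the `w` bits that it
passes on are the values of the gates `o 0, …, o (w - 1)` of the block. The block `s'` obtains the
head and the `w` bits from the root, and its gates `o' 0, …, o' (w' - 1)` are the outputs. -/
structure TreeData where
  q : ℕ
  ℓ : ℕ
  w : ℕ
  w' : ℕ
  s : List Gate
  s' : List Gate
  o : ℕ → ℕ
  o' : ℕ → ℕ

namespace TreeData

variable (T : TreeData)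

/-- The number of ports of a node. -/
def ports : ℕ := T.ℓ + T.w + T.w + 1

/-- The first gate of node `p`. It is preceded by the inputs and the two constants. -/
def base (n p : ℕ) : ℕ := n + 2 + p * T.s.length

/-- The gates at the ports of node `p`. With `K = widthOf n`, the nodes `p < K` are leaves, and the
children of a node `p ≥ K` are the nodes `2 (p - K)` and `2 (p - K) + 1`. Gate `n` is the constant
true, and is also read in place of bits beyond the end of the input; gate `n + 1` is the constant
false. -/
def port (n p r : ℕ) : ℕ :=
  if r < T.ℓ then min (T.q + T.ℓ * p + r) n
  else if r < T.ℓ + T.w then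
    if widthOf n ≤ p then T.base n (2 * (p - widthOf n)) + T.o (r - T.ℓ) else n
  else if r < T.ℓ + T.w + T.w then
    if widthOf n ≤ p then T.base n (2 * (p - widthOf n) + 1) + T.o (r - (T.ℓ + T.w)) else n
  else if widthOf n ≤ p then n + 1 else n

/-- The gates at the ports of the final block. -/
def port' (n r : ℕ) : ℕ :=
  if r < T.q then min r n else T.base n (2 * widthOf n - 2) + T.o (r - T.q)

/-- The tree circuit for inputs of length `n`. -/
def circuit (n : ℕ) : Circuit where
  gates := (List.range n).map Gate.input ++ ([.conj [], .disj []] ++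
    ((List.range (2 * widthOf n - 1)).flatMap (fun p =>
      placed T.ports (T.port n p) (T.base n p) T.s) ++
    placed (T.q + T.w) (T.port' n) (T.base n (2 * widthOf n - 1)) T.s'))
  outputs := (List.range T.w').map fun j => T.base n (2 * widthOf n - 1) + T.o' j

/-- The references in the data make sense. -/
structure Valid : Prop where
  block : IsBlock T.ports T.s
  block' : IsBlock (T.q + T.w) T.s'
  o_lt : ∀ j < T.w, T.o j < T.s.length
  o'_lt : ∀ j < T.w', T.o' j < T.s'.length

variable {T}

theorem two_le_widthOf (n : ℕ) : 2 ≤ widthOf n := by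
  rw [widthOf, pow_succ]
  have := Nat.one_le_two_pow (n := Nat.log 2 n)
  omega

theorem length_placed (m : ℕ) (port : ℕ → ℕ) (b : ℕ) (s : List Gate) :
    (placed m port b s).length = s.length := by simp [placed]

theorem length_gates (n : ℕ) : (T.circuit n).gates.length =
    T.base n (2 * widthOf n - 1) + T.s'.length := by
  have := length_flatMap_range (fun p => placed T.ports (T.port n p) (T.base n p) T.s)
    T.s.length (2 * widthOf n - 1) (fun p _ => length_placed ..)
  simp only [circuit, List.length_append, length_placed, List.length_map, List.length_range,
    List.length_cons, List.length_nil]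
  rw [this, base]
  omega

theorem gates_input {n i : ℕ} (hi : i < n) : (T.circuit n).gates[i]? = some (.input i) := by
  rw [circuit, List.getElem?_append_left (by simpa using hi)]
  simp [hi]

theorem gates_true (n : ℕ) : (T.circuit n).gates[n]? = some (.conj []) := by
  rw [circuit, List.getElem?_append_right (by simp)]
  simp

theorem gates_false (n : ℕ) : (T.circuit n).gates[n + 1]? = some (.disj []) := by
  rw [circuit, List.getElem?_append_right (by simp)]
  simp

theorem gates_node {n p i : ℕ} (hp : p < 2 * widthOf n - 1) (hi : i < T.s.length) :
    (T.circuit n).gates[T.base n p + i]? =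
      (placed T.ports (T.port n p) (T.base n p) T.s)[i]? := by
  have h1 := getElem?_flatMap_range (fun p => placed T.ports (T.port n p) (T.base n p) T.s)
    T.s.length (P := 2 * widthOf n - 1) (fun p _ => length_placed ..) hp hi
  have h2 := length_flatMap_range (fun p => placed T.ports (T.port n p) (T.base n p) T.s)
    T.s.length (2 * widthOf n - 1) (fun p _ => length_placed ..)
  have h3 : (p + 1) * T.s.length ≤ (2 * widthOf n - 1) * T.s.length :=
    Nat.mul_le_mul_right _ (by omega)
  rw [Nat.succ_mul] at h3
  simp only [circuit]
  rw [List.getElem?_append_right (by simp [base]; omega),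
    List.getElem?_append_right (by simp [base]; omega), List.getElem?_append_left, ← h1]
  · congr 1
    simp [base]
    omega
  · rw [h2]
    simp [base]
    omega

theorem gates_final {n i : ℕ} (hi : i < T.s'.length) :
    (T.circuit n).gates[T.base n (2 * widthOf n - 1) + i]? =
      (placed (T.q + T.w) (T.port' n) (T.base n (2 * widthOf n - 1)) T.s')[i]? := by
  have h2 := length_flatMap_range (fun p => placed T.ports (T.port n p) (T.base n p) T.s)
    T.s.length (2 * widthOf n - 1) (fun p _ => length_placed ..)
  simp only [circuit]
  rw [List.getElem?_append_right (by simp [base]; omega),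
    List.getElem?_append_right (by simp [base]; omega), List.getElem?_append_right]
  · congr 1
    rw [h2]
    simp [base]
    omega
  · rw [h2]
    simp [base]
    omega

theorem base_add_lt (hT : T.Valid) {n c p j : ℕ} (hc : c < p) (hj : j < T.w) :
    T.base n c + T.o j < T.base n p := by
  have := hT.o_lt j hj
  have h3 : (c + 1) * T.s.length ≤ p * T.s.length := Nat.mul_le_mul_right _ (by omega)
  rw [Nat.succ_mul] at h3
  simp only [base]
  omega

theorem port_lt (hT : T.Valid) {n p : ℕ} (hp : p < 2 * widthOf n - 1) {r : ℕ} (hr : r < T.ports) :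
    T.port n p r < T.base n p := by
  have h0 : n + 1 < T.base n p := by simp only [base]; omega
  unfold ports at hr
  unfold port
  split_ifs
  · omega
  · exact base_add_lt hT (by omega) (by omega)
  · omega
  · exact base_add_lt hT (by omega) (by omega)
  · omega
  · omega
  · omega

theorem port'_lt (hT : T.Valid) {n r : ℕ} (hr : r < T.q + T.w) :
    T.port' n r < T.base n (2 * widthOf n - 1) := by
  have h0 : n + 1 < T.base n (2 * widthOf n - 1) := by simp only [base]; omega
  have := two_le_widthOf n
  unfold port'
  split_ifs
  · omega
  · exact base_add_lt hT (by omega) (by omega)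

theorem depths_le_one (n : ℕ) {i : ℕ} (hi : i < n + 2) :
    (T.circuit n).depths.getD i 0 ≤ 1 := by
  rcases Nat.lt_or_ge i n with h | h
  · rw [Circuit.getD_depths (gates_input h) (by simp [Gate.refs])]
    simp [Gate.depth]
  · obtain rfl | rfl : i = n ∨ i = n + 1 := by omega
    · rw [Circuit.getD_depths (gates_true _) (by simp [Gate.refs])]
      simp [Gate.depth]
    · rw [Circuit.getD_depths (gates_false _) (by simp [Gate.refs])]
      simp [Gate.depth]

theorem depths_node (hT : T.Valid) (n : ℕ) {t : ℕ} (ht : t ≤ Nat.log 2 n + 1) {p : ℕ}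
    (hp : p + 2 ^ (Nat.log 2 n + 1 - t) < 2 * widthOf n) {i : ℕ} (hi : i < T.s.length) :
    (T.circuit n).depths.getD (T.base n p + i) 0 ≤ 1 + (t + 1) * T.s.length := by
  induction t generalizing p i with
  | zero =>
    have hp' : p < widthOf n := by
      rw [Nat.sub_zero] at hp
      have : widthOf n = 2 ^ (Nat.log 2 n + 1) := rfl
      omega
    have := hT.block.depths_placed (fun r hr => port_lt hT (by omega) hr)
      (fun i hi => gates_node (n := n) (p := p) (by omega) hi) (d := 1) (fun r hr => ?_)
      (r := T.ports + i) (by omega)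
    · simp only [wire] at this
      rw [if_neg (by omega), Nat.add_sub_cancel_left] at this
      omega
    · refine depths_le_one n ?_
      unfold port
      split_ifs <;> omega
  | succ t ih =>
    obtain ⟨e, he⟩ : ∃ e, Nat.log 2 n + 1 - t = e + 1 := ⟨Nat.log 2 n - t, by omega⟩
    rw [show Nat.log 2 n + 1 - (t + 1) = e by omega] at hp
    have h0 := Nat.one_le_two_pow (n := e)
    have hs : (t + 1 + 1) * T.s.length = (t + 1) * T.s.length + T.s.length := Nat.succ_mul _ _
    have := hT.block.depths_placed (fun r hr => port_lt hT (by omega) hr)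
      (fun i hi => gates_node (n := n) (p := p) (by omega) hi) (d := 1 + (t + 1) * T.s.length)
      (fun r hr => ?_) (r := T.ports + i) (by omega)
    · simp only [wire] at this
      rw [if_neg (by omega), Nat.add_sub_cancel_left] at this
      omega
    · have hc : ∀ j, j < n + 2 → (T.circuit n).depths.getD j 0 ≤ 1 + (t + 1) * T.s.length :=
        fun j hj => (depths_le_one n hj).trans (by omega)
      have hi : ∀ p', p' ≤ 2 * (p - widthOf n) + 1 → widthOf n ≤ p → ∀ i < T.s.length,
          (T.circuit n).depths.getD (T.base n p' + i) 0 ≤ 1 + (t + 1) * T.s.length := by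
        intro p' hp' hpw i hi
        refine ih (by omega) ?_ hi
        rw [he, pow_succ]
        omega
      unfold ports at hr
      unfold port
      split_ifs
      · exact hc _ (by omega)
      · exact hi _ (by omega) (by omega) _ (hT.o_lt _ (by omega))
      · exact hc _ (by omega)
      · exact hi _ (by omega) (by omega) _ (hT.o_lt _ (by omega))
      · exact hc _ (by omega)
      · exact hc _ (by omega)
      · exact hc _ (by omega)

theorem exists_base {n j : ℕ} (P : ℕ) (h1 : n + 2 ≤ j) (h2 : j < T.base n P) :
    ∃ p < P, ∃ i < T.s.length, j = T.base n p + i := by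
  obtain ⟨d, rfl⟩ : ∃ d, j = n + 2 + d := ⟨j - (n + 2), by omega⟩
  have h3 : d < P * T.s.length := by simp only [base] at h2; omega
  have h4 : 0 < T.s.length := Nat.pos_of_ne_zero fun h => by simp [h] at h3
  refine ⟨d / T.s.length, (Nat.div_lt_iff_lt_mul h4).2 h3, d % T.s.length, Nat.mod_lt _ h4, ?_⟩
  have := Nat.div_add_mod' d T.s.length
  simp only [base]
  omega

theorem depth_le (hT : T.Valid) (n : ℕ) : (T.circuit n).depth ≤
    (1 + 2 * T.s.length + T.s'.length) * (Nat.log 2 n + 1) := by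
  set S := T.s.length with hS
  set k := Nat.log 2 n + 1 with hk
  have hK : (1 + 2 * S + T.s'.length) * k = k + 2 * (S * k) + T.s'.length * k := by ring
  have hk1 : S ≤ S * k := Nat.le_mul_of_pos_right _ (by omega)
  have hk2 : T.s'.length ≤ T.s'.length * k := Nat.le_mul_of_pos_right _ (by omega)
  have hnode : ∀ p < 2 * widthOf n - 1, ∀ i < S,
      (T.circuit n).depths.getD (T.base n p + i) 0 ≤ 1 + (S * k + S) := by
    intro p hp i hi
    refine (depths_node hT n le_rfl ?_ hi).trans (le_of_eq ?_)
    · simp; omega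
    · rw [← hk, ← hS]; ring
  have hlow : ∀ j < T.base n (2 * widthOf n - 1),
      (T.circuit n).depths.getD j 0 ≤ 1 + (S * k + S) := by
    intro j hj
    rcases Nat.lt_or_ge j (n + 2) with h | h
    · exact (depths_le_one n h).trans (by omega)
    · obtain ⟨p, hp, i, hi, rfl⟩ := exists_base _ h hj
      exact hnode p hp i hi
  refine Circuit.depth_le fun j hj => ?_
  rw [length_gates] at hj
  rcases Nat.lt_or_ge j (T.base n (2 * widthOf n - 1)) with h | h
  · exact (hlow j h).trans (by omega)
  · obtain ⟨i, rfl⟩ : ∃ i, j = T.base n (2 * widthOf n - 1) + i := ⟨_, (Nat.add_sub_cancel' h).symm⟩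
    have := hT.block'.depths_placed (C := T.circuit n) (fun r hr => port'_lt (n := n) hT hr)
      (fun i hi => gates_final hi) (d := 1 + (S * k + S))
      (fun r hr => hlow _ (port'_lt hT hr)) (r := T.q + T.w + i) (by omega)
    simp only [wire] at this
    rw [if_neg (by omega), Nat.add_sub_cancel_left] at this
    omega

theorem fanIn_le (hT : T.Valid) {n : ℕ} {g : Gate} (hg : g ∈ (T.circuit n).gates) :
    g.fanIn ≤ 2 := by
  have key : ∀ m port b s, IsBlock m s → g ∈ placed m port b s → g.fanIn ≤ 2 := by
    intro m port b s hs hg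
    obtain ⟨g', hg', rfl⟩ := List.mem_map.1 hg
    obtain ⟨i, hi, rfl⟩ := List.getElem_of_mem hg'
    rw [Gate.fanIn_rename]
    exact (hs i _ (List.getElem?_eq_getElem hi)).2.1
  simp only [circuit, List.mem_append, List.mem_map, List.mem_cons, List.not_mem_nil, or_false,
    List.mem_flatMap] at hg
  rcases hg with ⟨i, -, rfl⟩ | (rfl | rfl) | ⟨p, -, hg⟩ | hg
  · simp [Gate.fanIn]
  · simp [Gate.fanIn]
  · simp [Gate.fanIn]
  · exact key _ _ _ _ hT.block hg
  · exact key _ _ _ _ hT.block' hg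

theorem isNC1 (hT : T.Valid) : Family.IsNC1 T.circuit := by
  obtain ⟨c, hc⟩ := exists_pow_add_le (3 * (1 + 4 * T.s.length + T.s'.length) + T.w') 1
  refine ⟨c + (1 + 2 * T.s.length + T.s'.length), fun n => ⟨?_, ?_, fun g hg => fanIn_le hT hg⟩⟩
  · refine (Circuit.size_le fun g hg => fanIn_le hT hg).trans
      (le_trans ?_ ((hc n).trans (pow_add_le_pow_add (by omega) n)))
    have h1 : (T.circuit n).outputs.length = T.w' := by simp [circuit]
    have h2 : (2 * widthOf n - 1) * T.s.length ≤ (4 * (n + 2)) * T.s.length :=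
      Nat.mul_le_mul_right _ (by have := widthOf_le n; omega)
    rw [length_gates, h1, base, pow_one]
    nlinarith [Nat.zero_le (n * T.s'.length), Nat.zero_le (n * T.w')]
  · exact (depth_le hT n).trans (Nat.mul_le_mul_right _ (by omega))




section Semantics

variable {σ : Type} {enc : (σ → σ) → ℕ → Bool} {dec : List Bool → σ → σ}
  {letter : List Bool → σ → σ} {start : List Bool → σ} {out : σ → ℕ → Bool}

/-- The value of gate `i` on the input `x`. -/
def val (T : TreeData) (x : List Bool) (i : ℕ) : Bool :=
  ((T.circuit x.length).values x).getD i false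

/-- The bits that node `p` passes on. -/
def code (T : TreeData) (x : List Bool) (p : ℕ) : List Bool :=
  (List.range T.w).map fun j => T.val x (T.base x.length p + T.o j)

/-- Chunk `p` of the input, continued by ones. -/
def chunk (T : TreeData) (x : List Bool) (p : ℕ) : List Bool :=
  (List.range T.ℓ).map fun r => x.getD (T.q + T.ℓ * p + r) true

theorem val_min (x : List Bool) (i : ℕ) : T.val x (min i x.length) = x.getD i true := by
  rcases Nat.lt_or_ge i x.length with h | h
  · rw [min_eq_left h.le, val, Circuit.getD_values (gates_input h) (by simp [Gate.refs])]
    simp [Gate.value, h]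
  · rw [min_eq_right h, val, Circuit.getD_values (gates_true _) (by simp [Gate.refs])]
    simp [Gate.value, h]

theorem val_true (x : List Bool) : T.val x x.length = true := by
  rw [val, Circuit.getD_values (gates_true _) (by simp [Gate.refs])]
  simp [Gate.value]

theorem val_false (x : List Bool) : T.val x (x.length + 1) = false := by
  rw [val, Circuit.getD_values (gates_false _) (by simp [Gate.refs])]
  simp [Gate.value]

/-- The function that the blocks at the nodes compute: a leaf encodes the function of its chunk, an
inner node composes the functions encoded by its children. -/
def nodeFun (ℓ w : ℕ) (dec : List Bool → σ → σ) (letter : List Bool → σ → σ) (u : List Bool) :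
    σ → σ :=
  if u.getD (ℓ + w + w) false then letter ((List.range ℓ).map fun r => u.getD r false)
  else dec ((List.range w).map fun r => u.getD (ℓ + w + r) false) ∘
    dec ((List.range w).map fun r => u.getD (ℓ + r) false)

/-- The function that the final block computes. -/
def finalFun (q w : ℕ) (dec : List Bool → σ → σ) (start : List Bool → σ) (out : σ → ℕ → Bool)
    (u : List Bool) : ℕ → Bool :=
  out (dec ((List.range w).map fun r => u.getD (q + r) false)
    (start ((List.range q).map fun r => u.getD r false)))

/-- The blocks encode functions on `σ` and compute with them as intended. -/
structure Computes (T : TreeData) (enc : (σ → σ) → ℕ → Bool) (dec : List Bool → σ → σ)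
    (letter : List Bool → σ → σ) (start : List Bool → σ) (out : σ → ℕ → Bool) : Prop where
  valid : T.Valid
  dec_enc : ∀ F, dec ((List.range T.w).map (enc F)) = F
  node : ∀ u : List Bool, u.length = T.ports → ∀ j < T.w,
    (blockValues u T.s).getD (T.ports + T.o j) false = enc (nodeFun T.ℓ T.w dec letter u) j
  final : ∀ u : List Bool, u.length = T.q + T.w → ∀ j < T.w',
    (blockValues u T.s').getD (T.q + T.w + T.o' j) false = finalFun T.q T.w dec start out u j

theorem getD_map_range {f : ℕ → Bool} {m r : ℕ} (hr : r < m) :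
    ((List.range m).map f).getD r false = f r := by
  simp [List.getD_eq_getElem?_getD, hr]

theorem Computes.dec_code (h : Computes T enc dec letter start out) (x : List Bool) {p : ℕ}
    (hp : p < 2 * widthOf x.length - 1) :
    dec (T.code x p) = nodeFun T.ℓ T.w dec letter
      ((List.range T.ports).map fun r => T.val x (T.port x.length p r)) := by
  rw [← h.dec_enc (nodeFun T.ℓ T.w dec letter _), code]
  congr 1
  refine List.map_congr_left fun j hj => ?_
  have hj := List.mem_range.1 hj
  have ho := h.valid.o_lt j hj
  have := h.valid.block.values_placed (fun r hr => port_lt h.valid hp hr)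
    (fun i hi => gates_node hp hi) x (r := T.ports + T.o j) (by omega)
  rw [wire, if_neg (by omega), Nat.add_sub_cancel_left] at this
  rw [val, this]
  exact h.node _ (by simp) j hj

theorem Computes.dec_code_leaf (h : Computes T enc dec letter start out) (x : List Bool) {p : ℕ}
    (hp : p < widthOf x.length) : dec (T.code x p) = letter (T.chunk x p) := by
  have hs : T.port x.length p (T.ℓ + T.w + T.w) = x.length := by
    unfold port
    split_ifs <;> omega
  rw [h.dec_code x (by omega), nodeFun, getD_map_range (by simp [ports]), hs,
    if_pos (val_true x)]
  congr 1
  refine List.map_congr_left fun r hr => ?_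
  have hr := List.mem_range.1 hr
  rw [getD_map_range (by simp only [ports]; omega), port, if_pos hr, val_min]

theorem Computes.dec_code_inner (h : Computes T enc dec letter start out) (x : List Bool) {p : ℕ}
    (hp : widthOf x.length ≤ p) (hp' : p < 2 * widthOf x.length - 1) :
    dec (T.code x p) = dec (T.code x (2 * (p - widthOf x.length) + 1)) ∘
      dec (T.code x (2 * (p - widthOf x.length))) := by
  have hs : T.port x.length p (T.ℓ + T.w + T.w) = x.length + 1 := by
    unfold port
    split_ifs <;> omega
  rw [h.dec_code x hp', nodeFun, getD_map_range (by simp [ports]), hs,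
    if_neg (by simp [val_false])]
  congr 2
  · refine List.map_congr_left fun r hr => ?_
    have hr := List.mem_range.1 hr
    rw [getD_map_range (by simp only [ports]; omega), port, if_neg (by omega), if_neg (by omega),
      if_pos (by omega), if_pos hp, Nat.add_sub_cancel_left]
  · refine List.map_congr_left fun r hr => ?_
    have hr := List.mem_range.1 hr
    rw [getD_map_range (by simp only [ports]; omega), port, if_neg (by omega), if_pos (by omega),
      if_pos hp, Nat.add_sub_cancel_left]

/-- The node number `i` on level `t` encodes the effect of `2 ^ t` chunks. -/
theorem Computes.dec_code_level (h : Computes T enc dec letter start out) (x : List Bool) {t : ℕ}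
    (ht : t ≤ Nat.log 2 x.length + 1) {i : ℕ} (hi : i < 2 ^ (Nat.log 2 x.length + 1 - t)) :
    dec (T.code x (2 * widthOf x.length - 2 * 2 ^ (Nat.log 2 x.length + 1 - t) + i)) = fun a =>
      (List.range' (i * 2 ^ t) (2 ^ t)).foldl (fun a p => letter (T.chunk x p) a) a := by
  induction t generalizing i with
  | zero =>
    have : widthOf x.length = 2 ^ (Nat.log 2 x.length + 1) := rfl
    rw [Nat.sub_zero, ← this] at hi
    rw [Nat.sub_zero, ← this, Nat.sub_self, zero_add, h.dec_code_leaf x hi]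
    funext a
    simp
  | succ t ih =>
    obtain ⟨e, he⟩ : ∃ e, Nat.log 2 x.length + 1 - t = e + 1 := ⟨Nat.log 2 x.length - t, by omega⟩
    have hK : 2 * 2 ^ e ≤ widthOf x.length := by
      rw [widthOf, mul_comm, ← pow_succ]
      exact Nat.pow_le_pow_right (by omega) (by omega)
    have he' : Nat.log 2 x.length + 1 - (t + 1) = e := by omega
    rw [he'] at hi ⊢
    rw [he, pow_succ] at ih
    rw [h.dec_code_inner x (by omega) (by omega),
      show 2 * (2 * widthOf x.length - 2 * 2 ^ e + i - widthOf x.length) + 1 =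
        2 * widthOf x.length - 2 * (2 ^ e * 2) + (2 * i + 1) by omega,
      show 2 * (2 * widthOf x.length - 2 * 2 ^ e + i - widthOf x.length) =
        2 * widthOf x.length - 2 * (2 ^ e * 2) + 2 * i by omega,
      ih (by omega) (by omega), ih (by omega) (by omega)]
    funext a
    rw [Function.comp_apply, ← List.foldl_append]
    congr 1
    rw [show (2 * i + 1) * 2 ^ t = 2 * i * 2 ^ t + 2 ^ t by ring, pow_succ,
      show i * (2 ^ t * 2) = 2 * i * 2 ^ t by ring, show 2 ^ t * 2 = 2 ^ t + 2 ^ t by ring]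
    exact List.range'_append_1

theorem Computes.eval (h : Computes T enc dec letter start out)
    (hpad : letter (List.replicate T.ℓ true) = id) (hℓ : 0 < T.ℓ) {x : List Bool} (hx : x.length = T.q)
    {l : List (List Bool)} (hl : ∀ c ∈ l, c.length = T.ℓ) :
    Family.eval T.circuit (x ++ l.flatten) =
      (List.range T.w').map (out (l.foldl (fun a c => letter c a) (start x))) := by
  set y := x ++ l.flatten with hy
  have hlen : ∀ l : List (List Bool), (∀ c ∈ l, c.length = T.ℓ) →
      l.flatten.length = T.ℓ * l.length := by
    intro l
    induction l with
    | nil => simp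
    | cons c l ih =>
      intro hl
      rw [List.flatten_cons, List.length_append, ih fun c hc => hl c (List.mem_cons_of_mem _ hc),
        hl c List.mem_cons_self, List.length_cons]
      ring
  have hchunk : ∀ l : List (List Bool), (∀ c ∈ l, c.length = T.ℓ) → ∀ p,
      ((List.range T.ℓ).map fun r => l.flatten.getD (T.ℓ * p + r) true) =
        l.getD p (List.replicate T.ℓ true) := by
    intro l
    induction l with
    | nil =>
      intro _ p
      refine List.ext_getElem (by simp) fun i hi _ => ?_
      simp
    | cons c l ih =>
      intro hl p
      have hc : c.length = T.ℓ := hl c List.mem_cons_self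
      rcases p with _ | p
      · refine List.ext_getElem (by simp [hc]) fun i hi h2 => ?_
        have h2 : i < c.length := h2
        have h3 : i < c.length + l.flatten.length := by omega
        simp [List.getElem?_append_left h2, h2]
      · have := ih (fun c hc => hl c (List.mem_cons_of_mem _ hc)) p
        rw [List.getD_cons_succ, ← this]
        refine List.map_congr_left fun r _ => ?_
        rw [List.flatten_cons, List.getD_append_right _ _ _ _ (by rw [hc]; nlinarith)]
        congr 1
        rw [hc, Nat.mul_succ]
        omega
  have hch : ∀ p, T.chunk y p = l.getD p (List.replicate T.ℓ true) := by
    intro p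
    rw [← hchunk l hl p, chunk]
    refine List.map_congr_left fun r _ => ?_
    rw [hy, List.getD_append_right _ _ _ _ (by omega)]
    congr 1
    omega
  have hroot := h.dec_code_level y (t := Nat.log 2 y.length + 1) le_rfl (i := 0) (by simp)
  have hK : l.length ≤ widthOf y.length := by
    have h1 := lt_widthOf y.length
    have h2 : y.length = T.q + T.ℓ * l.length := by rw [hy, List.length_append, hx, hlen l hl]
    nlinarith
  have hfold : ∀ a, (List.range (widthOf y.length)).foldl (fun a p => letter (T.chunk y p) a) a =
      l.foldl (fun a c => letter c a) a := by
    intro a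
    obtain ⟨d, hd⟩ := Nat.exists_eq_add_of_le hK
    have h1 : ∀ d, ((List.range (l.length + d)).map fun p => l.getD p (List.replicate T.ℓ true)) =
        l ++ List.replicate d (List.replicate T.ℓ true) := by
      intro d
      induction d with
      | zero =>
        refine List.ext_getElem (by simp) fun i hi h2 => ?_
        have : i < l.length := by simpa using hi
        simp [this]
      | succ d ih =>
        rw [← add_assoc, List.range_succ, List.map_append, ih, List.replicate_succ',
          List.append_assoc]
        simp
    have h2 : ∀ d a, (List.replicate d (List.replicate T.ℓ true)).foldl
        (fun a c => letter c a) a = a := by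
      intro d
      induction d with
      | zero => simp
      | succ d ih => intro a; rw [List.replicate_succ, List.foldl_cons, hpad, id_eq, ih]
    have h3 : (List.range (widthOf y.length)).foldl (fun a p => letter (T.chunk y p) a) a =
        ((List.range (widthOf y.length)).map fun p => T.chunk y p).foldl
          (fun a c => letter c a) a := by rw [List.foldl_map]
    simp only [hch] at h3 ⊢
    rw [h3, hd, h1, List.foldl_append, h2]
  have hdec : dec (T.code y (2 * widthOf y.length - 2)) =
      fun a => l.foldl (fun a c => letter c a) a := by
    rw [Nat.sub_self, pow_zero, add_zero] at hroot
    rw [mul_one] at hroot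
    rw [hroot]
    funext a
    rw [← hfold a, zero_mul, List.range_eq_range']
    rfl
  simp only [Family.eval, Circuit.eval, circuit, List.map_map]
  refine List.map_congr_left fun j hj => ?_
  have hj := List.mem_range.1 hj
  have ho := h.valid.o'_lt j hj
  have h1 := h.valid.block'.values_placed (C := T.circuit y.length)
    (fun r hr => port'_lt h.valid hr)
    (fun i hi => gates_final hi) y (r := T.q + T.w + T.o' j) (by omega)
  rw [wire, if_neg (by omega), Nat.add_sub_cancel_left] at h1
  rw [Function.comp_apply]
  refine h1.trans ((h.final _ (by simp) j hj).trans ?_)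
  rw [finalFun]
  congr 1
  have e1 : ((List.range T.w).map fun r => ((List.range (T.q + T.w)).map fun r =>
      ((T.circuit y.length).values y).getD (T.port' y.length r) false).getD (T.q + r) false) =
      T.code y (2 * widthOf y.length - 2) := by
    refine List.map_congr_left fun r hr => ?_
    have hr := List.mem_range.1 hr
    rw [getD_map_range (by omega), port', if_neg (by omega), Nat.add_sub_cancel_left]
    rfl
  have e2 : ((List.range T.q).map fun r => ((List.range (T.q + T.w)).map fun r =>
      ((T.circuit y.length).values y).getD (T.port' y.length r) false).getD r false) = x := by
    refine List.ext_getElem (by simp [hx]) fun r hr h2 => ?_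
    have hr : r < T.q := by simpa using hr
    rw [List.getElem_map, List.getElem_range, getD_map_range (by omega), port', if_pos hr]
    have := val_min (T := T) y r
    rw [val] at this
    rw [this, hy, List.getD_append _ _ _ _ h2, List.getD_eq_getElem _ _ h2]
  rw [e1, e2, hdec]

end Semantics

section Uniformity

theorem _root_.CircuitComplexity.Prints.rename {α : Type} {D : Set α} {n : α → ℕ}
    {X : List (α → ℕ)} {g : Gate} (hg : ∀ k, g ≠ .input k) {ρ : α → ℕ → ℕ}
    (h : ∀ j ∈ g.refs, LS D n X fun a => ρ a j) :
    Prints D n X fun a => (g.rename (ρ a)).describe := by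
  cases g with
  | input k => exact absurd rfl (hg k)
  | neg j => exact .cons _ (.unary (h j (by simp [Gate.refs])))
  | conj js =>
    exact .congr (.cons Sym.conj (.flatMap_list js fun j hj => .unary (h j hj)))
      fun a _ => by simp [Gate.rename, Gate.describe, List.flatMap_map]
  | disj js =>
    exact .congr (.cons Sym.disj (.flatMap_list js fun j hj => .unary (h j hj)))
      fun a _ => by simp [Gate.rename, Gate.describe, List.flatMap_map]

theorem _root_.CircuitComplexity.IsBlock.prints {α : Type} {D : Set α} {n : α → ℕ}
    {X : List (α → ℕ)} {m : ℕ} {s : List Gate} (hs : IsBlock m s) {port : α → ℕ → ℕ} {b : α → ℕ}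
    (hp : ∀ r < m, LS D n X fun a => port a r) (hb : LS D n X b) :
    Prints D n X fun a => (placed m (port a) (b a) s).flatMap Gate.describe := by
  have : Prints D n X fun a => s.flatMap fun g => (g.rename (wire m (port a) (b a))).describe := by
    refine .flatMap_list s fun g hg => ?_
    obtain ⟨i, hi, rfl⟩ := List.getElem_of_mem hg
    obtain ⟨h1, -, h3⟩ := hs i _ (List.getElem?_eq_getElem hi)
    refine .rename h3 fun j _ => ?_
    unfold wire
    split_ifs with h
    · exact hp j h
    · exact hb.add (.const _)
  exact this.congr fun a _ => by simp [placed, List.flatMap_map]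

section

variable {α : Type} {D : Set α} {n : α → ℕ} {X : List (α → ℕ)} {m p : α → ℕ}

theorem ls_base (hm : LS D n X m) (hp : LS D n X p) : LS D n X fun a => T.base (m a) (p a) :=
  (hm.add (.const 2)).add (hp.mul (.const _))

theorem ls_port (hm : LS D n X m) (hp : LS D n X p) (r : ℕ) :
    LS D n X fun a => T.port (m a) (p a) r := by
  have hc := (LS.const (D := D) (n := n) (X := X) 2).mul (hp.sub hm.widthOf)
  unfold port
  split_ifs
  · exact (((LS.const T.q).add ((LS.const T.ℓ).mul hp)).add (.const r)).min hm
  · exact .ite_le hm.widthOf hp (((ls_base hm hc).add (.const _)).mono_dom Set.inter_subset_left)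
      (hm.mono_dom Set.inter_subset_left)
  · exact .ite_le hm.widthOf hp (((ls_base hm hc.succ).add (.const _)).mono_dom
      Set.inter_subset_left) (hm.mono_dom Set.inter_subset_left)
  · exact .ite_le hm.widthOf hp (hm.succ.mono_dom Set.inter_subset_left)
      (hm.mono_dom Set.inter_subset_left)

end

theorem lUniform (hT : T.Valid) : LUniform T.circuit := by
  refine LUniform.of_prints ?_
  have hn : LS Set.univ id [id] (id : ℕ → ℕ) := .var (by simp) (.size _ _)
  have hc : LS Set.univ id [id] fun n : ℕ => 2 * widthOf n - 1 := ((LS.const 2).mul hn.widthOf).pred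
  have h1 : Prints Set.univ id [id] fun n : ℕ => (List.range n).flatMap fun i =>
      Sym.input :: unary i :=
    .loop (o := fun p => Sym.input :: unary p.2) hn fun Y _ h2 => .cons _ (.unary h2)
  have h2 : Prints Set.univ id [id] fun n : ℕ => (List.range (2 * widthOf n - 1)).flatMap fun p =>
      (placed T.ports (T.port n p) (T.base n p) T.s).flatMap Gate.describe :=
    .loop (o := fun p : ℕ × ℕ =>
        (placed T.ports (T.port p.1 p.2) (T.base p.1 p.2) T.s).flatMap Gate.describe) hc
      fun Y h1 h2 => hT.block.prints (fun r _ => ls_port (h1 _ hn) h2 r) (ls_base (h1 _ hn) h2)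
  have h3 : Prints Set.univ id [id] fun n : ℕ => (placed (T.q + T.w) (T.port' n)
      (T.base n (2 * widthOf n - 1)) T.s').flatMap Gate.describe := by
    refine hT.block'.prints (fun r _ => ?_) (ls_base hn hc)
    unfold port'
    split_ifs
    · exact (LS.const r).min hn
    · exact (ls_base hn (((LS.const 2).mul hn.widthOf).sub (.const 2))).add (.const _)
  have h4 : Prints Set.univ id [id] fun n : ℕ => (List.range T.w').flatMap fun j =>
      unary (T.base n (2 * widthOf n - 1) + T.o' j) :=
    .flatMap_list _ fun j _ => .unary ((ls_base hn hc).add (.const _))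
  refine (h1.append ((Prints.cons .conj (.cons .disj .nil)).append
    (h2.append (h3.append (.cons .output h4))))).congr fun n _ => ?_
  simp [Circuit.describe, circuit, List.flatMap_map, Gate.describe, List.flatMap_assoc]

end Uniformity

/-- A deterministic finite automaton that reads its input in chunks of `ℓ` bits, starting in a state
that depends on the first `q` bits, can be simulated by uniform `NC¹` circuits: the composition of
functions on a finite set is associative, and so the effect of all chunks is found by a tree of
blocks of constant size. The circuits may see the input followed by ones, and so a chunk of ones must
have no effect. -/
theorem exists_nc1_of_automaton {σ : Type} [Finite σ] [Nonempty σ] (q ℓ w' : ℕ) (hℓ : 0 < ℓ)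
    (start : List Bool → σ) (letter : List Bool → σ → σ) (out : σ → ℕ → Bool)
    (hpad : letter (List.replicate ℓ true) = id) :
    ∃ C : Family, C.IsNC1 ∧ LUniform C ∧ ∀ (x : List Bool) (l : List (List Bool)), x.length = q →
      (∀ c ∈ l, c.length = ℓ) → C.eval (x ++ l.flatten) =
        (List.range w').map (out (l.foldl (fun a c => letter c a) (start x))) := by
  -- A function on `σ` is encoded by marking its number in a list of all functions.
  obtain ⟨w, ⟨e⟩⟩ := Finite.exists_equiv_fin (σ → σ)
  set enc : (σ → σ) → ℕ → Bool := fun F j => decide ((e F : ℕ) = j) with henc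
  have hinj : Function.Injective fun F => (List.range w).map (enc F) := by
    intro F G h
    have h1 := congrArg (fun l => l.getD (e F : ℕ) false) h
    simp only [getD_map_range (e F).2, henc, decide_true] at h1
    exact e.injective (Fin.ext (of_decide_eq_true h1.symm).symm)
  set dec := Function.invFun fun F => (List.range w).map (enc F) with hdec
  obtain ⟨s, o, h1, h2, h3⟩ := exists_block (ℓ + w + w + 1) w fun u => enc (nodeFun ℓ w dec letter u)
  obtain ⟨s', o', h1', h2', h3'⟩ := exists_block (q + w) w' fun u => finalFun q w dec start out u
  set T : TreeData := ⟨q, ℓ, w, w', s, s', o, o'⟩ with hT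
  have hv : T.Valid := ⟨h1, h1', h2, h2'⟩
  have hc : T.Computes enc dec letter start out :=
    ⟨hv, Function.leftInverse_invFun hinj, h3, h3'⟩
  exact ⟨T.circuit, isNC1 hv, lUniform hv, fun x l hx hl => hc.eval hpad hℓ hx hl⟩

end TreeData

end CircuitComplexity

/-! ### Chess state tracking by a finite automaton -/

namespace Chess

instance : Finite Position :=
  Finite.of_injective (fun P : Position => (P.board, P.turn, P.castling, P.enPassant)) (by
    rintro ⟨b, t, c, e⟩ ⟨b', t', c', e'⟩ h
    cases h
    rfl)

theorem length_stateBits (o : Option Position) : (stateBits o).length = 266 := by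
  cases o
  · exact List.length_replicate
  · rw [stateBits, List.length_cons, length_positionBits]

theorem track_eq_foldl (P : Position) (ms : List Move) :
    track P ms = ms.foldl (fun o m => o.bind (play · m)) (some P) := by
  have h : ∀ (l : List Move) (o : Option Position),
      (o.bind fun P => l.foldlM play P) = l.foldl (fun o m => o.bind (play · m)) o := by
    intro l
    induction l with
    | nil => intro o; cases o <;> rfl
    | cons m l ih =>
      intro o
      rw [List.foldl_cons, ← ih]
      cases o <;> rfl
  exact h ms (some P)

theorem track_append (P : Position) (l l' : List Move) :
    track P (l ++ l') = (track P l).bind fun Q => track Q l' := List.foldlM_append ..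

/-- The position with a given bit string, if any. -/
noncomputable def decodePosition : List Bool → Option Position := Function.partialInv Position.bits

/-- The effect on states of the move with a given bit string; bit strings of other forms have no
effect. -/
noncomputable def decodeMove (u : List Bool) (o : Option Position) : Option Position :=
  match Function.partialInv Move.bits u with
  | none => o
  | some m => o.bind (play · m)

theorem moveBits_ne_ones (m : Move) : m.bits ≠ List.replicate 15 true := by
  obtain ⟨s, t, p⟩ := m
  intro h
  have h1 : Move.bits ⟨s, t, p⟩ = List.replicate 12 true ++ List.replicate 3 true := h
  have h2 : kindBits p = List.replicate 3 true := (List.append_inj h1 (by simp)).2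
  clear h h1
  revert p
  decide

theorem decodeMove_ones : decodeMove (List.replicate 15 true) = id := by
  funext o
  have h : Function.partialInv Move.bits (List.replicate 15 true) = none := by
    rw [Option.eq_none_iff_forall_not_mem]
    intro m hm
    exact moveBits_ne_ones m ((moveBits_injective.isPartialInv m _).1 hm)
  rw [decodeMove, h]
  rfl

theorem decodeMove_bits (m : Move) (o : Option Position) :
    decodeMove m.bits o = o.bind (play · m) := by
  simp [decodeMove, Function.partialInv_left moveBits_injective]

/-- Chess state tracking is in uniform `NC¹`, since there are finitely many positions. -/
theorem exists_nc1_stateTracking : ∃ C : CircuitComplexity.Family, C.IsNC1 ∧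
    CircuitComplexity.LUniform C ∧
    ∀ x : Position × List Move, C.eval (instanceBits x) = stateBits (track x.1 x.2) := by
  obtain ⟨C, h1, h2, h3⟩ := CircuitComplexity.TreeData.exists_nc1_of_automaton 265 15 266
    (by omega) decodePosition decodeMove (fun o j => (stateBits o).getD j false) decodeMove_ones
  refine ⟨C, h1, h2, ?_⟩
  rintro ⟨P, ms⟩
  have h4 := h3 P.bits (ms.map Move.bits) (length_positionBits P) (by simp)
  rw [instanceBits, List.flatMap_def, h4, track_eq_foldl, List.foldl_map]
  simp only [decodeMove_bits, decodePosition]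
  rw [Function.partialInv_left positionBits_injective]
  refine List.ext_getElem (by simp [length_stateBits]) fun i hi h => ?_
  simp [h]

/-! ### Reversible computation on the chessboard -/

/-- A rook or queen of colour `t` can go to an empty adjacent square of its rank or file. -/
def SimpleStep (b : Board) (t : Colour) (m : Move) (k : Kind) : Prop :=
  b m.source = some ⟨t, k⟩ ∧ (k = .rook ∨ k = .queen) ∧ b m.target = none ∧ m.promotion = none ∧
    (dx m.source m.target = 0 ∧ |dy m.source m.target| = 1 ∨
      dy m.source m.target = 0 ∧ |dx m.source m.target| = 1)

instance (b : Board) (t : Colour) (m : Move) (k : Kind) : Decidable (SimpleStep b t m k) := by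
  unfold SimpleStep; infer_instance

/-- The board after a piece has been moved. -/
def movePiece (b : Board) (m : Move) : Board :=
  Function.update (Function.update b m.source none) m.target (b m.source)

/-- There are no kings on the board, so that no move can be illegal because of a check. -/
def NoKings (b : Board) : Prop := ∀ s c, b s ≠ some ⟨c, .king⟩

theorem NoKings.movePiece {b : Board} (hb : NoKings b) (m : Move) : NoKings (movePiece b m) := by
  intro s c
  simp only [Chess.movePiece, Function.update_apply]
  split_ifs
  · exact hb _ c
  · simp
  · exact hb s c

theorem clear_of_adjacent (b : Board) {s t : Square}
    (h : dx s t = 0 ∧ |dy s t| = 1 ∨ dy s t = 0 ∧ |dx s t| = 1) : Clear b s t := by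
  obtain ⟨⟨f, hf⟩, ⟨r, hr⟩⟩ := s
  obtain ⟨⟨f', hf'⟩, ⟨r', hr'⟩⟩ := t
  rintro ⟨⟨f'', hf''⟩, ⟨r'', hr''⟩⟩ ⟨h1, h2, -, h4, h5, h6, h7⟩
  simp only [dx, dy, ne_eq, Square.mk.injEq, Fin.mk.injEq, min_le_iff, le_max_iff, Fin.mk_le_mk,
    abs_eq (zero_le_one' ℤ)] at *
  omega

/-- Without kings and castling rights, a simple step is legal and just moves the piece. -/
theorem play_of_simpleStep {b : Board} (hb : NoKings b) {t : Colour} {m : Move} {k : Kind}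
    (h : SimpleStep b t m k) : play ⟨b, t, fun _ _ => false, none⟩ m =
      some ⟨movePiece b m, t.other, fun _ _ => false, none⟩ := by
  obtain ⟨h1, h2, h3, h4, h5⟩ := h
  have hk : k ≠ .pawn := by rintro rfl; simp at h2
  have hk' : k ≠ .king := by rintro rfl; simp at h2
  have hne : m.source ≠ m.target := by
    intro e
    rw [e, h3] at h1
    cases h1
  have hboard : boardAfter ⟨b, t, fun _ _ => false, none⟩ m = movePiece b m := by
    simp [boardAfter, IsEnPassant, IsCastling, h1, h4, hk', movePiece]
  have hline : SameLine m.source m.target := h5.imp And.left And.left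
  have hclear := clear_of_adjacent b h5
  have hlegal : Legal ⟨b, t, fun _ _ => false, none⟩ m := by
    refine ⟨⟨⟨t, k⟩, h1, rfl, Or.inr (Or.inl ⟨hk, h4, ⟨hne, ?_⟩, Or.inl h3⟩)⟩, ?_⟩
    · rcases h2 with rfl | rfl
      · exact ⟨hline, hclear⟩
      · exact ⟨Or.inl hline, hclear⟩
    · rw [hboard]
      rintro ⟨s, hs, -⟩
      exact hb.movePiece m s _ hs
  rw [play, if_pos hlegal, positionAfter, hboard]
  simp [h1, hk]

/-- The board after a sequence of simple steps, if they are possible. -/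
def simpleTrack : Board → Colour → List Move → Option Board
  | b, _, [] => some b
  | b, t, m :: ms =>
    if SimpleStep b t m .rook ∨ SimpleStep b t m .queen then simpleTrack (movePiece b m) t.other ms
    else none

theorem track_of_simpleTrack {b b' : Board} (hb : NoKings b) {ms : List Move} :
    ∀ {t : Colour}, Even ms.length → simpleTrack b t ms = some b' →
      track ⟨b, t, fun _ _ => false, none⟩ ms = some ⟨b', t, fun _ _ => false, none⟩ := by
  have key : ∀ (ms : List Move) (b : Board) (t : Colour), NoKings b → simpleTrack b t ms = some b' →
      track ⟨b, t, fun _ _ => false, none⟩ ms =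
        some ⟨b', if Even ms.length then t else t.other, fun _ _ => false, none⟩ := by
    intro ms
    induction ms with
    | nil =>
      intro b t _ h
      obtain rfl : b = b' := by simpa [simpleTrack] using h
      simp [track]
    | cons m ms ih =>
      intro b t hb h
      rw [simpleTrack] at h
      split at h
      · rename_i hs
        obtain ⟨k, hs⟩ : ∃ k, SimpleStep b t m k := hs.elim (fun h => ⟨_, h⟩) fun h => ⟨_, h⟩
        have := ih _ _ (hb.movePiece m) h
        rw [track, List.foldlM_cons, play_of_simpleStep hb hs]
        refine Eq.trans this ?_
        cases t <;> by_cases he : Even ms.length <;> simp [he, Nat.even_add_one, Colour.other]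
      · cases h
  intro t he h
  rw [key ms b t hb h, if_pos he]

/-- White rooks on all squares of the first rank except that there is a queen on file `v`, and a
black rook in the corner. The number `v` is the contents of the memory. -/
def markerBoard (v : ℕ) : Board := fun s =>
  if s.rank = 0 then some ⟨.white, if (s.file : ℕ) = v then .queen else .rook⟩
  else if s.rank = 7 ∧ s.file = 0 then some ⟨.black, .rook⟩ else none

/-- The position with the memory contents `v` and White to move. -/
def markerPosition (v : ℕ) : Position := ⟨markerBoard v, .white, fun _ _ => false, none⟩

theorem noKings_markerBoard (v : ℕ) : NoKings (markerBoard v) := by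
  intro s c
  unfold markerBoard
  split_ifs <;> simp

/-- Black waits by moving the rook from the corner and back. -/
def withWaiting (m₁ m₂ m₃ m₄ : Move) : List Move :=
  [m₁, ⟨⟨0, 7⟩, ⟨1, 7⟩, none⟩, m₂, ⟨⟨1, 7⟩, ⟨0, 7⟩, none⟩,
    m₃, ⟨⟨0, 7⟩, ⟨1, 7⟩, none⟩, m₄, ⟨⟨1, 7⟩, ⟨0, 7⟩, none⟩]

/-- White exchanges the pieces on the files `f` and `f + 1` of the first rank, using the second
rank. -/
def swapMoves (f : ℕ) : List Move :=
  let s (f : ℕ) (r : Fin 8) : Square := ⟨Fin.ofNat 8 f, r⟩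
  withWaiting ⟨s f 0, s f 1, none⟩ ⟨s (f + 1) 0, s f 0, none⟩ ⟨s f 1, s (f + 1) 1, none⟩
    ⟨s (f + 1) 1, s (f + 1) 0, none⟩

/-- White moves a rook forth and back twice. -/
def idleMoves : List Move :=
  withWaiting ⟨⟨0, 0⟩, ⟨0, 1⟩, none⟩ ⟨⟨0, 1⟩, ⟨0, 0⟩, none⟩ ⟨⟨0, 0⟩, ⟨0, 1⟩, none⟩
    ⟨⟨0, 1⟩, ⟨0, 0⟩, none⟩

/-- The effect on `v` of an exchange of `f` and `f + 1`. -/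
def adjacentSwap (f v : ℕ) : ℕ := if v = f then f + 1 else if v = f + 1 then f else v

theorem simpleTrack_swapMoves : ∀ f < 7, ∀ v < 8,
    simpleTrack (markerBoard v) .white (swapMoves f) = some (markerBoard (adjacentSwap f v)) := by
  decide +kernel

theorem simpleTrack_idleMoves : ∀ v < 8,
    simpleTrack (markerBoard v) .white idleMoves = some (markerBoard v) := by
  decide +kernel

theorem track_swapMoves {f v : ℕ} (hf : f < 7) (hv : v < 8) :
    track (markerPosition v) (swapMoves f) = some (markerPosition (adjacentSwap f v)) :=
  track_of_simpleTrack (noKings_markerBoard v) ⟨4, rfl⟩ (simpleTrack_swapMoves f hf v hv)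

theorem track_idleMoves {v : ℕ} (hv : v < 8) :
    track (markerPosition v) idleMoves = some (markerPosition v) :=
  track_of_simpleTrack (noKings_markerBoard v) (by decide) (simpleTrack_idleMoves v hv)

/-- The instruction that adds bit `a` of the memory to bit `b`. -/
def cnot (a b v : ℕ) : ℕ := if v.testBit a then v ^^^ 2 ^ b else v

/-- Exchanges of neighbours whose composition is the transposition of `x` and `x + d`. -/
def transpositionWord (x d : ℕ) : List ℕ :=
  (List.range d).map (x + ·) ++ ((List.range (d - 1)).map (x + ·)).reverse

/-- Exchanges of neighbours whose composition is `cnot a b`. -/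
def cnotWord (a b : ℕ) : List ℕ :=
  ((List.range 8).filter fun v => v.testBit a && !v.testBit b).flatMap fun v =>
    transpositionWord v (2 ^ b)

/-- The moves for `cnot a b`, executed if `c` is true; in either case there are 112 moves. -/
def cnotMoves (a b : ℕ) (c : Bool) : List Move :=
  if c then (cnotWord a b).flatMap swapMoves ++
    (List.replicate (14 - (cnotWord a b).length) idleMoves).flatten
  else (List.replicate 14 idleMoves).flatten

theorem cnotWord_spec : ∀ a < 3, ∀ b < 3, a ≠ b → (cnotWord a b).length ≤ 14 ∧
    (∀ f ∈ cnotWord a b, f < 7) ∧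
    ∀ v < 8, (cnotWord a b).foldl (fun v f => adjacentSwap f v) v = cnot a b v := by
  decide +kernel

theorem cnot_lt : ∀ a < 3, ∀ b < 3, ∀ v < 8, cnot a b v < 8 := by decide +kernel

theorem length_cnotMoves {a b : ℕ} (ha : a < 3) (hb : b < 3) (hab : a ≠ b) (c : Bool) :
    (cnotMoves a b c).length = 112 := by
  have h := (cnotWord_spec a ha b hb hab).1
  have h1 : ∀ f, (swapMoves f).length = 8 := fun f => rfl
  have h2 : idleMoves.length = 8 := rfl
  unfold cnotMoves
  split <;> simp [List.length_flatMap, List.length_flatten, h1, h2]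
  omega

theorem track_idle_flatten {v : ℕ} (hv : v < 8) (m : ℕ) :
    track (markerPosition v) (List.replicate m idleMoves).flatten = some (markerPosition v) := by
  induction m with
  | zero => rfl
  | succ m ih =>
    rw [List.replicate_succ, List.flatten_cons, track_append, track_idleMoves hv]
    exact ih

theorem track_swaps {l : List ℕ} (hl : ∀ f ∈ l, f < 7) {v : ℕ} (hv : v < 8) :
    track (markerPosition v) (l.flatMap swapMoves) =
      some (markerPosition (l.foldl (fun v f => adjacentSwap f v) v)) := by
  induction l generalizing v with
  | nil => rfl
  | cons f l ih =>
    have hf := hl f List.mem_cons_self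
    rw [List.flatMap_cons, track_append, track_swapMoves hf hv, List.foldl_cons]
    refine ih (fun f hf => hl f (List.mem_cons_of_mem _ hf)) ?_
    unfold adjacentSwap
    split_ifs <;> omega

theorem track_cnotMoves {a b v : ℕ} (ha : a < 3) (hb : b < 3) (hab : a ≠ b) (hv : v < 8)
    (c : Bool) : track (markerPosition v) (cnotMoves a b c) =
      some (markerPosition (if c then cnot a b v else v)) := by
  obtain ⟨-, h1, h2⟩ := cnotWord_spec a ha b hb hab
  cases c
  · simpa [cnotMoves] using track_idle_flatten hv 14
  · simp only [cnotMoves, if_true]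
    rw [track_append, track_swaps h1 hv, h2 v hv]
    exact track_idle_flatten (cnot_lt a ha b hb v hv) _

/-- Bit `1` of the memory, if bits `0` and `2` are `1` and `0`, is seen in the final state. -/
theorem stateBits_markerPosition :
    (stateBits (some (markerPosition 1))).getD 14 false = false ∧
    (stateBits (some (markerPosition 3))).getD 14 false = true := by
  decide +kernel

end Chess

namespace CircuitComplexity

/-! ### Reversible programs for circuits of logarithmic depth -/

open Chess (cnot cnot_lt)

section Lookup

variable {C : Circuit} {x : List Bool} {j : ℕ}

/-- The value of gate `j`; false if there is no such gate. -/
def Circuit.gateValue (C : Circuit) (x : List Bool) (j : ℕ) : Bool := (C.values x).getD j false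

theorem Circuit.getD_take_values (u : ℕ) : ((C.values x).take j).getD u false =
    if u < j then C.gateValue x u else false := by
  split
  · rename_i h
    rw [List.getD_eq_getElem?_getD, List.getElem?_take_of_lt h, gateValue,
      List.getD_eq_getElem?_getD]
  · rename_i h
    rw [List.getD_eq_default]
    rw [List.length_take]
    omega

theorem Circuit.gateValue_eq {g : Gate} (hg : C.gates[j]? = some g) :
    C.gateValue x j = g.value x ((C.values x).take j) := by
  have := getD_extend_take (fun v g => g.value x v) false (v := []) hg
  rwa [List.length_nil, zero_add] at this

theorem Circuit.gateValue_of_none (hg : C.gates[j]? = none) : C.gateValue x j = false := by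
  rw [gateValue, List.getD_eq_default]
  rw [length_values]
  exact List.getElem?_eq_none_iff.1 hg

theorem Circuit.depth_ref {g : Gate} (hg : C.gates[j]? = some g) {u : ℕ} (hu : u ∈ g.refs)
    (huj : u < j) : C.depths.getD u 0 < C.depths.getD j 0 := by
  have h := getD_extend_take (fun d g => g.depth d) 0 (v := []) hg
  rw [List.length_nil, zero_add] at h
  have h1 : C.depths.getD u 0 = (C.depths.take j).getD u 0 := by
    rw [List.getD_eq_getElem?_getD, List.getD_eq_getElem?_getD, List.getElem?_take_of_lt huj]
  have h2 : C.depths.getD j 0 = g.depth (C.depths.take j) := h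
  have h3 : ∀ js : List ℕ, u ∈ js →
      (C.depths.take j).getD u 0 ≤ (js.map fun i => (C.depths.take j).getD i 0).foldr max 0 :=
    fun js hu => foldr_max_le.1 le_rfl _ (List.mem_map.2 ⟨u, hu, rfl⟩)
  rw [h1, h2]
  cases g with
  | input i => simp [Gate.refs] at hu
  | neg i =>
    obtain rfl : u = i := by simpa [Gate.refs] using hu
    exact Nat.lt_succ_self _
  | conj js => exact Nat.lt_succ_of_le (h3 js hu)
  | disj js => exact Nat.lt_succ_of_le (h3 js hu)

theorem Circuit.depth_pos {g : Gate} (hg : C.gates[j]? = some g) (hi : ∀ k, g ≠ .input k) :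
    0 < C.depths.getD j 0 := by
  have h := getD_extend_take (fun d g => g.depth d) 0 (v := []) hg
  rw [List.length_nil, zero_add] at h
  have h2 : C.depths.getD j 0 = g.depth (C.depths.take j) := h
  rw [h2]
  cases g with
  | input i => exact absurd rfl (hi i)
  | neg i => exact Nat.succ_pos _
  | conj js => exact Nat.succ_pos _
  | disj js => exact Nat.succ_pos _

theorem Circuit.depths_le_depth (j : ℕ) : C.depths.getD j 0 ≤ C.depth := by
  rcases Nat.lt_or_ge j C.depths.length with h | h
  · rw [List.getD_eq_getElem _ _ h]
    exact foldr_max_le.1 le_rfl _ (List.getElem_mem h)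
  · rw [List.getD_eq_default _ _ h]
    exact Nat.zero_le _

/-- The symbol with which the description of a gate begins. -/
def Gate.symbol : Gate → Sym
  | .input _ => .input
  | .neg _ => .neg
  | .conj _ => .conj
  | .disj _ => .disj

/-- The numbers in the description of a gate. -/
def Gate.args : Gate → List ℕ
  | .input i => [i]
  | .neg j => [j]
  | .conj js => js
  | .disj js => js

theorem Circuit.items_of_gates {g : Gate} (hg : C.gates[j]? = some g) : C.items[j]? =
    some (g.symbol, g.args) := by
  have h := (List.getElem?_eq_some_iff.1 hg).1
  rw [items, List.getElem?_append_left (by simpa using h), List.getElem?_map, hg]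
  cases g <;> rfl

theorem Circuit.kindAt_of_none (hg : C.gates[j]? = none) : C.kindAt j = 0 ∨ C.kindAt j = 5 := by
  have h := List.getElem?_eq_none_iff.1 hg
  rw [kindAt, items, List.getElem?_append_right (by simpa using h)]
  rw [List.length_map]
  rcases Nat.eq_zero_or_pos (j - C.gates.length) with h0 | h0
  · rw [h0]; right; rfl
  · rw [List.getElem?_eq_none (by rw [List.length_singleton]; exact h0)]; left; rfl

end Lookup

/-- A procedure call in a reversible program. In mode `2` it asks to add bit `src` of the memory to
bit `dst` if gate `gate` of a circuit is true, in mode `1` to add it in any case, and in other modes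
to do nothing. -/
structure Call where
  mode : ℕ
  gate : ℕ
  src : ℕ
  dst : ℕ

/-- How one of the eight calls into which a call is expanded comes from it: do nothing; repeat the
call; make it unconditional; refer to the first or to the second argument of the gate; refer to the
first argument, with the third bit of the memory as the destination; refer to the second argument,
with the third bit as the source. -/
inductive Expansion where
  | void | stay | one | first | second | toThird | fromThird
  deriving DecidableEq

instance : Fintype Expansion :=
  ⟨{.void, .stay, .one, .first, .second, .toThird, .fromThird}, by intro e; cases e <;> decide⟩

/-- The expansion of a conditional instruction. With `a`, `b`, `k` the source, the destination and
the third bit, a conjunction of `f` and `g` becomes: add `a` to `k` if `f`, add `k` to `b` if `g`,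
and both once more; a disjunction is the sum of the conjunction and both arguments. -/
def expansion : ℕ → ℕ → ℕ → Expansion
  | 1, _, 0 => .stay
  | 2, _, 0 => .first
  | 2, _, 1 => .one
  | 3, 0, 0 => .one
  | 3, 1, 0 => .first
  | 3, 2, 0 => .toThird
  | 3, 2, 1 => .fromThird
  | 3, 2, 2 => .toThird
  | 3, 2, 3 => .fromThird
  | 4, 1, 0 => .first
  | 4, 2, 0 => .toThird
  | 4, 2, 1 => .fromThird
  | 4, 2, 2 => .toThird
  | 4, 2, 3 => .fromThird
  | 4, 2, 4 => .first
  | 4, 2, 5 => .second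
  | _, _, _ => .void

theorem of_expansion_eq {K N δ : ℕ} {e : Expansion} (h : expansion K N δ = e) :
    (e = .stay → K = 1) ∧ (e = .first ∨ e = .toThird → K = 2 ∨ (K = 3 ∨ K = 4) ∧ 1 ≤ N) ∧
      (e = .second ∨ e = .fromThird → (K = 3 ∨ K = 4) ∧ N = 2) := by
  unfold expansion at h
  split at h <;> subst h <;> simp

namespace Call

/-- The call that refers to gate `u`. A dangling reference makes the call void. -/
def refer (s : Call) (u src dst : ℕ) : Call :=
  ⟨if s.gate ≤ u then 0 else 2, min u s.gate, src, dst⟩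

/-- The call that comes from `s` in a given way. -/
def apply (C : Circuit) (s : Call) : Expansion → Call
  | .void => { s with mode := 0 }
  | .stay => s
  | .one => { s with mode := 1 }
  | .first => s.refer (C.arg0At s.gate) s.src s.dst
  | .second => s.refer (C.arg1At s.gate) s.src s.dst
  | .toThird => s.refer (C.arg0At s.gate) s.src (3 - (s.src + s.dst))
  | .fromThird => s.refer (C.arg1At s.gate) (3 - (s.src + s.dst)) s.dst

/-- The expansion that leads from a call to call number `δ` in its place. -/
def expansionAt (C : Circuit) (s : Call) (δ : ℕ) : Expansion :=
  if s.mode = 2 then expansion (C.kindAt s.gate) (min (C.nargsAt s.gate) 3) δ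
  else if δ = 0 then .stay else .void

/-- Call number `δ` of the eight calls that replace a call. -/
def next (C : Circuit) (s : Call) (δ : ℕ) : Call := s.apply C (s.expansionAt C δ)

/-- Whether the instruction is executed. -/
def control (C : Circuit) (x : List Bool) (s : Call) : Bool :=
  s.mode == 1 || (s.mode == 2 && C.gateValue x s.gate)

/-- The effect on the memory. -/
def effect (C : Circuit) (x : List Bool) (s : Call) (v : ℕ) : ℕ :=
  if s.control C x then cnot s.src s.dst v else v

/-- Source and destination are different bits. -/
def Good (s : Call) : Prop := s.src < 3 ∧ s.dst < 3 ∧ s.src ≠ s.dst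

theorem Good.next {C : Circuit} {s : Call} (hs : s.Good) (δ : ℕ) : (s.next C δ).Good := by
  obtain ⟨h1, h2, h3⟩ := hs
  unfold Call.next
  cases expansionAt C s δ <;> simp only [apply, refer, Good] <;> omega

theorem Good.effect_lt {s : Call} (hs : s.Good) (C : Circuit) (x : List Bool) {v : ℕ} (hv : v < 8) :
    s.effect C x v < 8 := by
  unfold effect
  split
  · exact cnot_lt _ hs.1 _ hs.2.1 v hv
  · exact hv

/-- The memory after an instruction that is executed if `c` is true. -/
def condCnot (c : Bool) (a b v : ℕ) : ℕ := if c then cnot a b v else v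

theorem condCnot_conj : ∀ a < 3, ∀ b < 3, a ≠ b → ∀ v < 8, ∀ f g : Bool,
    condCnot g (3 - (a + b)) b (condCnot f a (3 - (a + b))
      (condCnot g (3 - (a + b)) b (condCnot f a (3 - (a + b)) v))) = condCnot (f && g) a b v := by
  decide +kernel

theorem condCnot_disj : ∀ a < 3, ∀ b < 3, a ≠ b → ∀ v < 8, ∀ f g : Bool,
    condCnot g a b (condCnot f a b
      (condCnot g (3 - (a + b)) b (condCnot f a (3 - (a + b))
      (condCnot g (3 - (a + b)) b (condCnot f a (3 - (a + b)) v))))) = condCnot (f || g) a b v := by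
  decide +kernel

theorem condCnot_neg : ∀ a < 3, ∀ b < 3, a ≠ b → ∀ v < 8, ∀ f : Bool,
    cnot a b (condCnot f a b v) = condCnot (!f) a b v := by
  decide +kernel

section

variable {C : Circuit} {x : List Bool} {s : Call}

theorem effect_void (v : ℕ) : (s.apply C .void).effect C x v = v := by
  simp [apply, effect, control]

theorem effect_one (v : ℕ) : (s.apply C .one).effect C x v = cnot s.src s.dst v := by
  simp [apply, effect, control]

theorem effect_refer (u a b v : ℕ) : (s.refer u a b).effect C x v =
    condCnot (((C.values x).take s.gate).getD u false) a b v := by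
  rw [Circuit.getD_take_values]
  by_cases h : s.gate ≤ u
  · have h' : ¬ u < s.gate := by omega
    simp [refer, effect, control, h, condCnot, h']
  · have h' : u < s.gate := by omega
    simp [refer, effect, control, h, condCnot, h', min_eq_left h'.le]

theorem effect_first (v : ℕ) : (s.apply C .first).effect C x v =
    condCnot (((C.values x).take s.gate).getD (C.arg0At s.gate) false) s.src s.dst v :=
  effect_refer ..

theorem effect_second (v : ℕ) : (s.apply C .second).effect C x v =
    condCnot (((C.values x).take s.gate).getD (C.arg1At s.gate) false) s.src s.dst v :=
  effect_refer ..

theorem effect_toThird (v : ℕ) : (s.apply C .toThird).effect C x v =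
    condCnot (((C.values x).take s.gate).getD (C.arg0At s.gate) false) s.src (3 - (s.src + s.dst)) v :=
  effect_refer ..

theorem effect_fromThird (v : ℕ) : (s.apply C .fromThird).effect C x v =
    condCnot (((C.values x).take s.gate).getD (C.arg1At s.gate) false) (3 - (s.src + s.dst)) s.dst v :=
  effect_refer ..

theorem foldl_range_eight {β : Type} (f : β → ℕ → β) (v : β) : (List.range 8).foldl f v =
    f (f (f (f (f (f (f (f v 0) 1) 2) 3) 4) 5) 6) 7 := rfl

/-- The eight calls together have the effect of the original call. -/
theorem foldl_effect_next (hC : ∀ g ∈ C.gates, g.fanIn ≤ 2) (hs : s.Good) {v : ℕ} (hv : v < 8) :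
    (List.range 8).foldl (fun v δ => (s.next C δ).effect C x v) v = s.effect C x v := by
  obtain ⟨ha, hb, hab⟩ := hs
  rw [foldl_range_eight]
  by_cases hm : s.mode = 2
  · have he : s.effect C x v = condCnot (C.gateValue x s.gate) s.src s.dst v := by
      simp [effect, control, hm, condCnot]
    rw [he]
    simp only [next, expansionAt, hm, if_true]
    rcases hg : C.gates[s.gate]? with _ | g
    · rw [Circuit.gateValue_of_none hg]
      rcases Circuit.kindAt_of_none hg with hk | hk <;>
        simp [hk, expansion, effect_void, condCnot]
    · have hi := Circuit.items_of_gates hg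
      have hf := hC g (List.mem_of_getElem? hg)
      cases g with
      | input i =>
        have hk : C.kindAt s.gate = 1 := by rw [Circuit.kindAt, hi]; rfl
        simp only [hk, expansion, effect_void]
        exact he
      | neg i =>
        have hk : C.kindAt s.gate = 2 := by rw [Circuit.kindAt, hi]; rfl
        have h0 : C.arg0At s.gate = i := by rw [Circuit.arg0At, hi]; rfl
        simp only [hk, expansion, effect_void, effect_first, effect_one, h0]
        rw [condCnot_neg _ ha _ hb hab v hv, Circuit.gateValue_eq hg]
        rfl
      | conj js =>
        have hk : C.kindAt s.gate = 3 := by rw [Circuit.kindAt, hi]; rfl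
        have hn : C.nargsAt s.gate = js.length := by rw [Circuit.nargsAt, hi]; rfl
        have h0 : C.arg0At s.gate = js.getD 0 0 := by rw [Circuit.arg0At, hi]; rfl
        have h1 : C.arg1At s.gate = js.getD 1 0 := by rw [Circuit.arg1At, hi]; rfl
        rw [Circuit.gateValue_eq hg]
        simp only [hk, hn]
        match js, hf with
        | [], _ => simp [expansion, effect_void, effect_one, Gate.value, condCnot]
        | [i], _ => simp [expansion, effect_void, effect_first, Gate.value, h0]
        | [i, j], _ =>
          simpa [expansion, effect_void, effect_toThird, effect_fromThird, Gate.value, h0, h1] using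
            condCnot_conj _ ha _ hb hab v hv _ _
      | disj js =>
        have hk : C.kindAt s.gate = 4 := by rw [Circuit.kindAt, hi]; rfl
        have hn : C.nargsAt s.gate = js.length := by rw [Circuit.nargsAt, hi]; rfl
        have h0 : C.arg0At s.gate = js.getD 0 0 := by rw [Circuit.arg0At, hi]; rfl
        have h1 : C.arg1At s.gate = js.getD 1 0 := by rw [Circuit.arg1At, hi]; rfl
        rw [Circuit.gateValue_eq hg]
        simp only [hk, hn]
        match js, hf with
        | [], _ => simp [expansion, effect_void, Gate.value, condCnot]
        | [i], _ => simp [expansion, effect_void, effect_first, Gate.value, h0]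
        | [i, j], _ =>
          simpa [expansion, effect_void, effect_first, effect_second, effect_toThird,
            effect_fromThird, Gate.value, h0, h1] using
            condCnot_disj _ ha _ hb hab v hv _ _
  · simp only [next, expansionAt, hm, if_false, if_true, one_ne_zero,
      OfNat.ofNat_ne_zero, effect_void]
    rfl

theorem next_depth {d : ℕ} (hd : s.mode = 2 → C.depths.getD s.gate 0 ≤ d + 1) {δ : ℕ}
    (hm : (s.next C δ).mode = 2) : C.depths.getD (s.next C δ).gate 0 ≤ d := by
  by_cases hs : s.mode = 2
  · rw [next, expansionAt, if_pos hs] at hm ⊢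
    obtain ⟨h1, h2, h3⟩ := of_expansion_eq (e := expansion _ _ δ) rfl
      (K := C.kindAt s.gate) (N := min (C.nargsAt s.gate) 3)
    generalize expansion _ _ δ = e at h1 h2 h3 hm
    have hd := hd hs
    rcases hg : C.gates[s.gate]? with _ | g
    · rcases Circuit.kindAt_of_none hg with hk | hk <;>
        cases e <;> simp_all [apply]
    have hi := Circuit.items_of_gates hg
    have hk : C.kindAt s.gate = g.symbol.kind := by rw [Circuit.kindAt, hi]; rfl
    have hn : C.nargsAt s.gate = g.args.length := by rw [Circuit.nargsAt, hi]; rfl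
    have e0 : C.arg0At s.gate = g.args.getD 0 0 := by rw [Circuit.arg0At, hi]; rfl
    have e1 : C.arg1At s.gate = g.args.getD 1 0 := by rw [Circuit.arg1At, hi]; rfl
    rw [hk, hn] at h2 h3
    rw [hk] at h1
    have hr : ∀ i, i < g.args.length → g.symbol.kind ≠ 1 → g.args.getD i 0 ∈ g.refs := by
      intro i hi hk
      rw [List.getD_eq_getElem _ _ hi]
      cases g with
      | input k => exact absurd rfl hk
      | neg k => exact List.getElem_mem _
      | conj js => exact List.getElem_mem _
      | disj js => exact List.getElem_mem _
    have key : ∀ i a b, i < g.args.length → g.symbol.kind ≠ 1 →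
        (s.refer (g.args.getD i 0) a b).mode = 2 →
        C.depths.getD (s.refer (g.args.getD i 0) a b).gate 0 ≤ d := by
      intro i a b hi hk hm
      have hlt : g.args.getD i 0 < s.gate := by
        by_contra h
        have hm : (if s.gate ≤ g.args.getD i 0 then 0 else 2) = 2 := hm
        rw [if_pos (not_lt.1 h)] at hm
        cases hm
      have := Circuit.depth_ref hg (hr i hi hk) hlt
      rw [refer, min_eq_left hlt.le]
      exact Nat.lt_succ_iff.1 (this.trans_le hd)
    have h0 : g.symbol.kind = 2 → 0 < g.args.length := by
      intro h
      cases g <;> simp [Gate.symbol, Sym.kind, Gate.args] at h ⊢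
    cases e with
    | void => cases hm
    | one => cases hm
    | stay =>
      have h1 := h1 rfl
      cases g with
      | input k =>
        rw [apply, Circuit.getD_depths hg (by simp [Gate.refs])]
        exact Nat.zero_le _
      | neg k => cases h1
      | conj js => cases h1
      | disj js => cases h1
    | first =>
      rw [apply, e0] at hm ⊢
      have := h2 (Or.inl rfl)
      exact key _ _ _ (by omega) (by omega) hm
    | second =>
      rw [apply, e1] at hm ⊢
      have := h3 (Or.inl rfl)
      exact key _ _ _ (by omega) (by omega) hm
    | toThird =>
      rw [apply, e0] at hm ⊢
      have := h2 (Or.inr rfl)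
      exact key _ _ _ (by omega) (by omega) hm
    | fromThird =>
      rw [apply, e1] at hm ⊢
      have := h3 (Or.inr rfl)
      exact key _ _ _ (by omega) (by omega) hm
  · rw [next, expansionAt, if_neg hs] at hm
    split at hm
    · exact absurd hm hs
    · cases hm

/-- The instruction that remains of a call when it is not expanded any further: its control is a
constant or an input bit. -/
def leafControl (C : Circuit) (x : List Bool) (s : Call) : Bool :=
  s.mode == 1 || (s.mode == 2 && (C.kindAt s.gate == 1 && x.getD (C.arg0At s.gate) false))

/-- The call number `t` after `d` rounds of expansion; the digits of `t` in base `8` tell which of the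
eight calls to follow. -/
def walk (C : Circuit) (d : ℕ) (s : Call) (t : ℕ) : Call :=
  (List.range d).foldl (fun s i => s.next C (t / 8 ^ (d - 1 - i) % 8)) s

theorem walk_succ (d : ℕ) {δ r : ℕ} (hδ : δ < 8) (hr : r < 8 ^ d) :
    walk C (d + 1) s (δ * 8 ^ d + r) = walk C d (s.next C δ) r := by
  rw [walk, List.range_succ_eq_map, List.foldl_cons, List.foldl_map, walk]
  have h0 : (δ * 8 ^ d + r) / 8 ^ (d + 1 - 1 - 0) % 8 = δ := by
    rw [show d + 1 - 1 - 0 = d by omega, mul_comm, Nat.mul_add_div (by positivity),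
      Nat.div_eq_of_lt hr, add_zero, Nat.mod_eq_of_lt hδ]
  rw [h0]
  refine List.foldl_ext _ _ _ fun s i hi => ?_
  have hi := List.mem_range.1 hi
  congr 1
  obtain ⟨e, rfl⟩ : ∃ e, d = e + 1 + i := ⟨d - 1 - i, by omega⟩
  rw [show e + 1 + i + 1 - 1 - (i + 1) = e by omega, show e + 1 + i - 1 - i = e by omega,
    show δ * 8 ^ (e + 1 + i) + r = 8 ^ e * (8 * (8 ^ i * δ)) + r by ring,
    Nat.mul_add_div (by positivity), Nat.mul_add_mod]

theorem Good.walk (hs : s.Good) (d t : ℕ) : (walk C d s t).Good := by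
  unfold Call.walk
  generalize List.range d = l
  induction l generalizing s with
  | nil => exact hs
  | cons i l ih => exact ih (hs.next _)

theorem foldl_range_mul {β : Type} (f : β → ℕ → β) (m k : ℕ) (v : β) :
    (List.range (m * k)).foldl f v =
      (List.range m).foldl (fun v δ => (List.range k).foldl (fun v r => f v (δ * k + r)) v) v := by
  induction m with
  | zero => simp
  | succ m ih =>
    rw [Nat.succ_mul, List.range_add, List.foldl_append, ih, List.range_succ, List.foldl_append,
      List.foldl_map]
    rfl

/-- Expanding a call `d` times leaves its effect unchanged. If the depth of the gate is at most `d`,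
this leads to instructions that are controlled by input bits. -/
theorem foldl_leaf (hC : ∀ g ∈ C.gates, g.fanIn ≤ 2) {d : ℕ} :
    ∀ {s : Call}, s.Good → (s.mode = 2 → C.depths.getD s.gate 0 ≤ d) → ∀ v < 8,
    (List.range (8 ^ d)).foldl (fun v t => condCnot ((walk C d s t).leafControl C x)
      (walk C d s t).src (walk C d s t).dst v) v = s.effect C x v := by
  induction d with
  | zero =>
    intro s _ hd v _
    have : s.leafControl C x = s.control C x := by
      unfold leafControl control
      by_cases hm : s.mode = 2
      · congr 2
        rcases hg : C.gates[s.gate]? with _ | g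
        · rw [Circuit.gateValue_of_none hg]
          rcases Circuit.kindAt_of_none hg with hk | hk <;> simp [hk]
        · have hi := Circuit.items_of_gates hg
          by_cases h : ∃ k, g = .input k
          · obtain ⟨k, rfl⟩ := h
            have hk : C.kindAt s.gate = 1 := by rw [Circuit.kindAt, hi]; rfl
            have h0 : C.arg0At s.gate = k := by rw [Circuit.arg0At, hi]; rfl
            rw [Circuit.gateValue_eq hg, hk, h0]
            rfl
          · push Not at h
            have := Circuit.depth_pos hg h
            have := hd hm
            omega
      · have hm' : (s.mode == 2) = false := by simpa using hm
        rw [hm']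
        rfl
    simp [walk, condCnot, effect, this]
  | succ d ih =>
    intro s hs hd v hv
    rw [pow_succ', foldl_range_mul, ← foldl_effect_next hC hs hv]
    have key : ∀ l : List ℕ, (∀ δ ∈ l, δ < 8) → ∀ v < 8,
        l.foldl (fun v δ => (List.range (8 ^ d)).foldl (fun v r =>
          condCnot ((Call.walk C (d + 1) s (δ * 8 ^ d + r)).leafControl C x)
            (Call.walk C (d + 1) s (δ * 8 ^ d + r)).src
            (Call.walk C (d + 1) s (δ * 8 ^ d + r)).dst v) v) v =
        l.foldl (fun v δ => (s.next C δ).effect C x v) v := by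
      intro l
      induction l with
      | nil => exact fun _ _ _ => rfl
      | cons δ l ihl =>
        intro hl v hv
        have hδ := hl δ List.mem_cons_self
        rw [List.foldl_cons, List.foldl_cons]
        have h1 : (List.range (8 ^ d)).foldl (fun v r =>
            condCnot ((Call.walk C (d + 1) s (δ * 8 ^ d + r)).leafControl C x)
            (Call.walk C (d + 1) s (δ * 8 ^ d + r)).src
            (Call.walk C (d + 1) s (δ * 8 ^ d + r)).dst v) v = (s.next C δ).effect C x v := by
          rw [← ih (hs.next δ) ?_ v hv]
          · refine List.foldl_ext _ _ _ fun v r hr => ?_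
            rw [walk_succ d hδ (List.mem_range.1 hr)]
          · intro hm
            exact next_depth hd hm
        rw [h1]
        exact ihl (fun δ hδ => hl δ (List.mem_cons_of_mem _ hδ)) _ ((hs.next δ).effect_lt C x hv)
    exact key _ (fun δ hδ => List.mem_range.1 hδ) v hv

end

end Call

/-! ### The reduction -/

open Chess (markerPosition cnotMoves track)

section Reduction

variable (C : Circuit) (d : ℕ)

/-- The call that adds the output of the circuit to bit `1` of the memory if bit `0` is set. -/
def rootCall : Call := ⟨2, C.arg0At C.gates.length, 0, 1⟩

theorem rootCall_good : (rootCall C).Good := ⟨by simp [rootCall], by simp [rootCall], by simp [rootCall]⟩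

/-- The gate of the reduction that controls an instruction, where `n` is the length of the input:
gate `0` is true, gate `1` is false, and gates `2 + 2 * i` and `3 + 2 * i` are input bit `i` and its
negation. -/
def controlGate (n : ℕ) (s : Call) : ℕ :=
  if s.mode = 1 then 0
  else if s.mode = 2 then
    if C.kindAt s.gate = 1 then if n ≤ C.arg0At s.gate then 1 else 2 + 2 * C.arg0At s.gate else 1
  else 1

/-- The gate with the negation of a gate used as a control. -/
def negatedGate (c : ℕ) : ℕ := if c = 1 then 0 else c + 1

/-- The bits of the moves for `cnot a b`. -/
def cnotBits (a b : ℕ) (c : Bool) : List Bool := (cnotMoves a b c).flatMap Chess.Move.bits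

/-- The gate that supplies a bit whose value is `p.1` or `p.2` according to the value of gate `c`. -/
def selectGate (c : ℕ) (p : Bool × Bool) : ℕ :=
  if p.1 = p.2 then if p.1 then 0 else 1 else if p.1 then c else negatedGate c

/-- The gates that supply the bits of the moves for an instruction. -/
def slotOutputs (c a b : ℕ) : List ℕ :=
  ((cnotBits a b true).zip (cnotBits a b false)).map (selectGate c)

/-- The gates of the reduction: constants, inputs and their negations. -/
def literalGates (n : ℕ) : List Gate :=
  (List.range (n + 1)).flatMap fun
    | 0 => [.conj [], .disj []]
    | i + 1 => [.input i, .neg (2 + 2 * i)]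

/-- The reduction writes down the initial position and the moves for all instructions. -/
def reductionCircuit (n : ℕ) : Circuit where
  gates := literalGates n
  outputs := ((markerPosition 1).bits.map fun b => if b then 0 else 1) ++
    (List.range (8 ^ d)).flatMap fun t =>
      let s := Call.walk C d (rootCall C) t
      slotOutputs (controlGate C n s) s.src s.dst

variable {C d}

theorem literalGates_get {n i r : ℕ} (hi : i < n + 1) (hr : r < 2) :
    (literalGates n)[i * 2 + r]? = (match i with
    | 0 => [Gate.conj [], Gate.disj []]
    | i + 1 => [Gate.input i, Gate.neg (2 + 2 * i)])[r]? := by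
  rw [literalGates, getElem?_flatMap_range _ 2 _ hi hr]
  intro p _
  cases p <;> rfl

theorem length_literalGates (n : ℕ) : (literalGates n).length = (n + 1) * 2 :=
  length_flatMap_range _ 2 (n + 1) fun p _ => by cases p <;> rfl

theorem literal_value {n : ℕ} {os : List ℕ} {x : List Bool} :
    Circuit.gateValue ⟨literalGates n, os⟩ x 0 = true ∧
    Circuit.gateValue ⟨literalGates n, os⟩ x 1 = false ∧
    ∀ i < n, Circuit.gateValue ⟨literalGates n, os⟩ x (2 + 2 * i) = x.getD i false ∧
      Circuit.gateValue ⟨literalGates n, os⟩ x (3 + 2 * i) = !x.getD i false := by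
  set R : Circuit := ⟨literalGates n, os⟩
  have h0 : R.gates[0]? = some (.conj []) := literalGates_get (i := 0) (r := 0) (by omega) (by omega)
  have h1 : R.gates[1]? = some (.disj []) := literalGates_get (i := 0) (r := 1) (by omega) (by omega)
  refine ⟨?_, ?_, fun i hi => ?_⟩
  · rw [Circuit.gateValue_eq h0]; rfl
  · rw [Circuit.gateValue_eq h1]; rfl
  · have h2 : R.gates[2 + 2 * i]? = some (.input i) := by
      rw [show 2 + 2 * i = (i + 1) * 2 + 0 by ring]
      exact literalGates_get (by omega) (by omega)
    have h3 : R.gates[3 + 2 * i]? = some (.neg (2 + 2 * i)) := by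
      rw [show 3 + 2 * i = (i + 1) * 2 + 1 by ring]
      exact literalGates_get (by omega) (by omega)
    have e2 : R.gateValue x (2 + 2 * i) = x.getD i false := by rw [Circuit.gateValue_eq h2]; rfl
    refine ⟨e2, ?_⟩
    rw [Circuit.gateValue_eq h3, Gate.value, Circuit.getD_take_values, if_pos (by omega), e2]

theorem controlGate_value {s : Call} {os : List ℕ} (x : List Bool) :
    let R : Circuit := ⟨literalGates x.length, os⟩
    R.gateValue x (controlGate C x.length s) = s.leafControl C x ∧
    R.gateValue x (negatedGate (controlGate C x.length s)) = !s.leafControl C x := by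
  intro R
  obtain ⟨h0, h1, h2⟩ := literal_value (n := x.length) (os := os) (x := x)
  unfold controlGate Call.leafControl
  by_cases e1 : s.mode = 1
  · simpa [e1, negatedGate] using ⟨h0, h1⟩
  have e1' : (s.mode == 1) = false := by simpa using e1
  rw [if_neg e1, e1', Bool.false_or]
  by_cases e2 : s.mode = 2
  · have e2' : (s.mode == 2) = true := by simpa using e2
    rw [if_pos e2, e2', Bool.true_and]
    by_cases e3 : C.kindAt s.gate = 1
    · have e3' : (C.kindAt s.gate == 1) = true := by simpa using e3
      rw [if_pos e3, e3', Bool.true_and]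
      by_cases e4 : x.length ≤ C.arg0At s.gate
      · rw [if_pos e4, List.getD_eq_default _ _ e4]
        exact ⟨h1, h0⟩
      · obtain ⟨h3, h4⟩ := h2 _ (not_le.1 e4)
        have e : negatedGate (2 + 2 * C.arg0At s.gate) = 3 + 2 * C.arg0At s.gate := by
          rw [negatedGate, if_neg (by omega)]; omega
        rw [if_neg e4, e]
        exact ⟨h3, h4⟩
    · have e3' : (C.kindAt s.gate == 1) = false := by simpa using e3
      rw [if_neg e3, e3']
      exact ⟨h1, h0⟩
  · have e2' : (s.mode == 2) = false := by simpa using e2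
    rw [if_neg e2, e2']
    exact ⟨h1, h0⟩

theorem length_cnotBits {a b : ℕ} (ha : a < 3) (hb : b < 3) (hab : a ≠ b) (c : Bool) :
    (cnotBits a b c).length = 1680 := by
  simp [cnotBits, List.length_flatMap, Chess.length_cnotMoves ha hb hab]

theorem map_slotOutputs {R : Circuit} {x : List Bool} {c : ℕ} {v : Bool}
    (h0 : R.gateValue x 0 = true) (h1 : R.gateValue x 1 = false) (hc : R.gateValue x c = v)
    (hc' : R.gateValue x (negatedGate c) = !v) {a b : ℕ} (ha : a < 3) (hb : b < 3) (hab : a ≠ b) :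
    (slotOutputs c a b).map (R.gateValue x) = cnotBits a b v := by
  have h : ∀ p q, R.gateValue x (selectGate c (p, q)) = if v then p else q := by
    intro p q
    cases p <;> cases q <;> cases v <;> simp [selectGate, h0, h1, hc, hc']
  have hl : (cnotBits a b true).length = (cnotBits a b false).length := by
    rw [length_cnotBits ha hb hab, length_cnotBits ha hb hab]
  rw [slotOutputs, List.map_map]
  cases v
  · refine Eq.trans ?_ (List.map_snd_zip hl.ge)
    refine List.map_congr_left fun p _ => ?_
    rw [Function.comp_apply, h p.1 p.2]
    rfl
  · refine Eq.trans ?_ (List.map_fst_zip hl.le)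
    refine List.map_congr_left fun p _ => ?_
    rw [Function.comp_apply, h p.1 p.2]
    rfl

theorem track_instructions (f : ℕ → Call) (c : ℕ → Bool) (hf : ∀ t, (f t).Good) (l : List ℕ) {v : ℕ}
    (hv : v < 8) : track (markerPosition v) (l.flatMap fun t => cnotMoves (f t).src (f t).dst (c t)) =
      some (markerPosition (l.foldl
        (fun v t => Call.condCnot (c t) (f t).src (f t).dst v) v)) := by
  induction l generalizing v with
  | nil => rfl
  | cons t l ih =>
    obtain ⟨h1, h2, h3⟩ := hf t
    rw [List.flatMap_cons, Chess.track_append, Chess.track_cnotMoves h1 h2 h3 hv, List.foldl_cons]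
    refine ih ?_
    split
    · exact Chess.cnot_lt _ h1 _ h2 v hv
    · exact hv

/-- The instructions compute the output of the circuit. -/
theorem reductionCircuit_eval (hC : ∀ g ∈ C.gates, g.fanIn ≤ 2) (hd : C.depth ≤ d) {b : Bool}
    {x : List Bool} (hx : C.eval x = [b]) : ∃ ms : List Chess.Move,
      (reductionCircuit C d x.length).eval x = Chess.instanceBits (markerPosition 1, ms) ∧
      track (markerPosition 1) ms = some (markerPosition (if b then 3 else 1)) := by
  have hgood := rootCall_good C
  refine ⟨(List.range (8 ^ d)).flatMap fun t =>
    let s := Call.walk C d (rootCall C) t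
    cnotMoves s.src s.dst (s.leafControl C x), ?_, ?_⟩
  · obtain ⟨h0, h1, -⟩ := literal_value (n := x.length) (os := (reductionCircuit C d x.length).outputs)
      (x := x)
    rw [Chess.instanceBits, Circuit.eval]
    change List.map (Circuit.gateValue (reductionCircuit C d x.length) x) _ = _
    rw [reductionCircuit, List.map_append, List.map_flatMap, List.map_map, List.flatMap_assoc]
    congr 1
    · refine (List.map_congr_left fun p _ => ?_).trans (List.map_id _)
      cases p
      · exact h1
      · exact h0
    · refine List.flatMap_congr fun t _ => ?_
      obtain ⟨g1, g2, g3⟩ := hgood.walk d t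
      obtain ⟨e1, e2⟩ := controlGate_value (C := C) (s := Call.walk C d (rootCall C) t)
        (os := (reductionCircuit C d x.length).outputs) x
      exact map_slotOutputs h0 h1 e1 e2 g1 g2 g3
  · rw [track_instructions (fun t => Call.walk C d (rootCall C) t)
      (fun t => (Call.walk C d (rootCall C) t).leafControl C x) (fun t => hgood.walk d t) _
      (by omega), Call.foldl_leaf hC hgood (fun _ => (C.depths_le_depth _).trans hd) 1 (by omega)]
    have hb : C.gateValue x (C.arg0At C.gates.length) = b := by
      have hl := congrArg List.length hx
      rw [Circuit.length_eval] at hl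
      obtain ⟨o, ho⟩ := List.length_eq_one_iff.1 hl
      have h2 : C.arg0At C.gates.length = o := by
        rw [Circuit.arg0At, Circuit.items, List.getElem?_append_right (by simp)]
        simp [ho]
      rw [h2]
      rw [Circuit.eval, ho] at hx
      simpa [Circuit.gateValue] using hx
    congr 2
    simp only [Call.effect, Call.control, rootCall, hb]
    cases b <;> rfl

theorem eight_pow_eq (c n : ℕ) : 8 ^ (c * (Nat.log 2 n + 1)) = widthOf n ^ (3 * c) := by
  rw [show (8 : ℕ) = 2 ^ 3 by norm_num, ← pow_mul,
    show 3 * (c * (Nat.log 2 n + 1)) = (Nat.log 2 n + 1) * (3 * c) by ring, pow_mul, widthOf]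

theorem eight_pow_le (c n : ℕ) : 8 ^ (c * (Nat.log 2 n + 1)) ≤ 2 ^ (3 * c) * (n + 2) ^ (3 * c) := by
  rw [← mul_pow, eight_pow_eq]
  exact Nat.pow_le_pow_left ((widthOf_le n).trans (by omega)) _

theorem reductionCircuit_isAC0 (F : Family) (c : ℕ) :
    Family.IsAC0 fun n => reductionCircuit (F n) (c * (Nat.log 2 n + 1)) n := by
  obtain ⟨e, he⟩ := exists_pow_add_le (4 + 265 + 2 ^ (3 * c) * 1680) (3 * c + 1)
  refine ⟨e + 2, fun n => ⟨le_trans ?_ (pow_add_le_pow_add (Nat.le_add_right e 2) n), ?_⟩⟩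
  · have hgood := rootCall_good (F n)
    have hf : ∀ g ∈ (reductionCircuit (F n) (c * (Nat.log 2 n + 1)) n).gates, g.fanIn ≤ 1 := by
      intro g hg
      simp only [reductionCircuit, literalGates, List.mem_flatMap, List.mem_range] at hg
      obtain ⟨i, -, hg⟩ := hg
      cases i <;> simp only [List.mem_cons, List.not_mem_nil, or_false] at hg <;>
        rcases hg with rfl | rfl <;> simp [Gate.fanIn]
    refine (Circuit.size_le hf).trans (le_trans ?_ (he n))
    have h1 : (reductionCircuit (F n) (c * (Nat.log 2 n + 1)) n).outputs.length =
        265 + 8 ^ (c * (Nat.log 2 n + 1)) * 1680 := by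
      rw [reductionCircuit, List.length_append, length_flatMap_range _ 1680, List.length_map,
        Chess.length_positionBits]
      intro t _
      obtain ⟨g1, g2, g3⟩ := hgood.walk (C := F n) (c * (Nat.log 2 n + 1)) t
      simp only [slotOutputs, List.length_map, List.length_zip]
      rw [length_cnotBits g1 g2 g3, length_cnotBits g1 g2 g3, min_self]
    have h2 := eight_pow_le c n
    have h3 : (n + 2) ^ (3 * c) ≤ (n + 2) ^ (3 * c + 1) := Nat.pow_le_pow_right (by omega) (by omega)
    have h4 : n + 2 ≤ (n + 2) ^ (3 * c + 1) := Nat.le_self_pow (by omega) _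
    rw [h1]
    have h5 : (reductionCircuit (F n) (c * (Nat.log 2 n + 1)) n).gates.length = (n + 1) * 2 :=
      length_literalGates n
    rw [h5]
    have h6 := Nat.mul_le_mul_left (2 ^ (3 * c)) h3
    have h7 : (4 + 265 + 2 ^ (3 * c) * 1680) * (n + 2) ^ (3 * c + 1) =
        269 * (n + 2) ^ (3 * c + 1) + 1680 * (2 ^ (3 * c) * (n + 2) ^ (3 * c + 1)) := by ring
    rw [h7]
    omega
  · refine le_trans (Circuit.depth_le (b := 1) fun j hj => ?_) (by omega)
    set R := reductionCircuit (F n) (c * (Nat.log 2 n + 1)) n with hR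
    have hj : j < (n + 1) * 2 := by rwa [← length_literalGates n]
    obtain ⟨i, r, hi, hr, rfl⟩ : ∃ i r, i < n + 1 ∧ r < 2 ∧ j = i * 2 + r :=
      ⟨j / 2, j % 2, by omega, by omega, by omega⟩
    have hg : ∀ r < 2, R.gates[i * 2 + r]? = _ := fun r hr => literalGates_get hi hr
    have h0 := hg 0 (by omega)
    have h1 := hg 1 (by omega)
    obtain rfl | rfl : r = 0 ∨ r = 1 := by omega
    · rcases i with _ | i
      · rw [Circuit.getD_depths (g := .conj []) h0 (by simp [Gate.refs])]
        simp [Gate.depth]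
      · rw [Circuit.getD_depths (g := .input i) h0 (by simp [Gate.refs])]
        simp [Gate.depth]
    · rcases i with _ | i
      · rw [Circuit.getD_depths (g := .disj []) h1 (by simp [Gate.refs])]
        simp [Gate.depth]
      · rw [Circuit.getD_depths (g := .neg (2 + 2 * i)) h1 (by simp [Gate.refs]; omega)]
        refine Gate.depth_le fun k hk => ?_
        obtain rfl : k = (i + 1) * 2 + 0 := by
          simp only [Gate.refs, List.mem_singleton] at hk
          omega
        rw [Circuit.getD_depths (g := .input i) h0 (by simp [Gate.refs])]
        simp [Gate.depth]

end Reduction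

/-! ### Uniformity of the reduction -/

theorem Circuit.kindAt_lt (C : Circuit) (j : ℕ) : C.kindAt j < 6 := by
  unfold kindAt
  rcases C.items[j]? with _ | ⟨s, l⟩
  · simp
  · cases s <;> simp [Sym.kind]

/-- The components of a call, by number. -/
def Call.comp (s : Call) : ℕ → ℕ
  | 0 => s.mode
  | 1 => s.gate
  | 2 => s.src
  | _ => s.dst

section

variable {α : Type} {D : Set α} {n : α → ℕ} {X : List (α → ℕ)}

theorem LS.powEight {e : α → ℕ} (he : LS D n X e) (hb : PolyBounded D n fun a => 8 ^ e a) :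
    LS D n X fun a => 8 ^ e a := by
  refine loop_one (fun a i => 8 ^ i) he ?_ ((const 1).congr fun _ _ => rfl) ?_
  · obtain ⟨c, hc⟩ := hb
    exact ⟨c, fun a ha i hi => (Nat.pow_le_pow_right (by omega) hi).trans (hc a ha)⟩
  · intro Y h1 h2 h3
    exact (h3.mul (const 8)).congr fun p _ => (pow_succ 8 p.2).symm

variable {F : Family}

theorem Call.ls_next (hF : LUniform F) (hm : LS D n X n) {s : α → Call} {δ : α → ℕ}
    (hs : ∀ c < 4, LS D n X fun a => (s a).comp c) (hδ : LS D n X δ) (hδ8 : ∀ a ∈ D, δ a < 8) :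
    ∀ c < 4, LS D n X fun a => ((s a).next (F (n a)) (δ a)).comp c := by
  have s0 : LS D n X fun a => (s a).mode := hs 0 (by omega)
  have s1 : LS D n X fun a => (s a).gate := hs 1 (by omega)
  have s2 : LS D n X fun a => (s a).src := hs 2 (by omega)
  have s3 : LS D n X fun a => (s a).dst := hs 3 (by omega)
  obtain ⟨hk, hN, h0, h1, -⟩ := hF.lookup hm s1
  have hop : LSFin D n X fun a => (s a).expansionAt (F (n a)) (δ a) := by
    intro φ
    have ht : LS D n X fun a => φ (expansion ((F (n a)).kindAt (s a).gate)
        (min ((F (n a)).nargsAt (s a).gate) 3) (δ a)) := by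
      refine LS.cases 6 (G := fun k a => φ (expansion k
        (min ((F (n a)).nargsAt (s a).gate) 3) (δ a))) hk
        (fun a _ => Circuit.kindAt_lt _ _) fun k _ => ?_
      refine LS.cases 4 (G := fun N a => φ (expansion k N (δ a)))
        ((hN.min (.const 3)).mono_dom Set.inter_subset_left) (fun a _ => by omega) fun N _ => ?_
      refine LS.cases 8 (G := fun δ _ => φ (expansion k N δ))
        (hδ.mono_dom (Set.inter_subset_left.trans Set.inter_subset_left))
        (fun a ha => hδ8 a ha.1.1) fun δ _ => .const _
    refine (LS.ite_eq s0 (.const 2) (ht.mono_dom Set.inter_subset_left)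
      (LS.ite_eq (hδ.mono_dom Set.inter_subset_left) .zero (.const (φ .stay))
      (.const (φ .void)))).congr fun a _ => ?_
    simp only [expansionAt]
    split_ifs <;> rfl
  intro c hc
  refine hop.cases (G := fun e a => ((s a).apply (F (n a)) e).comp c) fun e => ?_
  refine LS.mono_dom ?_ Set.inter_subset_left
  have third := (LS.const (D := D) (n := n) (X := X) 3).sub (s2.add s3)
  have hrefer : ∀ {u x y : α → ℕ}, LS D n X u → LS D n X x → LS D n X y →
      LS D n X fun a => ((s a).refer (u a) (x a) (y a)).comp c := by
    intro u x y hu hx hy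
    obtain rfl | rfl | rfl | rfl : c = 0 ∨ c = 1 ∨ c = 2 ∨ c = 3 := by omega
    · exact .ite_le s1 hu (.const 0) (.const 2)
    · exact hu.min s1
    · exact hx
    · exact hy
  cases e with
  | void =>
    obtain rfl | rfl | rfl | rfl : c = 0 ∨ c = 1 ∨ c = 2 ∨ c = 3 := by omega
    · exact .const 0
    · exact s1
    · exact s2
    · exact s3
  | stay => exact hs c hc
  | one =>
    obtain rfl | rfl | rfl | rfl : c = 0 ∨ c = 1 ∨ c = 2 ∨ c = 3 := by omega
    · exact .const 1
    · exact s1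
    · exact s2
    · exact s3
  | first => exact hrefer h0 s2 s3
  | second => exact hrefer h1 s2 s3
  | toThird => exact hrefer h0 s2 third
  | fromThird => exact hrefer h1 third s3

theorem Call.next_le {C : Circuit} {s : Call} {δ : ℕ} :
    (s.next C δ).mode ≤ max s.mode 2 ∧ (s.next C δ).gate ≤ s.gate := by
  unfold next
  cases s.expansionAt C δ <;> simp only [apply, refer] <;> constructor <;>
    first | omega | (split <;> omega)

theorem Call.walk_comp_le {C : Circuit} {s : Call} (hs : s.Good) (hm : s.mode ≤ 2) (f : ℕ → ℕ)
    (i c : ℕ) : ((List.range i).foldl (fun s i => s.next C (f i)) s).comp c ≤ s.gate + 3 := by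
  have key : ((List.range i).foldl (fun s i => s.next C (f i)) s).Good ∧
      ((List.range i).foldl (fun s i => s.next C (f i)) s).mode ≤ 2 ∧
      ((List.range i).foldl (fun s i => s.next C (f i)) s).gate ≤ s.gate := by
    induction i with
    | zero => exact ⟨hs, hm, le_rfl⟩
    | succ i ih =>
      obtain ⟨h1, h2, h3⟩ := ih
      rw [List.range_succ, List.foldl_append]
      obtain ⟨h4, h5⟩ := next_le (C := C)
        (s := (List.range i).foldl (fun s i => s.next C (f i)) s) (δ := f i)
      exact ⟨h1.next _, h4.trans (by omega), h5.trans h3⟩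
  obtain ⟨⟨h1, h2, -⟩, h4, h5⟩ := key
  rcases c with _ | _ | _ | c <;> simp only [comp] <;> omega

theorem Call.ls_walk (hF : LUniform F) (hm : LS D n X n) (e : ℕ) {t : α → ℕ} (ht : LS D n X t) :
    ∀ c < 4, LS D n X fun a =>
      (walk (F (n a)) (e * (Nat.log 2 (n a) + 1)) (rootCall (F (n a))) (t a)).comp c := by
  have hd : LS D n X fun a => e * (Nat.log 2 (n a) + 1) := (LS.const e).mul hm.log.succ
  have hpoly : PolyBounded D n fun a => 8 ^ (e * (Nat.log 2 (n a) + 1)) :=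
    ((PolyBounded.const D n (2 ^ (3 * e))).mul
      ((hm.1.add (.const D n 2)).pow (3 * e))).mono fun a _ => eight_pow_le e (n a)
  obtain ⟨-, -, -, -, hlen⟩ := hF.lookup hm hm
  obtain ⟨-, -, hroot, -, -⟩ := hF.lookup hm hlen
  refine LS.loop (F := fun c a i => ((List.range i).foldl (fun s i => s.next (F (n a))
    (t a / 8 ^ (e * (Nat.log 2 (n a) + 1) - 1 - i) % 8)) (rootCall (F (n a)))).comp c) hd ?_ ?_ ?_
  · intro c _
    obtain ⟨b, hb⟩ := hroot.1.add (.const D n 3)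
    exact ⟨b, fun a ha i _ => (walk_comp_le (rootCall_good _) le_rfl _ i c).trans (hb a ha)⟩
  · intro c hc
    obtain rfl | rfl | rfl | rfl : c = 0 ∨ c = 1 ∨ c = 2 ∨ c = 3 := by omega
    · exact .const 2
    · exact hroot
    · exact .const 0
    · exact .const 1
  · intro Y h1 h2 h3
    have hexp := ((h1 _ hd).sub (.const 1)).sub h2
    have hpoly' : PolyBounded (loopDom D fun a => e * (Nat.log 2 (n a) + 1)) (fun p => n p.1)
        fun p => 8 ^ (e * (Nat.log 2 (n p.1) + 1) - 1 - p.2) := by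
      obtain ⟨b, hb⟩ := hpoly
      exact ⟨b, fun p hp => (Nat.pow_le_pow_right (by omega) (by omega)).trans (hb p.1 hp.1)⟩
    have hdigit := ((h1 _ ht).div (hexp.powEight hpoly')).mod (.const 8)
    have := ls_next hF (h1 _ hm) h3 hdigit fun p _ => Nat.mod_lt _ (by omega)
    intro c hc
    refine (this c hc).congr fun p _ => ?_
    rw [List.range_succ, List.foldl_append]
    rfl

theorem Prints.slotOutputs {c a b : α → ℕ} (hc : LS D n X c) (ha : LS D n X a) (hb : LS D n X b)
    (ha3 : ∀ p ∈ D, a p < 3) (hb3 : ∀ p ∈ D, b p < 3) :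
    Prints D n X fun p => (slotOutputs (c p) (a p) (b p)).flatMap CircuitComplexity.unary := by
  have hneg : LS D n X fun p => negatedGate (c p) :=
    .ite_eq hc (.const 1) .zero (hc.succ.mono_dom Set.inter_subset_left)
  refine Prints.cases 3 (O := fun a p => (CircuitComplexity.slotOutputs (c p) a (b p)).flatMap
    CircuitComplexity.unary) ha ha3 fun a _ => ?_
  refine Prints.cases 3 (O := fun b p => (CircuitComplexity.slotOutputs (c p) a b).flatMap
    CircuitComplexity.unary) (hb.mono_dom Set.inter_subset_left) (fun p hp => hb3 p hp.1)
    fun b _ => ?_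
  refine Prints.mono_dom ?_ (Set.inter_subset_left.trans Set.inter_subset_left)
  have : Prints D n X fun p => ((cnotBits a b true).zip (cnotBits a b false)).flatMap fun q =>
      CircuitComplexity.unary (selectGate (c p) q) := by
    refine .flatMap_list _ fun q _ => .unary ?_
    unfold selectGate
    split_ifs
    · exact .const 0
    · exact .const 1
    · exact hc
    · exact hneg
  exact this.congr fun p _ => by rw [CircuitComplexity.slotOutputs, List.flatMap_map]

end

/-- If the given circuits are uniform, then so is the reduction. -/
theorem reductionCircuit_lUniform {F : Family} (hF : LUniform F) (e : ℕ) :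
    LUniform fun n => reductionCircuit (F n) (e * (Nat.log 2 n + 1)) n := by
  refine LUniform.of_prints ?_
  have hn : LS Set.univ id [id] (id : ℕ → ℕ) := .var (by simp) (.size _ _)
  have hcount : LS Set.univ id [id] fun n : ℕ => 8 ^ (e * (Nat.log 2 n + 1)) :=
    (hn.widthOf.pow (3 * e)).congr fun n _ => (eight_pow_eq e n).symm
  have h1 : Prints Set.univ id [id] fun n : ℕ => (List.range (n + 1)).flatMap fun i =>
      if i = 0 then [Sym.conj, Sym.disj]
      else Sym.input :: unary (i - 1) ++ Sym.neg :: unary (2 + 2 * (i - 1)) := by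
    refine .loop (o := fun p : ℕ × ℕ => if p.2 = 0 then [Sym.conj, Sym.disj]
      else Sym.input :: unary (p.2 - 1) ++ Sym.neg :: unary (2 + 2 * (p.2 - 1))) hn.succ
      fun Y _ h2 => ?_
    refine .ite_eq h2 .zero (.cons _ (.cons _ .nil)) (Prints.mono_dom ?_ Set.inter_subset_left)
    exact (Prints.cons _ (.unary h2.pred)).append (.cons _ (.unary
      ((LS.const 2).add ((LS.const 2).mul h2.pred))))
  have h2 : Prints Set.univ id [id] fun _ : ℕ =>
      ((Chess.markerPosition 1).bits.map fun b => if b then 0 else 1).flatMap unary :=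
    .flatMap_list _ fun j _ => .unary (.const j)
  have h3 : Prints Set.univ id [id] fun n : ℕ => (List.range (8 ^ (e * (Nat.log 2 n + 1)))).flatMap
      fun t => (slotOutputs
        (controlGate (F n) n (Call.walk (F n) (e * (Nat.log 2 n + 1)) (rootCall (F n)) t))
        (Call.walk (F n) (e * (Nat.log 2 n + 1)) (rootCall (F n)) t).src
        (Call.walk (F n) (e * (Nat.log 2 n + 1)) (rootCall (F n)) t).dst).flatMap unary := by
    refine .loop (o := fun p : ℕ × ℕ => (slotOutputs
        (controlGate (F p.1) p.1
          (Call.walk (F p.1) (e * (Nat.log 2 p.1 + 1)) (rootCall (F p.1)) p.2))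
        (Call.walk (F p.1) (e * (Nat.log 2 p.1 + 1)) (rootCall (F p.1)) p.2).src
        (Call.walk (F p.1) (e * (Nat.log 2 p.1 + 1)) (rootCall (F p.1)) p.2).dst).flatMap unary)
      hcount fun Y h1 h2 => ?_
    have hn' := h1 _ hn
    have hw := Call.ls_walk hF hn' e h2
    have w0 := hw 0 (by omega)
    have w1 := hw 1 (by omega)
    obtain ⟨hk, -, h0, -, -⟩ := hF.lookup hn' w1
    have hgood := fun p : ℕ × ℕ =>
      (rootCall_good (F p.1)).walk (C := F p.1) (e * (Nat.log 2 p.1 + 1)) p.2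
    refine .slotOutputs ?_ (hw 2 (by omega)) (hw 3 (by omega)) (fun p _ => (hgood p).1)
      fun p _ => (hgood p).2.1
    refine LS.ite_eq w0 (.const 1) .zero (LS.mono_dom (LS.ite_eq w0 (.const 2)
      (LS.mono_dom (LS.ite_eq hk (.const 1) (LS.mono_dom (LS.ite_le hn' h0 (.const 1)
      (LS.mono_dom ?_ Set.inter_subset_left)) Set.inter_subset_left) (.const 1))
      Set.inter_subset_left) (.const 1)) Set.inter_subset_left)
    exact (LS.const 2).add ((LS.const 2).mul h0)
  refine (h1.append (.cons .output (h2.append h3))).congr fun n _ => ?_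
  simp only [Circuit.describe, reductionCircuit, literalGates, List.flatMap_append,
    List.flatMap_assoc]
  congr 1
  refine List.flatMap_congr fun i _ => ?_
  rcases i with _ | i
  · rfl
  · simp [Gate.describe]

/-- Every language with `NC¹` circuits reduces to chess state tracking. -/
theorem exists_reduction {L : Language Bool} {F : Family} (hF : F.IsNC1)
    (hL : ∀ x : (decisionProblem L).Instance,
      F.eval ((decisionProblem L).code x) = (decisionProblem L).answer x) :
    ∃ R S : Family, R.IsAC0 ∧ (LUniform F → LUniform R) ∧ S.IsAC0 ∧ LUniform S ∧
      ∀ x : (decisionProblem L).Instance, ∃ y : Chess.stateTracking.Instance,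
        R.eval ((decisionProblem L).code x) = Chess.stateTracking.code y ∧
        S.eval (Chess.stateTracking.answer y) = (decisionProblem L).answer x := by
  obtain ⟨e, he⟩ := hF
  refine ⟨fun n => reductionCircuit (F n) (e * (Nat.log 2 n + 1)) n,
    fun _ => ⟨[.input 14], [0]⟩, reductionCircuit_isAC0 F e,
    fun hF => reductionCircuit_lUniform hF e, ⟨2, fun n => ⟨?_, ?_⟩⟩, ?_, fun x => ?_⟩
  · simp [Circuit.size, Gate.fanIn]
  · simp [Circuit.depth, Gate.depth]
  · refine LUniform.of_prints ?_
    refine ((Prints.cons .input (.unary (.const 14))).append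
      (.cons .output (.unary (.const 0)))).congr fun n _ => ?_
    simp [Circuit.describe, Gate.describe]
  · obtain ⟨ms, h1, h2⟩ := reductionCircuit_eval (he _).2.2 (he _).2.1 (hL x)
    refine ⟨(Chess.markerPosition 1, ms), h1, ?_⟩
    have h3 : Chess.stateTracking.answer (Chess.markerPosition 1, ms) =
      Chess.stateBits (Chess.track (Chess.markerPosition 1) ms) := rfl
    obtain ⟨h4, h5⟩ := Chess.stateBits_markerPosition
    rw [h3, h2]
    simp only [Family.eval, Circuit.eval, Circuit.values, List.foldl_cons, List.foldl_nil,
      Gate.value, decisionProblem]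
    split
    · rename_i h; rw [h5]; simp [h]
    · rename_i h; rw [h4]; simp [h]

end CircuitComplexity

theorem corollary3p2 :
    CircuitComplexity.NC1Complete CircuitComplexity.LUniform Chess.stateTracking ∧
    CircuitComplexity.NC1Complete CircuitComplexity.NonUniform Chess.stateTracking := by
  obtain ⟨C, h1, h2, h3⟩ := Chess.exists_nc1_stateTracking
  refine ⟨⟨⟨C, h1, h2, h3⟩, ?_⟩, ⟨⟨C, h1, trivial, h3⟩, ?_⟩⟩
  · rintro L ⟨F, hF, hU, hL⟩
    obtain ⟨R, S, hR, hRU, hS, hSU, h⟩ := CircuitComplexity.exists_reduction hF hL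
    exact ⟨R, S, hR, hRU hU, hS, hSU, h⟩
  · rintro L ⟨F, hF, -, hL⟩
    obtain ⟨R, S, hR, -, hS, -, h⟩ := CircuitComplexity.exists_reduction hF hL
    exact ⟨R, S, hR, trivial, hS, trivial, h⟩
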